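/- **Notation.** All functions live on $(0,\infty)$ and are complex valued; $\nu,\mu\in\mathbb C$ are arbitrary. $P_\nu^\mu(z)$, $z>1$, is the Legendre function of the first kind, $\mathbb P_\nu^\mu(z)$, $-1<z<1$, is the Legendre function of the first kind on the cut, that is $$P_\nu^\mu(z)=\tfrac{1}{\Gamma(1-\mu)}\Big(\tfrac{z+1}{z-1}\Big)^{\mu/2}F\big(-\nu,\nu+1;1-\mu;\tfrac{1-z}{2}\big),\qquad \mathbb P_\nu^\mu(z)=\tfrac{1}{\Gamma(1-\mu)}\Big(\tfrac{1+z}{1-z}\Big)^{\mu/2}F\big(-\nu,\nu+1;1-\mu;\tfrac{1-z}{2}\big)$$ ($F$ is the Gauss hypergeometric function, continued analytically), and $P_\nu=P_\nu^0$ or $\mathbb P_\nu^0$. *Buschman–Erdélyi operators.* For $\operatorname{Re}\mu<1$, $$B_{0+}^{\nu,\mu}f(x)=\int_0^x (x^2-t^2)^{-\mu/2}P_\nu^\mu\big(\tfrac xt\big)f(t)\,dt,\qquad E_{0+}^{\nu,\mu}f(x)=\int_0^x (x^2-t^2)^{-\mu/2}\mathbb P_\nu^\mu\big(\tfrac tx\big)f(t)\,dt,$$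 $$B_{-}^{\nu,\mu}f(x)=\int_x^\infty (t^2-x^2)^{-\mu/2}P_\nu^\mu\big(\tfrac tx\big)f(t)\,dt,\qquad E_{-}^{\nu,\mu}f(x)=\int_x^\infty (t^2-x^2)^{-\mu/2}\mathbb P_\nu^\mu\big(\tfrac xt\big)f(t)\,dt.$$ For $\operatorname{Re}\mu\ge1$ let $m$ be the least natural number with $\operatorname{Re}(\mu-m)<1$ and put $B_{0+}^{\nu,\mu}=(\frac{d}{dx})^mB_{0+}^{\nu,\mu-m}$, $E_{0+}^{\nu,\mu}=E_{0+}^{\nu,\mu-m}(\frac{d}{dx})^m$, $B_-^{\nu,\mu}=B_-^{\nu,\mu-m}(-\frac{d}{dx})^m$, $E_-^{\nu,\mu}=(-\frac{d}{dx})^mE_-^{\nu,\mu-m}$. The operators of zero order of smoothness are $${}_1S_{0+}^\nu f=\frac{d}{dx}\int_0^xP_\nu\big(\tfrac xt\big)f(t)dt,\quad {}_1P_{0+}^\nu f=\int_0^xP_\nu\big(\tfrac tx\big)f'(t)dt,\quad {}_1P_-^\nu f=\int_x^\infty P_\nu\big(\tfrac tx\big)(-f'(t))dt,\quad {}_1S_-^\nu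 f=-\frac{d}{dx}\int_x^\infty P_\nu\big(\tfrac xt\big)f(t)dt .$$ *Riemann–Liouville operators.* For $\operatorname{Re}\alpha>0$, $I_{0+}^\alpha f(x)=\frac1{\Gamma(\alpha)}\int_0^x(x-t)^{\alpha-1}f(t)dt$ and $I_-^\alpha f(x)=\frac1{\Gamma(\alpha)}\int_x^\infty(t-x)^{\alpha-1}f(t)dt$; for $\operatorname{Re}\alpha\le0$, $I_{0+}^\alpha=(\frac d{dx})^nI_{0+}^{\alpha+n}$ and $I_-^\alpha=(-\frac d{dx})^nI_-^{\alpha+n}$, where $n$ is the least natural number with $\operatorname{Re}\alpha+n>0$. *Erdélyi–Kober operators.* For $\operatorname{Re}\alpha>0$, $$I_{0+;2,y}^\alpha f=\tfrac{2}{\Gamma(\alpha)}x^{-2(\alpha+y)}\int_0^x(x^2-t^2)^{\alpha-1}t^{2y+1}f(t)dt,\qquad I_{-;2,y}^\alpha f=\tfrac{2}{\Gamma(\alpha)}x^{2y}\int_x^\infty(t^2-x^2)^{\alpha-1}t^{2(1-\alpha-y)-1}f(t)dt;$$ for $\operatorname{Re}\alpha\le0$, with the same $n$ and $\frac{d}{dx^2}=\frac1{2x}\frac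 d{dx}$, $$I_{0+;2,y}^\alpha f=x^{-2(\alpha+y)}\big(\tfrac{d}{dx^2}\big)^nx^{2(\alpha+y+n)}I_{0+;2,y}^{\alpha+n}f,\qquad I_{-;2,y}^\alpha f=x^{2y}\big(-\tfrac{d}{dx^2}\big)^nx^{2(n-y)}I_{-;2,y-n}^{\alpha+n}f .$$ *Classes of functions.* For $a,b\in\mathbb R$ let $\mathcal Z_a$ be the set of $f\in C^\infty(0,\infty)$ with $f^{(k)}(x)=O(x^{a-k})$ as $x\to0+$ for all $k\ge0$, and $\mathcal W_b$ the set of $f\in C^\infty(0,\infty)$ with $f^{(k)}(x)=O(x^{-b-k})$ as $x\to\infty$ for all $k\ge0$. **Theorem.** Let $\nu,\mu\in\mathbb C$. In each of the following formulas, for every $f$ in the indicated class, all operators on both sides are defined (the integrals converge absolutely, the derivatives exist), and the two sides agree at every $x>0$. (i) Factorizations of the Buschman–Erdélyi operators: - $B_{0+}^{\nu,\mu}f=I_{0+}^{\nu+2-\mu}\,I_{0+;2,\nu+1/2}^{-(\nu+1)}\big(\tfrac2x\big)^{\nu+1}f$ for $f\in\mathcal Z_a$, $a>\max(\operatorname{Re}\nu,-\operatorname{Re}\nu-2)$;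 - $E_{0+}^{\nu,\mu}f=\big(\tfrac x2\big)^{\nu+1}I_{0+;2,-1/2}^{\nu+1}\,I_{0+}^{-(\nu+\mu)}f$ for $f\in\mathcal Z_a$, $a>\max(-1,\operatorname{Re}\mu-1,\operatorname{Re}(\nu+\mu)-1)$; - $B_-^{\nu,\mu}f=\big(\tfrac2x\big)^{\nu+1}I_{-;2,\nu+1}^{-(\nu+1)}\,I_-^{\nu-\mu+2}f$ for $f\in\mathcal W_b$, $b>\max(1,\operatorname{Re}(\nu-\mu)+4,-\operatorname{Re}(\nu+\mu))$; - $E_-^{\nu,\mu}f=I_-^{-(\nu+\mu)}\,I_{-;2,0}^{\nu+1}\big(\tfrac x2\big)^{\nu+1}f$ for $f\in\mathcal W_b$, $b>\max(\operatorname{Re}\nu+2,1-\operatorname{Re}\nu,1-\operatorname{Re}\mu)$. (ii) Factorizations of the operators of zero order of smoothness: - ${}_1S_{0+}^\nu f=I_{0+}^{\nu+1}\,I_{0+;2,\nu+1/2}^{-(\nu+1)}\big(\tfrac2x\big)^{\nu+1}f$ for $f\in\mathcal Z_a$, $a>\max(\operatorname{Re}\nu,-\operatorname{Re}\nu-2)$;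 - ${}_1P_{0+}^\nu f=\big(\tfrac x2\big)^{\nu+1}I_{0+;2,-1/2}^{\nu+1}\,I_{0+}^{-(\nu+1)}f$ for $f\in\mathcal Z_a$, $a>\max(0,\operatorname{Re}\nu)$; - ${}_1P_-^\nu f=\big(\tfrac2x\big)^{\nu+1}I_{-;2,\nu+1}^{-(\nu+1)}\,I_-^{\nu+1}f$ for $f\in\mathcal W_b$, $b>\max(1,\operatorname{Re}\nu+3,-\operatorname{Re}\nu-1)$; - ${}_1S_-^\nu f=I_-^{-(\nu+1)}\,I_{-;2,0}^{\nu+1}\big(\tfrac x2\big)^{\nu+1}f$ for $f\in\mathcal W_b$, $b>\max(\operatorname{Re}\nu+2,1-\operatorname{Re}\nu)$. (iii) Each Buschman–Erdélyi operator is an operator of zero order of smoothness composed with a fractional integral of order $1-\mu$: - $B_{0+}^{\nu,\mu}f=I_{0+}^{1-\mu}\,{}_1S_{0+}^\nu f$ for $f\in\mathcal Z_a$, $a>\max(-1,\operatorname{Re}\nu-1,-\operatorname{Re}\nu-2)$; - $E_{0+}^{\nu,\mu}f={}_1P_{0+}^\nu\,I_{0+}^{1-\mu}f$ for $f\in\mathcal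 Z_a$, $a>\max(-1,\operatorname{Re}\mu-1)$; - $B_-^{\nu,\mu}f={}_1P_-^\nu\,I_-^{1-\mu}f$ for $f\in\mathcal W_b$, $b>\max(1,1-\operatorname{Re}\mu,\operatorname{Re}(\nu-\mu)+1,-\operatorname{Re}(\nu+\mu))$; - $E_-^{\nu,\mu}f=I_-^{1-\mu}\,{}_1S_-^\nu f$ for $f\in\mathcal W_b$, $b>\max(1,1-\operatorname{Re}\mu)$. -/

import Mathlib

open Set Filter Topology Asymptotics
open scoped ContDiff

noncomputable section

namespace BuschmanErdelyi

/-! ### Legendre functions -/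

/-- The Gauss hypergeometric function `F(a, b; c; w)` for real `w < 1`, on the principal branch.
For `0 ≤ w < 1` it is the hypergeometric series; for `w < 0` it is the analytic continuation of that
series, `F(a, b; c; w) = (1 - w)^(-a) F(a, c - b; c; w / (w - 1))`, where `w / (w - 1) ∈ (0, 1)`. -/
def gaussF (a b c : ℂ) (w : ℝ) : ℂ :=
  if w < 0 then ((1 - w : ℝ) : ℂ) ^ (-a) * ₂F₁ a (c - b) c ((w / (w - 1) : ℝ) : ℂ)
  else ₂F₁ a b c (w : ℂ)

/-- The Legendre function of the first kind `P_ν^μ(z)` for `z > 1` (used with `Re μ < 1`). -/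
def legendreP (ν μ : ℂ) (z : ℝ) : ℂ :=
  (Complex.Gamma (1 - μ))⁻¹ * (((z + 1) / (z - 1) : ℝ) : ℂ) ^ (μ / 2) *
    gaussF (-ν) (ν + 1) (1 - μ) ((1 - z) / 2)

/-- The Legendre function of the first kind on the cut, for `-1 < z < 1` (used with `Re μ < 1`). -/
def legendreCut (ν μ : ℂ) (z : ℝ) : ℂ :=
  (Complex.Gamma (1 - μ))⁻¹ * (((1 + z) / (1 - z) : ℝ) : ℂ) ^ (μ / 2) *
    gaussF (-ν) (ν + 1) (1 - μ) ((1 - z) / 2)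

/-! ### Integral operators on the half-line

Functions on `(0, ∞)` are represented by functions `ℝ → ℂ` whose values outside `(0, ∞)` are never
used. -/

/-- `x ↦ ∫_0^x K(x, t) f(t) dt`. -/
def leftInt (K : ℝ → ℝ → ℂ) (f : ℝ → ℂ) (x : ℝ) : ℂ := ∫ t in Ioo 0 x, K x t * f t

/-- `x ↦ ∫_x^∞ K(x, t) f(t) dt`. -/
def rightInt (K : ℝ → ℝ → ℂ) (f : ℝ → ℂ) (x : ℝ) : ℂ := ∫ t in Ioi x, K x t * f t

/-- `∫_0^x K(x, t) f(t) dt` converges absolutely for every `x > 0`. -/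
def LeftConverges (K : ℝ → ℝ → ℂ) (f : ℝ → ℂ) : Prop :=
  ∀ x : ℝ, 0 < x → MeasureTheory.IntegrableOn (fun t => K x t * f t) (Ioo 0 x)

/-- `∫_x^∞ K(x, t) f(t) dt` converges absolutely for every `x > 0`. -/
def RightConverges (K : ℝ → ℝ → ℂ) (f : ℝ → ℂ) : Prop :=
  ∀ x : ℝ, 0 < x → MeasureTheory.IntegrableOn (fun t => K x t * f t) (Ioi x)

/-- The function is `n` times continuously differentiable on `(0, ∞)`. -/
def DiffTimes (n : ℕ) (g : ℝ → ℂ) : Prop := ContDiffOn ℝ n g (Ioi 0)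

/-- The least `n : ℕ` with `Re α + n > 0`. -/
def ordShift (α : ℂ) : ℕ := ⌊1 - α.re⌋₊

/-- The least `m : ℕ` with `Re σ - m < 1`. -/
def smoothShift (σ : ℂ) : ℕ := ⌊σ.re⌋₊

/-! ### Riemann–Liouville fractional integrals and derivatives of order `α ∈ ℂ` -/

/-- `(x - t)^(α - 1) / Γ(α)`. -/
def rlKerL (α : ℂ) (x t : ℝ) : ℂ := (Complex.Gamma α)⁻¹ * ((x - t : ℝ) : ℂ) ^ (α - 1)

/-- `(t - x)^(α - 1) / Γ(α)`. -/
def rlKerR (α : ℂ) (x t : ℝ) : ℂ := (Complex.Gamma α)⁻¹ * ((t - x : ℝ) : ℂ) ^ (α - 1)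

/-- `I_{0+}^α f`; for `Re α ≤ 0` it is `(d/dx)^n I_{0+}^{α+n} f` with the least admissible `n`. -/
def rlL (α : ℂ) (f : ℝ → ℂ) : ℝ → ℂ :=
  iteratedDeriv (ordShift α) (leftInt (rlKerL (α + ordShift α)) f)

/-- `I_{0+}^α f` exists on `(0, ∞)`. -/
def RlLDefined (α : ℂ) (f : ℝ → ℂ) : Prop :=
  LeftConverges (rlKerL (α + ordShift α)) f ∧
    DiffTimes (ordShift α) (leftInt (rlKerL (α + ordShift α)) f)

/-- `I_-^α f`; for `Re α ≤ 0` it is `(-d/dx)^n I_-^{α+n} f` with the least admissible `n`. -/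
def rlR (α : ℂ) (f : ℝ → ℂ) (x : ℝ) : ℂ :=
  (-1) ^ ordShift α * iteratedDeriv (ordShift α) (rightInt (rlKerR (α + ordShift α)) f) x

/-- `I_-^α f` exists on `(0, ∞)`. -/
def RlRDefined (α : ℂ) (f : ℝ → ℂ) : Prop :=
  RightConverges (rlKerR (α + ordShift α)) f ∧
    DiffTimes (ordShift α) (rightInt (rlKerR (α + ordShift α)) f)

/-! ### Erdélyi–Kober operators (with respect to `x²`) of order `α ∈ ℂ` -/

/-- The differentiation `d/d(x²) = (1/(2x)) d/dx`. -/
def derivSq (g : ℝ → ℂ) (x : ℝ) : ℂ := deriv g x / (2 * x)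

/-- `(2/Γ(α)) x^(-2(α+y)) (x² - t²)^(α-1) t^(2y+1)`. -/
def ekKerL (α y : ℂ) (x t : ℝ) : ℂ :=
  2 / Complex.Gamma α * (x : ℂ) ^ (-2 * (α + y)) * ((x ^ 2 - t ^ 2 : ℝ) : ℂ) ^ (α - 1) *
    (t : ℂ) ^ (2 * y + 1)

/-- `(2/Γ(α)) x^(2y) (t² - x²)^(α-1) t^(2(1-α-y)-1)`. -/
def ekKerR (α y : ℂ) (x t : ℝ) : ℂ :=
  2 / Complex.Gamma α * (x : ℂ) ^ (2 * y) * ((t ^ 2 - x ^ 2 : ℝ) : ℂ) ^ (α - 1) *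
    (t : ℂ) ^ (2 * (1 - α - y) - 1)

/-- `x^(2(α+y+n)) I_{0+;2,y}^{α+n} f` with `n = ordShift α`. -/
def ekLInner (α y : ℂ) (f : ℝ → ℂ) (x : ℝ) : ℂ :=
  (x : ℂ) ^ (2 * (α + y + ordShift α)) * leftInt (ekKerL (α + ordShift α) y) f x

/-- `I_{0+;2,y}^α f = x^(-2(α+y)) (d/dx²)^n x^(2(α+y+n)) I_{0+;2,y}^{α+n} f`, `n = ordShift α`
(for `Re α > 0` one has `n = 0` and this is the integral itself). -/
def ekL (α y : ℂ) (f : ℝ → ℂ) (x : ℝ) : ℂ :=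
  (x : ℂ) ^ (-2 * (α + y)) * (derivSq^[ordShift α]) (ekLInner α y f) x

/-- `I_{0+;2,y}^α f` exists on `(0, ∞)`. -/
def EkLDefined (α y : ℂ) (f : ℝ → ℂ) : Prop :=
  LeftConverges (ekKerL (α + ordShift α) y) f ∧ DiffTimes (ordShift α) (ekLInner α y f)

/-- `x^(2(n-y)) I_{-;2,y-n}^{α+n} f` with `n = ordShift α`. -/
def ekRInner (α y : ℂ) (f : ℝ → ℂ) (x : ℝ) : ℂ :=
  (x : ℂ) ^ (2 * (ordShift α - y)) *
    rightInt (ekKerR (α + ordShift α) (y - ordShift α)) f x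

/-- `I_{-;2,y}^α f = x^(2y) (-d/dx²)^n x^(2(n-y)) I_{-;2,y-n}^{α+n} f`, `n = ordShift α`
(for `Re α > 0` one has `n = 0` and this is the integral itself). -/
def ekR (α y : ℂ) (f : ℝ → ℂ) (x : ℝ) : ℂ :=
  (x : ℂ) ^ (2 * y) * ((-1) ^ ordShift α * (derivSq^[ordShift α]) (ekRInner α y f) x)

/-- `I_{-;2,y}^α f` exists on `(0, ∞)`. -/
def EkRDefined (α y : ℂ) (f : ℝ → ℂ) : Prop :=
  RightConverges (ekKerR (α + ordShift α) (y - ordShift α)) f ∧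
    DiffTimes (ordShift α) (ekRInner α y f)

/-! ### Power weights -/

/-- Multiplication by `(2/x)^s`. -/
def mulTwoDiv (s : ℂ) (f : ℝ → ℂ) (x : ℝ) : ℂ := ((2 / x : ℝ) : ℂ) ^ s * f x

/-- Multiplication by `(x/2)^s`. -/
def mulDivTwo (s : ℂ) (f : ℝ → ℂ) (x : ℝ) : ℂ := ((x / 2 : ℝ) : ℂ) ^ s * f x

/-! ### Buschman–Erdélyi operators -/

/-- `(x² - t²)^(-μ/2) P_ν^μ(x/t)`. -/
def kerBL (ν μ : ℂ) (x t : ℝ) : ℂ :=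
  ((x ^ 2 - t ^ 2 : ℝ) : ℂ) ^ (-μ / 2) * legendreP ν μ (x / t)

/-- `(x² - t²)^(-μ/2) ℙ_ν^μ(t/x)`. -/
def kerEL (ν μ : ℂ) (x t : ℝ) : ℂ :=
  ((x ^ 2 - t ^ 2 : ℝ) : ℂ) ^ (-μ / 2) * legendreCut ν μ (t / x)

/-- `(t² - x²)^(-μ/2) P_ν^μ(t/x)`. -/
def kerBR (ν μ : ℂ) (x t : ℝ) : ℂ :=
  ((t ^ 2 - x ^ 2 : ℝ) : ℂ) ^ (-μ / 2) * legendreP ν μ (t / x)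

/-- `(t² - x²)^(-μ/2) ℙ_ν^μ(x/t)`. -/
def kerER (ν μ : ℂ) (x t : ℝ) : ℂ :=
  ((t ^ 2 - x ^ 2 : ℝ) : ℂ) ^ (-μ / 2) * legendreCut ν μ (x / t)

/-- `B_{0+}^{ν,σ}`: the integral operator for `Re σ < 1`, and `(d/dx)^m B_{0+}^{ν,σ-m}` with
`m = smoothShift σ` in general. -/
def opBL (ν σ : ℂ) (f : ℝ → ℂ) : ℝ → ℂ :=
  iteratedDeriv (smoothShift σ) (leftInt (kerBL ν (σ - smoothShift σ)) f)

/-- `B_{0+}^{ν,σ} f` exists on `(0, ∞)`. -/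
def BLDefined (ν σ : ℂ) (f : ℝ → ℂ) : Prop :=
  LeftConverges (kerBL ν (σ - smoothShift σ)) f ∧
    DiffTimes (smoothShift σ) (leftInt (kerBL ν (σ - smoothShift σ)) f)

/-- `E_{0+}^{ν,σ}`: the integral operator for `Re σ < 1`, and `E_{0+}^{ν,σ-m} (d/dx)^m` with
`m = smoothShift σ` in general. -/
def opEL (ν σ : ℂ) (f : ℝ → ℂ) : ℝ → ℂ :=
  leftInt (kerEL ν (σ - smoothShift σ)) (iteratedDeriv (smoothShift σ) f)

/-- `E_{0+}^{ν,σ} f` exists on `(0, ∞)`. -/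
def ELDefined (ν σ : ℂ) (f : ℝ → ℂ) : Prop :=
  DiffTimes (smoothShift σ) f ∧
    LeftConverges (kerEL ν (σ - smoothShift σ)) (iteratedDeriv (smoothShift σ) f)

/-- `B_-^{ν,σ}`: the integral operator for `Re σ < 1`, and `B_-^{ν,σ-m} (-d/dx)^m` with
`m = smoothShift σ` in general. -/
def opBR (ν σ : ℂ) (f : ℝ → ℂ) : ℝ → ℂ :=
  rightInt (kerBR ν (σ - smoothShift σ))
    (fun t => (-1) ^ smoothShift σ * iteratedDeriv (smoothShift σ) f t)

/-- `B_-^{ν,σ} f` exists on `(0, ∞)`. -/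
def BRDefined (ν σ : ℂ) (f : ℝ → ℂ) : Prop :=
  DiffTimes (smoothShift σ) f ∧
    RightConverges (kerBR ν (σ - smoothShift σ))
      (fun t => (-1) ^ smoothShift σ * iteratedDeriv (smoothShift σ) f t)

/-- `E_-^{ν,σ}`: the integral operator for `Re σ < 1`, and `(-d/dx)^m E_-^{ν,σ-m}` with
`m = smoothShift σ` in general. -/
def opER (ν σ : ℂ) (f : ℝ → ℂ) (x : ℝ) : ℂ :=
  (-1) ^ smoothShift σ *
    iteratedDeriv (smoothShift σ) (rightInt (kerER ν (σ - smoothShift σ)) f) x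

/-- `E_-^{ν,σ} f` exists on `(0, ∞)`. -/
def ERDefined (ν σ : ℂ) (f : ℝ → ℂ) : Prop :=
  RightConverges (kerER ν (σ - smoothShift σ)) f ∧
    DiffTimes (smoothShift σ) (rightInt (kerER ν (σ - smoothShift σ)) f)

/-! ### The operators of zero order of smoothness, with `P_ν = P_ν^0` -/

/-- `₁S_{0+}^ν f = d/dx ∫_0^x P_ν(x/t) f(t) dt`. -/
def zeroSL (ν : ℂ) (f : ℝ → ℂ) : ℝ → ℂ := deriv (leftInt (fun x t => legendreP ν 0 (x / t)) f)

/-- `₁S_{0+}^ν f` exists on `(0, ∞)`. -/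
def ZeroSLDefined (ν : ℂ) (f : ℝ → ℂ) : Prop :=
  LeftConverges (fun x t => legendreP ν 0 (x / t)) f ∧
    DiffTimes 1 (leftInt (fun x t => legendreP ν 0 (x / t)) f)

/-- `₁P_{0+}^ν f = ∫_0^x P_ν(t/x) f'(t) dt`. -/
def zeroPL (ν : ℂ) (f : ℝ → ℂ) : ℝ → ℂ := leftInt (fun x t => legendreCut ν 0 (t / x)) (deriv f)

/-- `₁P_{0+}^ν f` exists on `(0, ∞)`. -/
def ZeroPLDefined (ν : ℂ) (f : ℝ → ℂ) : Prop :=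
  DiffTimes 1 f ∧ LeftConverges (fun x t => legendreCut ν 0 (t / x)) (deriv f)

/-- `₁P_-^ν f = ∫_x^∞ P_ν(t/x) (-f'(t)) dt`. -/
def zeroPR (ν : ℂ) (f : ℝ → ℂ) : ℝ → ℂ :=
  rightInt (fun x t => legendreP ν 0 (t / x)) (fun t => -deriv f t)

/-- `₁P_-^ν f` exists on `(0, ∞)`. -/
def ZeroPRDefined (ν : ℂ) (f : ℝ → ℂ) : Prop :=
  DiffTimes 1 f ∧ RightConverges (fun x t => legendreP ν 0 (t / x)) (fun t => -deriv f t)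

/-- `₁S_-^ν f = -d/dx ∫_x^∞ P_ν(x/t) f(t) dt`. -/
def zeroSR (ν : ℂ) (f : ℝ → ℂ) (x : ℝ) : ℂ :=
  -deriv (rightInt (fun x t => legendreCut ν 0 (x / t)) f) x

/-- `₁S_-^ν f` exists on `(0, ∞)`. -/
def ZeroSRDefined (ν : ℂ) (f : ℝ → ℂ) : Prop :=
  RightConverges (fun x t => legendreCut ν 0 (x / t)) f ∧
    DiffTimes 1 (rightInt (fun x t => legendreCut ν 0 (x / t)) f)

/-! ### Classes of functions -/

/-- `f ∈ C^∞(0, ∞)` and `f^(k)(x) = O(x^(a-k))` as `x → 0+` for every `k`. -/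
def PowerTypeZero (a : ℝ) (f : ℝ → ℂ) : Prop :=
  ContDiffOn ℝ ∞ f (Ioi 0) ∧
    ∀ k : ℕ, iteratedDeriv k f =O[𝓝[>] (0 : ℝ)] fun x : ℝ => x ^ (a - k)

/-- `f ∈ C^∞(0, ∞)` and `f^(k)(x) = O(x^(-b-k))` as `x → ∞` for every `k`. -/
def PowerTypeInfty (b : ℝ) (f : ℝ → ℂ) : Prop :=
  ContDiffOn ℝ ∞ f (Ioi 0) ∧
    ∀ k : ℕ, iteratedDeriv k f =O[atTop] fun x : ℝ => x ^ (-b - k)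

end BuschmanErdelyi

end

/-!
Each of the operators sends a power `x^w` to a multiple of a shifted power, and the multiplier, its
Mellin symbol, is a quotient of Gamma functions. By Fourier inversion in the variable `log x`, a
function in one of the two classes agrees near `0`, respectively near `∞`, with a superposition of
powers `x^w` over a vertical line, so each factorization reduces to an identity between symbols,
which follows from the duplication formula for the Gamma function. The symbols of the
Buschman–Erdélyi operators are the Mellin transforms of the Legendre kernels: the Legendre equation
gives a recursion under `w ↦ w + 2`, and the behaviour as `w → ∞`, where the kernel concentrates at
its singular endpoint, singles out the solution.
-/

namespace BuschmanErdelyi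

/-! ### Rising factorials and quotients of Gamma functions -/

/-- The rising factorial `(z)_n`. -/
noncomputable abbrev poch (z : ℂ) (n : ℕ) : ℂ := (ascPochhammer ℂ n).eval z

lemma poch_succ (z : ℂ) (n : ℕ) : poch z (n + 1) = poch z n * (z + n) :=
  ascPochhammer_succ_eval n z

lemma poch_succ_left (z : ℂ) (n : ℕ) : poch z (n + 1) = z * poch (z + 1) n := by
  simp [poch, ascPochhammer_succ_left]

lemma poch_eq_prod (z : ℂ) (n : ℕ) : poch z n = ∏ j ∈ Finset.range n, (z + j) := by
  induction n with
  | zero => simp [poch]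
  | succ n ih => rw [poch_succ, Finset.prod_range_succ, ih]

lemma poch_ne_zero {z : ℂ} (hz : ∀ m : ℕ, z ≠ -m) (n : ℕ) : poch z n ≠ 0 := by
  rw [Ne, ascPochhammer_eval_eq_zero_iff]
  rintro ⟨m, -, hm⟩
  exact hz m (by rw [hm, neg_neg])

lemma poch_ofReal_eq_norm {s : ℝ} (hs : 0 < s) (n : ℕ) : poch (s : ℂ) n = ‖poch (s : ℂ) n‖ := by
  have h : poch (s : ℂ) n = ((∏ j ∈ Finset.range n, (s + j) : ℝ) : ℂ) := by
    rw [poch_eq_prod]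
    push_cast
    rfl
  rw [h, Complex.norm_real, Real.norm_of_nonneg (Finset.prod_nonneg fun j _ => by positivity)]

lemma ne_neg_natCast_of_re_pos {z : ℂ} (hz : 0 < z.re) (m : ℕ) : z ≠ -m := by
  rintro rfl
  have : (0 : ℝ) ≤ m := m.cast_nonneg
  simp only [Complex.neg_re, Complex.natCast_re] at hz
  linarith

lemma Gamma_add_natCast {z : ℂ} (hz : ∀ m : ℕ, z ≠ -m) (n : ℕ) :
    Complex.Gamma (z + n) = poch z n * Complex.Gamma z := by
  rw [poch, ← Complex.Gamma_add_nat_div_Gamma_eq z hz,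
    div_mul_cancel₀ _ (Complex.Gamma_ne_zero hz)]

lemma poch_mul_inv_Gamma (z : ℂ) (n : ℕ) :
    poch z n * (Complex.Gamma (z + n))⁻¹ = (Complex.Gamma z)⁻¹ := by
  induction n with
  | zero => simp [poch]
  | succ n ih =>
    rw [← ih, poch_succ, Complex.one_div_Gamma_eq_self_mul_one_div_Gamma_add_one (z + n),
      Nat.cast_succ, add_assoc z n 1, mul_assoc]

lemma natCast_cpow_ne_zero {n : ℕ} (hn : n ≠ 0) (z : ℂ) : (n : ℂ) ^ z ≠ 0 :=
  Complex.cpow_ne_zero_iff.2 (Or.inl (Nat.cast_ne_zero.2 hn))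

lemma tendsto_poch_succ_div (z : ℂ) :
    Tendsto (fun n : ℕ => poch z (n + 1) / ((n : ℂ) ^ z * n.factorial)) atTop
      (𝓝 (Complex.Gamma z)⁻¹) := by
  by_cases hz : ∃ m : ℕ, z = -m
  · obtain ⟨m, rfl⟩ := hz
    rw [Complex.Gamma_neg_nat_eq_zero, inv_zero]
    refine tendsto_const_nhds.congr' ?_
    filter_upwards [eventually_ge_atTop m] with n hn
    rw [poch, ascPochhammer_eval_neg_coe_nat_of_lt (Nat.lt_succ_of_le hn), zero_div]
  · push Not at hz
    refine ((Complex.GammaSeq_tendsto_Gamma z).inv₀ (Complex.Gamma_ne_zero hz)).congr fun n => ?_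
    rw [Complex.GammaSeq, inv_div, poch_eq_prod]

lemma tendsto_Gamma_div_of_re_pos {z : ℂ} (hz : 0 < z.re) :
    Tendsto (fun n : ℕ => Complex.Gamma (z + n + 1) / ((n : ℂ) ^ z * n.factorial)) atTop
      (𝓝 1) := by
  have h := (tendsto_poch_succ_div z).mul_const (Complex.Gamma z)
  rw [inv_mul_cancel₀ (Complex.Gamma_ne_zero_of_re_pos hz)] at h
  refine h.congr fun n => ?_
  rw [add_assoc z, ← Nat.cast_succ, Gamma_add_natCast (ne_neg_natCast_of_re_pos hz)]
  ring

lemma eventually_add_natCast_ne_zero (z : ℂ) : ∀ᶠ n : ℕ in atTop, z + n ≠ 0 := by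
  obtain ⟨N, hN⟩ := exists_nat_gt (-z.re)
  filter_upwards [eventually_ge_atTop N] with n hn h
  have hre := congrArg Complex.re h
  have : (N : ℝ) ≤ n := by exact_mod_cast hn
  simp only [Complex.add_re, Complex.natCast_re, Complex.zero_re] at hre
  linarith

lemma tendsto_Gamma_div_of_add_one {z : ℂ}
    (h : Tendsto (fun n : ℕ => Complex.Gamma (z + 1 + n + 1) / ((n : ℂ) ^ (z + 1) * n.factorial))
      atTop (𝓝 1)) :
    Tendsto (fun n : ℕ => Complex.Gamma (z + n + 1) / ((n : ℂ) ^ z * n.factorial)) atTop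
      (𝓝 1) := by
  have hq : Tendsto (fun n : ℕ => (z + 1) * (n : ℂ)⁻¹ + 1) atTop (𝓝 1) := by
    simpa using ((tendsto_inv_atTop_nhds_zero_nat (𝕜 := ℂ)).const_mul (z + 1)).add_const 1
  have hdiv := h.div hq one_ne_zero
  rw [div_one] at hdiv
  refine hdiv.congr' ?_
  filter_upwards [eventually_ne_atTop 0, eventually_add_natCast_ne_zero (z + 1)] with n hn hne
  have hn0 : (n : ℂ) ≠ 0 := Nat.cast_ne_zero.2 hn
  have hp := natCast_cpow_ne_zero hn z
  have hq0 : (z + 1) * (n : ℂ)⁻¹ + 1 = (z + 1 + n) / n := by field_simp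
  rw [Pi.div_apply, hq0, Complex.Gamma_add_one _ hne, Complex.cpow_add _ _ hn0, Complex.cpow_one,
    add_right_comm z 1]
  rw [add_right_comm z 1] at hne
  field_simp

lemma tendsto_Gamma_div (z : ℂ) :
    Tendsto (fun n : ℕ => Complex.Gamma (z + n + 1) / ((n : ℂ) ^ z * n.factorial)) atTop
      (𝓝 1) := by
  obtain ⟨k, hk⟩ := exists_nat_gt (-z.re)
  have hk' : 0 < z.re + k := by linarith
  clear hk
  induction k generalizing z with
  | zero => exact tendsto_Gamma_div_of_re_pos (by simpa using hk')
  | succ k ih =>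
    refine tendsto_Gamma_div_of_add_one (ih (z + 1) ?_)
    simp only [Complex.add_re, Complex.one_re, Nat.cast_succ] at hk' ⊢
    linarith

lemma tendsto_Gamma_ratio (z w : ℂ) :
    Tendsto
      (fun n : ℕ => (n : ℂ) ^ w * (Complex.Gamma (z + n + 1) / Complex.Gamma (z + w + n + 1)))
      atTop (𝓝 1) := by
  have h := (tendsto_Gamma_div z).div (tendsto_Gamma_div (z + w)) one_ne_zero
  rw [div_one] at h
  refine h.congr' ?_
  filter_upwards [eventually_ne_atTop 0] with n hn
  have hf : (n.factorial : ℂ) ≠ 0 := by exact_mod_cast n.factorial_ne_zero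
  have hz := natCast_cpow_ne_zero hn z
  have hw := natCast_cpow_ne_zero hn w
  rw [Pi.div_apply, Complex.cpow_add _ _ (Nat.cast_ne_zero.2 hn), div_div_div_eq]
  rcases eq_or_ne (Complex.Gamma (z + w + n + 1)) 0 with hG | hG
  · simp [hG]
  · field_simp

lemma tendsto_Gamma_ratio_two_mul (z w : ℂ) :
    Tendsto (fun n : ℕ => (n : ℂ) ^ w *
      (Complex.Gamma (z + 2 * n + 1) / Complex.Gamma (z + w + 2 * n + 1)))
      atTop (𝓝 (2 ^ (-w))) := by
  have h := ((tendsto_Gamma_ratio z w).comp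
    (tendsto_id.const_mul_atTop' two_pos)).const_mul ((2 : ℂ) ^ (-w))
  rw [mul_one] at h
  refine h.congr fun n => ?_
  have hmul : ((2 * n : ℕ) : ℂ) ^ w = 2 ^ w * (n : ℂ) ^ w := by
    exact_mod_cast Complex.natCast_mul_natCast_cpow 2 n w
  have hinv : (2 : ℂ) ^ (-w) * 2 ^ w = 1 := by
    rw [← Complex.cpow_add _ _ two_ne_zero, neg_add_cancel, Complex.cpow_zero]
  rw [Function.comp_apply, id, hmul, ← mul_assoc, ← mul_assoc, hinv, one_mul]
  push_cast
  rfl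

/-! ### The hypergeometric series -/

/-- The coefficients of the Gauss hypergeometric series `F(a, b; c; ·)`. -/
noncomputable def gaussCoeff (a b c : ℂ) (n : ℕ) : ℂ :=
  poch a n * poch b n / (poch c n * n.factorial)

/-- The derivative of `F(a, b; c; ·)`. -/
noncomputable def gaussDeriv (a b c x : ℂ) : ℂ := a * b / c * ₂F₁ (a + 1) (b + 1) (c + 1) x

/-- The second derivative of `F(a, b; c; ·)`. -/
noncomputable def gaussDeriv2 (a b c x : ℂ) : ℂ := a * b / c * gaussDeriv (a + 1) (b + 1) (c + 1) x

lemma ne_neg_natCast_add_one {c : ℂ} (hc : ∀ m : ℕ, c ≠ -m) (m : ℕ) : c + 1 ≠ -m := by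
  intro h
  refine hc (m + 1) ?_
  push_cast
  linear_combination h

lemma ne_zero_of_ne_neg_natCast {c : ℂ} (hc : ∀ m : ℕ, c ≠ -m) : c ≠ 0 := by
  simpa using hc 0

lemma isBigO_poch_succ (z : ℂ) :
    (fun n : ℕ => poch z (n + 1)) =O[atTop] fun n : ℕ => (n : ℂ) ^ z * n.factorial := by
  refine isBigO_of_div_tendsto_nhds ?_ _ (tendsto_poch_succ_div z)
  filter_upwards [eventually_ne_atTop 0] with n hn h
  exact absurd h (mul_ne_zero (natCast_cpow_ne_zero hn z) (Nat.cast_ne_zero.2 n.factorial_ne_zero))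

lemma isBigO_cpow_mul_factorial {z : ℂ} (hz : ∀ m : ℕ, z ≠ -m) :
    (fun n : ℕ => (n : ℂ) ^ z * n.factorial) =O[atTop] fun n : ℕ => poch z (n + 1) := by
  refine isBigO_of_div_tendsto_nhds (Eventually.of_forall fun n h => ?_) (Complex.Gamma z) ?_
  · exact absurd h (poch_ne_zero hz _)
  · simpa [Pi.div_def] using
      (tendsto_poch_succ_div z).inv₀ (inv_ne_zero (Complex.Gamma_ne_zero hz))

lemma isBigO_natCast_cpow {w z : ℂ} (h : w.re ≤ z.re) :
    (fun n : ℕ => (n : ℂ) ^ w) =O[atTop] fun n : ℕ => (n : ℂ) ^ z := by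
  refine IsBigO.of_bound 1 ?_
  filter_upwards [eventually_ge_atTop 1] with n hn
  rw [one_mul, Complex.norm_natCast_cpow_of_pos hn, Complex.norm_natCast_cpow_of_pos hn]
  exact Real.rpow_le_rpow_of_exponent_le (by exact_mod_cast hn) h

lemma gaussCoeff_isBigO {a b c : ℂ} (hc : ∀ m : ℕ, c ≠ -m) {s : ℂ} (hs : ∀ m : ℕ, s ≠ -m)
    (h : (a + b - c).re ≤ s.re) :
    gaussCoeff a b c =O[atTop] fun n : ℕ => poch s n / n.factorial := by
  suffices H : (fun n => gaussCoeff a b c (n + 1)) =O[atTop]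
      fun n : ℕ => poch s (n + 1) / (n + 1).factorial by
    have := H.comp_tendsto (tendsto_sub_atTop_nat 1)
    refine this.congr' ?_ ?_ <;>
    · filter_upwards [eventually_ge_atTop 1] with n hn
      simp only [Function.comp_apply, Nat.sub_add_cancel hn]
  have hcinv : (fun n : ℕ => (poch c (n + 1))⁻¹) =O[atTop]
      fun n : ℕ => ((n : ℂ) ^ c * n.factorial)⁻¹ :=
    (isBigO_cpow_mul_factorial hc).inv_rev (by
      filter_upwards [eventually_ne_atTop 0] with n hn h
      exact absurd h
        (mul_ne_zero (natCast_cpow_ne_zero hn c) (Nat.cast_ne_zero.2 n.factorial_ne_zero)))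
  have hfac : (fun n : ℕ => ((n + 1).factorial : ℂ)⁻¹) =O[atTop]
      fun n : ℕ => ((n + 1).factorial : ℂ)⁻¹ := isBigO_refl _ _
  have hcoeff := (((isBigO_poch_succ a).mul (isBigO_poch_succ b)).mul hcinv).mul hfac
  have hpow := (((isBigO_natCast_cpow h).mul (isBigO_refl (fun n : ℕ => (n.factorial : ℂ)) _)).trans
    (isBigO_cpow_mul_factorial hs)).mul hfac
  refine (hcoeff.congr' (Eventually.of_forall fun n => ?_) ?_).trans
    (hpow.congr_right fun n => (div_eq_mul_inv _ _).symm)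
  · rw [gaussCoeff, div_eq_mul_inv, mul_inv, ← mul_assoc]
  · filter_upwards [eventually_ne_atTop 0] with n hn
    have hn0 : (n : ℂ) ≠ 0 := Nat.cast_ne_zero.2 hn
    have hf : (n.factorial : ℂ) ≠ 0 := Nat.cast_ne_zero.2 n.factorial_ne_zero
    have hpc := natCast_cpow_ne_zero hn c
    rw [Complex.cpow_sub _ _ hn0, Complex.cpow_add _ _ hn0]
    field_simp

lemma hasSum_norm_binomial {s u : ℝ} (hs : 0 < s) (hu0 : 0 ≤ u) (hu1 : u < 1) :
    HasSum (fun n : ℕ => ‖poch (s : ℂ) n / n.factorial‖ * u ^ n) ((1 - u) ^ (-s)) := by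
  have h := (Complex.one_div_one_sub_cpow_hasFPowerSeriesOnBall_zero (s : ℂ)).hasSum
    (y := (u : ℂ)) (by
      rw [← ENNReal.ofReal_one, Metric.eball_ofReal]
      simpa [abs_of_nonneg hu0] using hu1)
  suffices H : HasSum (fun n : ℕ => ((‖poch (s : ℂ) n / n.factorial‖ * u ^ n : ℝ) : ℂ))
      (((1 - u) ^ (-s) : ℝ) : ℂ) by exact_mod_cast H
  refine (congrArg₂ HasSum (funext fun n => ?_) ?_).mpr h
  · have hchoose := Ring.factorial_nsmul_multichoose_eq_ascPochhammer (s : ℂ) n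
    rw [Polynomial.ascPochhammer_smeval_eq_eval, nsmul_eq_mul] at hchoose
    rw [FormalMultilinearSeries.ofScalars_apply_eq, smul_eq_mul, ← Ring.multichoose_eq, norm_div,
      Complex.norm_natCast]
    push_cast
    rw [← poch_ofReal_eq_norm hs, poch, ← hchoose,
      mul_div_cancel_left₀ _ (Nat.cast_ne_zero.2 n.factorial_ne_zero)]
  · rw [zero_add, Real.rpow_neg (by linarith), one_div, Complex.ofReal_inv,
      Complex.ofReal_cpow (by linarith), Complex.ofReal_sub, Complex.ofReal_one]

lemma gaussCoeff_norm_le {a b c : ℂ} (hc : ∀ m : ℕ, c ≠ -m) {s : ℝ} (hs : 0 < s)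
    (h : (a + b - c).re ≤ s) :
    ∃ K, 0 < K ∧ ∀ n, ‖gaussCoeff a b c n‖ ≤ K * ‖poch (s : ℂ) n / n.factorial‖ := by
  have hs' : ∀ m : ℕ, (s : ℂ) ≠ -m := ne_neg_natCast_of_re_pos (by simpa using hs)
  obtain ⟨K, hK0, hK⟩ := bound_of_isBigO_nat_atTop (gaussCoeff_isBigO hc hs' (by simpa using h))
  exact ⟨K, hK0, fun n => hK (div_ne_zero (poch_ne_zero hs' n)
    (Nat.cast_ne_zero.2 n.factorial_ne_zero))⟩

lemma gauss_eq_tsum (a b c x : ℂ) : ₂F₁ a b c x = ∑' n, gaussCoeff a b c n * x ^ n := by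
  rw [ordinaryHypergeometric_eq_tsum]
  refine tsum_congr fun n => ?_
  rw [smul_eq_mul, gaussCoeff, div_eq_mul_inv, mul_inv]
  ring

lemma gauss_norm_le {a b c : ℂ} (hc : ∀ m : ℕ, c ≠ -m) {s : ℝ} (hs : 0 < s)
    (h : (a + b - c).re ≤ s) :
    ∃ K, 0 < K ∧ ∀ x : ℂ, ‖x‖ < 1 → ‖₂F₁ a b c x‖ ≤ K * (1 - ‖x‖) ^ (-s) := by
  obtain ⟨K, hK0, hK⟩ := gaussCoeff_norm_le hc hs h
  refine ⟨K, hK0, fun x hx => ?_⟩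
  rw [gauss_eq_tsum]
  refine tsum_of_norm_bounded ((hasSum_norm_binomial hs (norm_nonneg x) hx).mul_left K)
    fun n => ?_
  rw [norm_mul, norm_pow, ← mul_assoc]
  exact mul_le_mul_of_nonneg_right (hK n) (by positivity)

lemma hasSum_gauss (a b : ℂ) {c : ℂ} (hc : ∀ m : ℕ, c ≠ -m) {x : ℂ} (hx : ‖x‖ < 1) :
    HasSum (fun n => gaussCoeff a b c n * x ^ n) (₂F₁ a b c x) := by
  obtain ⟨K, -, hK⟩ := gaussCoeff_norm_le (a := a) (b := b) hc
    (s := |(a + b - c).re| + 1) (by positivity) (by linarith [le_abs_self (a + b - c).re])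
  rw [gauss_eq_tsum]
  have hbin := hasSum_norm_binomial (s := |(a + b - c).re| + 1) (by positivity) (norm_nonneg x) hx
  refine (Summable.of_norm_bounded (hbin.summable.mul_left K) fun n => ?_).hasSum
  rw [norm_mul, norm_pow, ← mul_assoc]
  exact mul_le_mul_of_nonneg_right (hK n) (by positivity)

lemma hasDerivAt_of_hasSum_mul_pow {u : ℕ → ℂ} {f f' : ℂ → ℂ}
    (hf : ∀ x, ‖x‖ < 1 → HasSum (fun n => u n * x ^ n) (f x))
    (hf' : ∀ x, ‖x‖ < 1 → HasSum (fun n => u (n + 1) * (n + 1 : ℕ) * x ^ n) (f' x))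
    {x : ℂ} (hx : ‖x‖ < 1) : HasDerivAt f (f' x) x := by
  obtain ⟨r, hxr, hr1⟩ := exists_between hx
  have hr0 : 0 ≤ r := (norm_nonneg x).trans hxr.le
  have hxr' : x ∈ Metric.ball 0 r := by simpa using hxr
  have hsum : Summable fun n : ℕ => ‖u n‖ * (n * r ^ (n - 1)) := by
    rw [← summable_nat_add_iff 1]
    refine ((hf' r (by simpa [abs_of_nonneg hr0] using hr1)).summable.norm).congr fun n => ?_
    rw [norm_mul, norm_mul, norm_pow, Complex.norm_real, Real.norm_of_nonneg hr0,
      Complex.norm_natCast, Nat.add_sub_cancel, mul_assoc]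
  have key := hasDerivAt_tsum_of_isPreconnected (g := fun n z => u n * z ^ n)
    (g' := fun n z => u n * (n * z ^ (n - 1))) hsum Metric.isOpen_ball
    (convex_ball _ _).isPreconnected (fun n y _ => (hasDerivAt_pow n y).const_mul _)
    (fun n y hy => by
      have : ‖y‖ ≤ r := (mem_ball_zero_iff.1 hy).le
      rw [norm_mul, norm_mul, norm_pow, Complex.norm_natCast]
      gcongr) hxr' (hf x hx).summable hxr'
  have hder : HasSum (fun n : ℕ => u n * (n * x ^ (n - 1))) (f' x) := by
    rw [← hasSum_nat_add_iff' 1]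
    simpa [mul_assoc] using hf' x hx
  rw [hder.tsum_eq] at key
  refine key.congr_of_eventuallyEq ?_
  filter_upwards [Metric.isOpen_ball.mem_nhds hxr'] with y hy
  exact (hf y ((mem_ball_zero_iff.1 hy).trans hr1)).tsum_eq.symm

lemma gaussCoeff_succ_mul (a b : ℂ) {c : ℂ} (hc : ∀ m : ℕ, c ≠ -m) (n : ℕ) :
    gaussCoeff a b c (n + 1) * (n + 1 : ℕ) =
      a * b / c * gaussCoeff (a + 1) (b + 1) (c + 1) n := by
  have hp : poch (c + 1) n ≠ 0 := poch_ne_zero (ne_neg_natCast_add_one hc) n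
  have hf : (n.factorial : ℂ) ≠ 0 := Nat.cast_ne_zero.2 n.factorial_ne_zero
  have hn : (n : ℂ) + 1 ≠ 0 := n.cast_add_one_ne_zero
  have hc0 := ne_zero_of_ne_neg_natCast hc
  simp only [gaussCoeff, poch_succ_left, Nat.factorial_succ]
  push_cast
  field_simp

lemma gaussCoeff_recurrence (a b : ℂ) {c : ℂ} (hc : ∀ m : ℕ, c ≠ -m) (n : ℕ) :
    gaussCoeff a b c (n + 1) * (n + 1 : ℕ) * (c + n) =
      gaussCoeff a b c n * ((a + n) * (b + n)) := by
  have hcn : c + n ≠ 0 := fun h => hc n (eq_neg_of_add_eq_zero_left h)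
  have hp : poch c n ≠ 0 := poch_ne_zero hc n
  have hf : (n.factorial : ℂ) ≠ 0 := Nat.cast_ne_zero.2 n.factorial_ne_zero
  have hn : (n : ℂ) + 1 ≠ 0 := n.cast_add_one_ne_zero
  simp only [gaussCoeff, poch_succ, Nat.factorial_succ]
  push_cast
  field_simp

lemma hasSum_gaussDeriv (a b : ℂ) {c : ℂ} (hc : ∀ m : ℕ, c ≠ -m) {x : ℂ} (hx : ‖x‖ < 1) :
    HasSum (fun n => gaussCoeff a b c (n + 1) * (n + 1 : ℕ) * x ^ n) (gaussDeriv a b c x) := by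
  simp_rw [gaussCoeff_succ_mul a b hc, mul_assoc]
  exact (hasSum_gauss (a + 1) (b + 1) (ne_neg_natCast_add_one hc) hx).mul_left (a * b / c)

lemma hasDerivAt_gauss (a b : ℂ) {c : ℂ} (hc : ∀ m : ℕ, c ≠ -m) {x : ℂ} (hx : ‖x‖ < 1) :
    HasDerivAt (₂F₁ a b c) (gaussDeriv a b c x) x :=
  hasDerivAt_of_hasSum_mul_pow (fun _ => hasSum_gauss a b hc) (fun _ => hasSum_gaussDeriv a b hc) hx

lemma hasDerivAt_gaussDeriv (a b : ℂ) {c : ℂ} (hc : ∀ m : ℕ, c ≠ -m) {x : ℂ} (hx : ‖x‖ < 1) :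
    HasDerivAt (gaussDeriv a b c) (gaussDeriv2 a b c x) x :=
  (hasDerivAt_gauss (a + 1) (b + 1) (ne_neg_natCast_add_one hc) hx).const_mul (a * b / c)

lemma hasSum_natCast_mul_pow {u : ℕ → ℂ} {x S : ℂ}
    (h : HasSum (fun n => u (n + 1) * (n + 1 : ℕ) * x ^ n) S) :
    HasSum (fun n => u n * n * x ^ n) (x * S) := by
  rw [← hasSum_nat_add_iff' 1]
  simpa [pow_succ, mul_comm, mul_left_comm, mul_assoc] using h.mul_left x

lemma hasSum_mul_gaussDeriv2 (a b : ℂ) {c : ℂ} (hc : ∀ m : ℕ, c ≠ -m) {x : ℂ} (hx : ‖x‖ < 1) :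
    HasSum (fun n => gaussCoeff a b c (n + 1) * (n + 1 : ℕ) * n * x ^ n)
      (x * gaussDeriv2 a b c x) := by
  refine hasSum_natCast_mul_pow (u := fun n => gaussCoeff a b c (n + 1) * (n + 1 : ℕ)) ?_
  simp_rw [gaussDeriv2, gaussCoeff_succ_mul a b hc, mul_assoc]
  simpa only [mul_assoc] using
    (hasSum_gaussDeriv (a + 1) (b + 1) (ne_neg_natCast_add_one hc) hx).mul_left (a * b / c)

/-- Term by term, in terms of `ϑ = x d/dx` this is the recurrence of the coefficients. -/
lemma gauss_ode (a b : ℂ) {c : ℂ} (hc : ∀ m : ℕ, c ≠ -m) {x : ℂ} (hx : ‖x‖ < 1) :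
    x * (1 - x) * gaussDeriv2 a b c x + (c - (a + b + 1) * x) * gaussDeriv a b c x =
      a * b * ₂F₁ a b c x := by
  have hF := hasSum_gauss a b hc hx
  have hF' := hasSum_gaussDeriv a b hc hx
  have hϑF := hasSum_natCast_mul_pow hF'
  have hϑF' := hasSum_mul_gaussDeriv2 a b hc hx
  have hϑϑF : HasSum (fun n => gaussCoeff a b c n * n * n * x ^ n)
      (x * (gaussDeriv a b c x + x * gaussDeriv2 a b c x)) := by
    refine hasSum_natCast_mul_pow (u := fun n => gaussCoeff a b c n * n) ?_
    refine (congrArg (HasSum · _) (funext fun n => ?_)).mp (hF'.add hϑF')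
    push_cast
    ring
  have hrec : (fun n => gaussCoeff a b c (n + 1) * (n + 1 : ℕ) * n * x ^ n +
        c * (gaussCoeff a b c (n + 1) * (n + 1 : ℕ) * x ^ n)) =
      fun n => gaussCoeff a b c n * n * n * x ^ n + (a + b) * (gaussCoeff a b c n * n * x ^ n) +
        a * b * (gaussCoeff a b c n * x ^ n) := funext fun n => by
    linear_combination x ^ n * gaussCoeff_recurrence a b hc n
  have h := hrec ▸ hϑF'.add (hF'.mul_left c)
  have := h.unique ((hϑϑF.add (hϑF.mul_left (a + b))).add (hF.mul_left (a * b)))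
  linear_combination this

open MeasureTheory

/-! ### Moments of kernels on the unit interval -/

/-- `HasMoment k w m`: the integral `∫_0^1 k(t) t^w dt` converges absolutely, with value `m`.
This is the Mellin transform of the kernel `k` on `(0, 1)` at the point `w + 1`. -/
structure HasMoment (k : ℝ → ℂ) (w m : ℂ) : Prop where
  integrable : IntegrableOn (fun t : ℝ => k t * (t : ℂ) ^ w) (Ioo 0 1)
  integral : ∫ t in Ioo (0 : ℝ) 1, k t * (t : ℂ) ^ w = m

lemma HasMoment.const_mul {k : ℝ → ℂ} {w m : ℂ} (h : HasMoment k w m) (c : ℂ) :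
    HasMoment (fun t => c * k t) w (c * m) := by
  refine ⟨?_, ?_⟩
  · simpa only [IntegrableOn, mul_assoc] using Integrable.const_mul h.integrable c
  · simp only [mul_assoc]
    rw [integral_const_mul, h.integral]

lemma HasMoment.mul_cpow {k : ℝ → ℂ} {w m : ℂ} (s : ℂ) (h : HasMoment k (w + s) m) :
    HasMoment (fun t : ℝ => k t * (t : ℂ) ^ s) w m := by
  have e : EqOn (fun t : ℝ => k t * (t : ℂ) ^ s * (t : ℂ) ^ w)
      (fun t : ℝ => k t * (t : ℂ) ^ (w + s)) (Ioo 0 1) := fun t ht => by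
    have : (t : ℂ) ≠ 0 := by exact_mod_cast ht.1.ne'
    simp only [Complex.cpow_add _ _ this]
    ring
  exact ⟨h.integrable.congr_fun e.symm measurableSet_Ioo,
    (setIntegral_congr_fun measurableSet_Ioo e).trans h.integral⟩

lemma hasMoment_one_sub_cpow {α p : ℂ} (hα : 0 < α.re) (hp : 0 < p.re) :
    HasMoment (fun t : ℝ => ((1 - t : ℝ) : ℂ) ^ (α - 1)) (p - 1)
      (Complex.Gamma p * Complex.Gamma α / Complex.Gamma (p + α)) := by
  have h := Complex.betaIntegral_convergent hp hα
  rw [intervalIntegrable_iff_integrableOn_Ioo_of_le zero_le_one] at h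
  refine ⟨?_, ?_⟩
  · refine h.congr_fun (fun t _ => ?_) measurableSet_Ioo
    push_cast
    ring
  · rw [← Complex.betaIntegral_eq_Gamma_mul_div p α hp hα, Complex.betaIntegral,
      intervalIntegral.integral_of_le zero_le_one, integral_Ioc_eq_integral_Ioo]
    refine setIntegral_congr_fun measurableSet_Ioo fun t _ => ?_
    push_cast
    ring

lemma hasMoment_one_sub_cpow_neg {μ w : ℂ} (hμ : μ.re < 1) (hw : -1 < w.re) :
    HasMoment (fun t : ℝ => ((1 - t : ℝ) : ℂ) ^ (-μ)) w
      (Complex.Gamma (w + 1) * Complex.Gamma (1 - μ) / Complex.Gamma (w + 1 + (1 - μ))) := by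
  have h := hasMoment_one_sub_cpow (α := 1 - μ) (p := w + 1)
    (by simpa using hμ) (by simpa using by linarith)
  rwa [add_sub_cancel_right, sub_sub_cancel_left] at h

section RealBeta

variable {a p : ℝ}

lemma ofReal_one_sub_rpow_mul_rpow {t : ℝ} (ht : t ∈ Ioo (0 : ℝ) 1) :
    (((1 - t) ^ (a - 1) * t ^ (p - 1) : ℝ) : ℂ) =
      ((1 - t : ℝ) : ℂ) ^ ((a : ℂ) - 1) * (t : ℂ) ^ ((p : ℂ) - 1) := by
  push_cast [Complex.ofReal_cpow ht.1.le, Complex.ofReal_cpow (sub_pos.2 ht.2).le]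
  rfl

lemma integrableOn_one_sub_rpow_mul_rpow (ha : 0 < a) (hp : 0 < p) :
    IntegrableOn (fun t : ℝ => (1 - t) ^ (a - 1) * t ^ (p - 1)) (Ioo 0 1) := by
  have h : HasMoment _ ((p : ℂ) - 1) _ := hasMoment_one_sub_cpow (α := a) (p := p) ha hp
  exact IntegrableOn.congr_fun h.integrable.re
    (fun t ht => by
      simp only [← ofReal_one_sub_rpow_mul_rpow ht, RCLike.re_to_complex, Complex.ofReal_re])
    measurableSet_Ioo

lemma integral_one_sub_rpow_mul_rpow (ha : 0 < a) (hp : 0 < p) :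
    ∫ t in Ioo (0 : ℝ) 1, (1 - t) ^ (a - 1) * t ^ (p - 1) =
      Real.Gamma p * Real.Gamma a / Real.Gamma (p + a) := by
  have h : HasMoment _ ((p : ℂ) - 1) _ := hasMoment_one_sub_cpow (α := a) (p := p) ha hp
  apply Complex.ofReal_injective
  rw [← integral_complex_ofReal,
    setIntegral_congr_fun measurableSet_Ioo fun t ht => ofReal_one_sub_rpow_mul_rpow ht, h.integral,
    ← Complex.ofReal_add]
  simp only [Complex.Gamma_ofReal, Complex.ofReal_mul, Complex.ofReal_div]

end RealBeta

lemma hasDerivAt_ofReal_cpow {t : ℝ} (ht : 0 < t) (s : ℂ) :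
    HasDerivAt (fun t : ℝ => (t : ℂ) ^ s) (s * (t : ℂ) ^ (s - 1)) t := by
  have h := (hasDerivAt_id (t : ℂ)).cpow_const (c := s) (Or.inl (by simpa using ht))
  simpa using h.comp_ofReal

lemma hasDerivAt_one_sub_cpow {t : ℝ} (ht : t < 1) (s : ℂ) :
    HasDerivAt (fun t : ℝ => ((1 - t : ℝ) : ℂ) ^ s) (-(s * ((1 - t : ℝ) : ℂ) ^ (s - 1))) t := by
  have h := (hasDerivAt_ofReal_cpow (sub_pos.2 ht) s).scomp t ((hasDerivAt_id t).const_sub 1)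
  simpa [Function.comp_def] using h

lemma norm_ofReal_cpow {t : ℝ} (ht : 0 < t) (s : ℂ) : ‖(t : ℂ) ^ s‖ = t ^ s.re :=
  Complex.norm_cpow_eq_rpow_re_of_pos ht s

/-- `h` is differentiable on `(0, 1]` with derivative `h1`, and `h = O(t^(-N))`,
`h1 = O(t^(-N-1))` at `0`: the regularity of the factors `h` of the kernels `(1 - t)^(-μ) h(t)`. -/
structure PowerGrowth (N : ℝ) (h h1 : ℝ → ℂ) : Prop where
  hasDerivAt : ∀ t ∈ Ioc (0 : ℝ) 1, HasDerivAt h (h1 t) t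
  bound : ∃ C, 0 ≤ C ∧ ∀ t ∈ Ioc (0 : ℝ) 1, ‖h t‖ ≤ C * t ^ (-N) ∧ ‖h1 t‖ ≤ C * t ^ (-N - 1)

section PowerGrowth

variable {N : ℝ} {h h1 : ℝ → ℂ} {μ w : ℂ}

lemma PowerGrowth.integrable (H : PowerGrowth N h h1) (hμ : μ.re < 1) (hw : N - 1 < w.re) :
    IntegrableOn (fun t : ℝ => ((1 - t : ℝ) : ℂ) ^ (-μ) * h t * (t : ℂ) ^ w) (Ioo 0 1) := by
  obtain ⟨C, -, hC⟩ := H.bound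
  have dominating := (integrableOn_one_sub_rpow_mul_rpow (a := 1 - μ.re) (p := w.re - N + 1)
    (by linarith) (by linarith)).const_mul C
  refine Integrable.mono' dominating ?_ ?_
  · refine ContinuousOn.aestronglyMeasurable (fun t ht => ContinuousAt.continuousWithinAt ?_)
      measurableSet_Ioo
    exact ((hasDerivAt_one_sub_cpow ht.2 _).continuousAt.mul
      (H.hasDerivAt t ⟨ht.1, ht.2.le⟩).continuousAt).mul
        (hasDerivAt_ofReal_cpow ht.1 w).continuousAt
  · refine (ae_restrict_iff' measurableSet_Ioo).2 (Eventually.of_forall fun t ht => ?_)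
    have ht' : 0 < 1 - t := sub_pos.2 ht.2
    have := ht.1
    rw [norm_mul, norm_mul, norm_ofReal_cpow ht', norm_ofReal_cpow ht.1, Complex.neg_re]
    calc _ ≤ (1 - t) ^ (-μ.re) * (C * t ^ (-N)) * t ^ w.re := by
          gcongr
          exact (hC t ⟨ht.1, ht.2.le⟩).1
      _ = C * ((1 - t) ^ (-μ.re) * (t ^ w.re * t ^ (-N))) := by ring
      _ = _ := by rw [← Real.rpow_add ht.1]; ring_nf

lemma PowerGrowth.norm_sub_one_le (H : PowerGrowth N h h1) :
    ∃ C, 0 ≤ C ∧ ∀ t ∈ Ioo (0 : ℝ) 1, ‖h t - h 1‖ ≤ C * ((1 - t) * t ^ (-max (N + 1) 0)) := by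
  obtain ⟨C, hC0, hC⟩ := H.bound
  refine ⟨C, hC0, fun t ht => ?_⟩
  have hb : ∀ s ∈ Icc t 1, ‖h1 s‖ ≤ C * t ^ (-max (N + 1) 0) := by
    intro s hs
    have hs0 : 0 < s := ht.1.trans_le hs.1
    refine (hC s ⟨hs0, hs.2⟩).2.trans (mul_le_mul_of_nonneg_left ?_ hC0)
    calc s ^ (-N - 1) ≤ s ^ (-max (N + 1) 0) :=
          Real.rpow_le_rpow_of_exponent_ge hs0 hs.2 (by linarith [le_max_left (N + 1) 0])
      _ ≤ _ := Real.rpow_le_rpow_of_nonpos ht.1 hs.1 (by linarith [le_max_right (N + 1) 0])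
  have mean_value := (convex_Icc t 1).norm_image_sub_le_of_norm_hasDerivWithin_le
    (fun s hs => (H.hasDerivAt s ⟨ht.1.trans_le hs.1, hs.2⟩).hasDerivWithinAt) hb
    (right_mem_Icc.2 ht.2.le) (left_mem_Icc.2 ht.2.le)
  refine mean_value.trans (le_of_eq ?_)
  rw [Real.norm_of_nonpos (by linarith [ht.2])]
  ring

/-- `h` solves `t² ((1 - t²) h'' + 2 (μ - t) h') = (α - β t²) h` on `(0, 1)`, where `h1 = h'` and
`h2 = h''`. Integration by parts turns this equation into a relation between the moments of
`(1 - t)^(-μ) h(t)` at `w` and at `w + 2` only. -/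
structure IsMellinSolution (μ α β : ℂ) (h h1 h2 : ℝ → ℂ) : Prop where
  hasDerivAt : ∀ t ∈ Ioo (0 : ℝ) 1, HasDerivAt h1 (h2 t) t
  eq : ∀ t ∈ Ioo (0 : ℝ) 1, (t : ℂ) ^ 2 * ((1 - (t : ℂ) ^ 2) * h2 t + 2 * (μ - t) * h1 t) =
    (α - β * (t : ℂ) ^ 2) * h t

/-- The primitive of `((w + 1)(w + 2) - α - ((w + 2 - μ)(w + 3 - μ) - β) t²) (1 - t)^(-μ) h(t) t^w`
for a solution `h` of `IsMellinSolution μ α β`. -/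
noncomputable def momentPrimitive (μ w : ℂ) (h h1 : ℝ → ℂ) (t : ℝ) : ℂ :=
  ((1 - t : ℝ) : ℂ) ^ (1 - μ) * (t : ℂ) ^ (w + 1) *
    (((2 + w) + (2 + w - μ) * t) * h t - t * (1 + t) * h1 t)

lemma IsMellinSolution.hasDerivAt_momentPrimitive {h2 : ℝ → ℂ} {α β : ℂ}
    (S : IsMellinSolution μ α β h h1 h2) {t : ℝ} (ht : t ∈ Ioo (0 : ℝ) 1)
    (hh : HasDerivAt h (h1 t) t) :
    HasDerivAt (momentPrimitive μ w h h1)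
      (((w + 1) * (w + 2) - α) * (((1 - t : ℝ) : ℂ) ^ (-μ) * h t * (t : ℂ) ^ w) -
        ((w + 2 - μ) * (w + 3 - μ) - β) *
          (((1 - t : ℝ) : ℂ) ^ (-μ) * h t * (t : ℂ) ^ (w + 2))) t := by
  have dt : HasDerivAt (fun t : ℝ => (t : ℂ)) 1 t := by simpa using (hasDerivAt_id t).ofReal_comp
  refine ((hasDerivAt_one_sub_cpow ht.2 (1 - μ)).mul (hasDerivAt_ofReal_cpow ht.1 (w + 1))
    |>.mul (((dt.const_mul (2 + w - μ)).const_add (2 + w) |>.mul hh).sub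
      ((dt.mul (dt.const_add 1)).mul (S.hasDerivAt t ht)))).congr_deriv ?_
  have t0 : (t : ℂ) ≠ 0 := by exact_mod_cast ht.1.ne'
  have t1 : ((1 - t : ℝ) : ℂ) ≠ 0 := by exact_mod_cast (sub_pos.2 ht.2).ne'
  rw [show w + 1 - 1 = w by ring, show w + 2 = w + 1 + 1 by ring,
    show 1 - μ - 1 = -μ by ring, show 1 - μ = -μ + 1 by ring]
  simp only [Complex.cpow_add _ _ t0, Complex.cpow_add _ _ t1, Complex.cpow_one, Pi.mul_apply,
    Pi.sub_apply]
  push_cast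
  linear_combination -((1 - t : ℂ) ^ (-μ) * (t : ℂ) ^ w) * S.eq t ht

lemma PowerGrowth.norm_momentPrimitive_le (H : PowerGrowth N h h1) (μ w : ℂ) :
    ∃ C, ∀ t ∈ Ioo (0 : ℝ) 1,
      ‖momentPrimitive μ w h h1 t‖ ≤ (1 - t) ^ (1 - μ.re) * t ^ (w.re + 1 - N) * C := by
  obtain ⟨C, -, hC⟩ := H.bound
  refine ⟨(‖2 + w‖ + ‖2 + w - μ‖ + 2) * C, fun t ht => ?_⟩
  obtain ⟨b0, b1⟩ := hC t ⟨ht.1, ht.2.le⟩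
  have ht' : (0 : ℝ) < 1 - t := sub_pos.2 ht.2
  have norm_t : ‖(t : ℂ)‖ = t := by rw [Complex.norm_real, Real.norm_of_nonneg ht.1.le]
  have coeff_h : ‖(2 + w) + (2 + w - μ) * t‖ ≤ ‖2 + w‖ + ‖2 + w - μ‖ := by
    refine (norm_add_le _ _).trans ?_
    rw [norm_mul, norm_t]
    nlinarith [norm_nonneg (2 + w - μ), ht.2]
  have coeff_h1 : ‖(t : ℂ) * (1 + t)‖ ≤ t * 2 := by
    rw [norm_mul, norm_t]
    refine mul_le_mul_of_nonneg_left ((norm_add_le _ _).trans ?_) ht.1.le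
    rw [norm_t, norm_one]
    linarith [ht.2]
  have split_rpow : t ^ (-N) = t * t ^ (-N - 1) := by
    rw [Real.rpow_sub_one ht.1.ne', mul_div_cancel₀ _ ht.1.ne']
  have last_factor : ‖((2 + w) + (2 + w - μ) * t) * h t - t * (1 + t) * h1 t‖ ≤
      t ^ (-N) * ((‖2 + w‖ + ‖2 + w - μ‖ + 2) * C) := by
    calc _ ≤ ‖((2 + w) + (2 + w - μ) * t) * h t‖ + ‖t * (1 + t) * h1 t‖ := norm_sub_le _ _
      _ ≤ (‖2 + w‖ + ‖2 + w - μ‖) * (C * t ^ (-N)) + t * 2 * (C * t ^ (-N - 1)) := by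
        rw [norm_mul, norm_mul (_ * _)]
        have := ht.1
        gcongr
      _ = _ := by rw [split_rpow]; ring
  rw [momentPrimitive, norm_mul, norm_mul, norm_ofReal_cpow ht', norm_ofReal_cpow ht.1,
    sub_eq_add_neg _ N, Real.rpow_add ht.1]
  simp only [Complex.sub_re, Complex.one_re, Complex.add_re, mul_assoc] at last_factor ⊢
  have := ht.1
  gcongr

lemma PowerGrowth.tendsto_momentPrimitive_zero (H : PowerGrowth N h h1) (hμ : μ.re < 1)
    (hw : N - 1 < w.re) {x : ℝ} (hx : x = 0 ∨ x = 1) :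
    Tendsto (momentPrimitive μ w h h1) (𝓝[Ioo 0 1] x) (𝓝 0) := by
  obtain ⟨C, hC⟩ := H.norm_momentPrimitive_le μ w
  have cont : ContinuousAt (fun t : ℝ => (1 - t) ^ (1 - μ.re) * t ^ (w.re + 1 - N) * C) x := by
    refine ((ContinuousAt.rpow_const (by fun_prop) (Or.inr ?_)).mul
      (ContinuousAt.rpow_const (by fun_prop) (Or.inr ?_))).mul continuousAt_const <;> linarith
  have bound_tendsto : Tendsto (fun t : ℝ => (1 - t) ^ (1 - μ.re) * t ^ (w.re + 1 - N) * C)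
      (𝓝 x) (𝓝 0) := by
    have h0 : w.re + 1 - N ≠ 0 := by linarith
    have h1 : 1 - μ.re ≠ 0 := by linarith
    rcases hx with rfl | rfl
    · simpa [ContinuousAt, Real.zero_rpow h0] using cont
    · simpa [ContinuousAt, Real.zero_rpow h1] using cont
  exact squeeze_zero_norm' (eventually_nhdsWithin_of_forall hC)
    (bound_tendsto.mono_left nhdsWithin_le_nhds)

lemma IsMellinSolution.moment_recursion {h2 : ℝ → ℂ} {α β : ℂ}
    (S : IsMellinSolution μ α β h h1 h2) (H : PowerGrowth N h h1)
    (hμ : μ.re < 1) (hw : N - 1 < w.re) :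
    ((w + 1) * (w + 2) - α) *
        ∫ t in Ioo (0 : ℝ) 1, ((1 - t : ℝ) : ℂ) ^ (-μ) * h t * (t : ℂ) ^ w =
      ((w + 2 - μ) * (w + 3 - μ) - β) *
        ∫ t in Ioo (0 : ℝ) 1, ((1 - t : ℝ) : ℂ) ^ (-μ) * h t * (t : ℂ) ^ (w + 2) := by
  have i0 := (H.integrable hμ hw).const_mul ((w + 1) * (w + 2) - α)
  have i2 := (H.integrable (w := w + 2) hμ (by simpa using by linarith)).const_mul
    ((w + 2 - μ) * (w + 3 - μ) - β)
  have at_zero := H.tendsto_momentPrimitive_zero hμ hw (Or.inl rfl)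
  have at_one := H.tendsto_momentPrimitive_zero hμ hw (Or.inr rfl)
  rw [nhdsWithin_Ioo_eq_nhdsGT zero_lt_one] at at_zero
  rw [nhdsWithin_Ioo_eq_nhdsLT zero_lt_one] at at_one
  have ftc := intervalIntegral.integral_eq_sub_of_hasDerivAt_of_tendsto zero_lt_one
    (fun t ht => S.hasDerivAt_momentPrimitive ht (H.hasDerivAt t ⟨ht.1, ht.2.le⟩))
    ((intervalIntegrable_iff_integrableOn_Ioo_of_le zero_le_one).2 (i0.sub i2)) at_zero at_one
  rw [intervalIntegral.integral_of_le zero_le_one, integral_Ioc_eq_integral_Ioo,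
    integral_sub i0 i2, integral_const_mul, integral_const_mul, sub_zero] at ftc
  exact sub_eq_zero.1 ftc

/-! ### Asymptotics of moments -/

lemma norm_integral_mul_cpow_le {g : ℝ → ℂ} {a C : ℝ} (ha : 0 < a)
    (hg : ∀ t ∈ Ioo (0 : ℝ) 1, ‖g t‖ ≤ C * ((1 - t) ^ (a - 1) * t ^ (-N)))
    (hw : N < w.re + 1) :
    ‖∫ t in Ioo (0 : ℝ) 1, g t * (t : ℂ) ^ w‖ ≤
      C * (Real.Gamma (w.re - N + 1) * Real.Gamma a / Real.Gamma (w.re - N + 1 + a)) := by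
  have hp : 0 < w.re - N + 1 := by linarith
  rw [← integral_one_sub_rpow_mul_rpow ha hp, ← integral_const_mul]
  refine norm_integral_le_of_norm_le ((integrableOn_one_sub_rpow_mul_rpow ha hp).const_mul C)
    ((ae_restrict_iff' measurableSet_Ioo).2 (Eventually.of_forall fun t ht => ?_))
  rw [norm_mul, norm_ofReal_cpow ht.1]
  calc _ ≤ C * ((1 - t) ^ (a - 1) * t ^ (-N)) * t ^ w.re := by
        have := ht.1
        gcongr
        exact hg t ht
    _ = C * ((1 - t) ^ (a - 1) * (t ^ w.re * t ^ (-N))) := by ring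
    _ = _ := by rw [← Real.rpow_add ht.1]; ring_nf

lemma tendsto_rpow_mul_Gamma_ratio (x a : ℝ) :
    Tendsto (fun n : ℕ => (n : ℝ) ^ a *
      (Real.Gamma (x + 2 * n + 1) / Real.Gamma (x + a + 2 * n + 1))) atTop (𝓝 (2 ^ (-a))) := by
  have h := (Complex.continuous_re.tendsto _).comp (tendsto_Gamma_ratio_two_mul x a)
  have limit : ((2 : ℂ) ^ (-(a : ℂ))).re = 2 ^ (-a) := by
    rw [← Complex.ofReal_ofNat, ← Complex.ofReal_neg, ← Complex.ofReal_cpow two_pos.le,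
      Complex.ofReal_re]
  rw [limit] at h
  refine h.congr fun n => ?_
  rw [Function.comp_apply, ← Complex.ofReal_re (_ * _)]
  push_cast [← Complex.Gamma_ofReal, Complex.ofReal_cpow n.cast_nonneg]
  rfl

lemma tendsto_cpow_mul_integral_zero {g : ℝ → ℂ} {a C : ℝ} (ha : 0 < a)
    (hg : ∀ t ∈ Ioo (0 : ℝ) 1, ‖g t‖ ≤ C * ((1 - t) ^ (a - 1) * t ^ (-N)))
    {c : ℂ} (hc : c.re < a) :
    Tendsto (fun n : ℕ => (n : ℂ) ^ c * ∫ t in Ioo (0 : ℝ) 1, g t * (t : ℂ) ^ (w + 2 * n))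
      atTop (𝓝 0) := by
  have decay : Tendsto (fun n : ℕ => (n : ℝ) ^ (-(a - c.re))) atTop (𝓝 0) :=
    (tendsto_rpow_neg_atTop (sub_pos.2 hc)).comp tendsto_natCast_atTop_atTop
  have majorant := (decay.mul (tendsto_rpow_mul_Gamma_ratio (w.re - N) a)).const_mul
    (C * Real.Gamma a)
  rw [zero_mul, mul_zero] at majorant
  refine squeeze_zero_norm' ?_ majorant
  obtain ⟨n0, hn0⟩ := exists_nat_gt (N - w.re - 1)
  filter_upwards [eventually_ge_atTop n0, eventually_gt_atTop 0] with n hn hpos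
  have hnn : (n0 : ℝ) ≤ n := by exact_mod_cast hn
  have hre : (w + 2 * n).re = w.re + 2 * n := by simp
  have bound := norm_integral_mul_cpow_le (w := w + 2 * n) ha hg (by rw [hre]; linarith)
  rw [norm_mul, Complex.norm_natCast_cpow_of_pos hpos]
  refine (mul_le_mul_of_nonneg_left bound (by positivity)).trans (le_of_eq ?_)
  have split : (n : ℝ) ^ c.re = (n : ℝ) ^ (-(a - c.re)) * (n : ℝ) ^ a := by
    rw [← Real.rpow_add (by exact_mod_cast hpos)]
    ring_nf
  rw [split, hre]
  ring_nf

lemma tendsto_cpow_mul_integral_one_sub_cpow (hμ : μ.re < 1) (w : ℂ) :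
    Tendsto (fun n : ℕ => (n : ℂ) ^ (1 - μ) *
      ∫ t in Ioo (0 : ℝ) 1, ((1 - t : ℝ) : ℂ) ^ (-μ) * (t : ℂ) ^ (w + 2 * n)) atTop
      (𝓝 (2 ^ (μ - 1) * Complex.Gamma (1 - μ))) := by
  have h := (tendsto_Gamma_ratio_two_mul w (1 - μ)).mul_const (Complex.Gamma (1 - μ))
  rw [neg_sub] at h
  refine h.congr' ?_
  obtain ⟨n0, hn0⟩ := exists_nat_gt (-w.re - 1)
  filter_upwards [eventually_ge_atTop n0] with n hn
  have hnn : (n0 : ℝ) ≤ n := by exact_mod_cast hn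
  rw [(hasMoment_one_sub_cpow_neg (w := w + 2 * n) hμ (by simpa using by linarith)).integral]
  ring_nf

/-- The factor `h` may be frozen at `t = 1`, where `t^(w + 2n)` concentrates as `n → ∞`. -/
lemma PowerGrowth.tendsto_cpow_mul_moment (H : PowerGrowth N h h1) (hμ : μ.re < 1) (w : ℂ) :
    Tendsto (fun n : ℕ => (n : ℂ) ^ (1 - μ) *
      ∫ t in Ioo (0 : ℝ) 1, ((1 - t : ℝ) : ℂ) ^ (-μ) * h t * (t : ℂ) ^ (w + 2 * n)) atTop
      (𝓝 (2 ^ (μ - 1) * Complex.Gamma (1 - μ) * h 1)) := by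
  obtain ⟨C, -, hC⟩ := H.norm_sub_one_le
  have error_bound : ∀ t ∈ Ioo (0 : ℝ) 1, ‖((1 - t : ℝ) : ℂ) ^ (-μ) * (h t - h 1)‖ ≤
      C * ((1 - t) ^ (2 - μ.re - 1) * t ^ (-max (N + 1) 0)) := fun t ht => by
    have ht' : 0 < 1 - t := sub_pos.2 ht.2
    rw [norm_mul, norm_ofReal_cpow ht', show 2 - μ.re - 1 = (-μ).re + 1 by simp; ring,
      Real.rpow_add_one ht'.ne']
    refine (mul_le_mul_of_nonneg_left (hC t ht) (by positivity)).trans (le_of_eq (by ring))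
  have error := tendsto_cpow_mul_integral_zero (w := w) (c := 1 - μ) (by linarith) error_bound
    (by simp)
  have sum := error.add ((tendsto_cpow_mul_integral_one_sub_cpow hμ w).mul_const (h 1))
  rw [zero_add] at sum
  refine sum.congr' ?_
  obtain ⟨n0, hn0⟩ := exists_nat_gt (max (N - 1) (-1) - w.re)
  filter_upwards [eventually_ge_atTop n0] with n hn
  have hnn : (n0 : ℝ) ≤ n := by exact_mod_cast hn
  have hre : (w + 2 * n).re = w.re + 2 * n := by simp
  have moment := (hasMoment_one_sub_cpow_neg (w := w + 2 * n) hμ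
    (by rw [hre]; linarith [le_max_right (N - 1) (-1)])).integrable.mul_const (h 1)
  have full := H.integrable (w := w + 2 * n) hμ
    (by rw [hre]; linarith [le_max_left (N - 1) (-1)])
  rw [mul_assoc, ← mul_add, ← integral_mul_const, ← integral_add ?_ moment]
  · congr 2 with t
    ring
  · exact (full.sub moment).congr (Eventually.of_forall fun t => by simp only [Pi.sub_apply]; ring)

lemma inv_Gamma_mul_eq_of_poch_mul_eq {M : ℕ → ℂ} {p q r s c L : ℂ} (hsum : r + s = p + q + c)
    (hM : ∀ n, poch p n * poch q n * M 0 = poch r n * poch s n * M n)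
    (hL : Tendsto (fun n : ℕ => (n : ℂ) ^ c * M (n + 1)) atTop (𝓝 L)) :
    (Complex.Gamma p)⁻¹ * (Complex.Gamma q)⁻¹ * M 0 =
      (Complex.Gamma r)⁻¹ * (Complex.Gamma s)⁻¹ * L := by
  have right := ((tendsto_poch_succ_div r).mul (tendsto_poch_succ_div s)).mul hL
  have left := ((tendsto_poch_succ_div p).mul (tendsto_poch_succ_div q)).mul_const (M 0)
  refine tendsto_nhds_unique_of_eventuallyEq left right ?_
  filter_upwards [eventually_gt_atTop 0] with n hn
  have split : (n : ℂ) ^ r * (n : ℂ) ^ s = (n : ℂ) ^ p * (n : ℂ) ^ q * (n : ℂ) ^ c := by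
    have hn0 : (n : ℂ) ≠ 0 := by exact_mod_cast hn.ne'
    rw [← Complex.cpow_add _ _ hn0, ← Complex.cpow_add _ _ hn0, ← Complex.cpow_add _ _ hn0, hsum]
  have hf : (n.factorial : ℂ) ≠ 0 := by exact_mod_cast n.factorial_ne_zero
  have hpow := natCast_cpow_ne_zero hn.ne'
  have := hpow p
  have := hpow q
  have := hpow r
  have := hpow s
  field_simp
  linear_combination (n : ℂ) ^ r * (n : ℂ) ^ s * hM (n + 1) +
    poch r (n + 1) * poch s (n + 1) * M (n + 1) * split

/-- Iterating the recursion pushes the moment to `w + 2n`, whose asymptotics are known. -/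
lemma IsMellinSolution.hasMoment {h2 : ℝ → ℂ} {α β : ℂ} (S : IsMellinSolution μ α β h h1 h2)
    (H : PowerGrowth N h h1) (hμ : μ.re < 1) (hw : N - 1 < w.re) {p q r s : ℂ}
    (hp : 0 < p.re) (hq : 0 < q.re)
    (hpq : p + q = w + 3 / 2) (hpq' : 4 * (p * q) = (w + 1) * (w + 2) - α)
    (hrs : r + s = w + 5 / 2 - μ) (hrs' : 4 * (r * s) = (w + 2 - μ) * (w + 3 - μ) - β) :
    HasMoment (fun t => ((1 - t : ℝ) : ℂ) ^ (-μ) * h t) w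
      (2 ^ (μ - 1) * Complex.Gamma (1 - μ) * h 1 * (Complex.Gamma p * Complex.Gamma q) *
        ((Complex.Gamma r)⁻¹ * (Complex.Gamma s)⁻¹)) := by
  refine ⟨H.integrable hμ hw, ?_⟩
  set M : ℕ → ℂ := fun n =>
    ∫ t in Ioo (0 : ℝ) 1, ((1 - t : ℝ) : ℂ) ^ (-μ) * h t * (t : ℂ) ^ (w + 2 * n) with hM
  have M_zero : M 0 = ∫ t in Ioo (0 : ℝ) 1, ((1 - t : ℝ) : ℂ) ^ (-μ) * h t * (t : ℂ) ^ w := by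
    simp [hM]
  have recursion : ∀ n : ℕ, (p + n) * (q + n) * M n = (r + n) * (s + n) * M (n + 1) := by
    intro n
    have shift : w + 2 * n + 2 = w + 2 * ((n + 1 : ℕ) : ℂ) := by push_cast; ring
    have step : ((w + 2 * n + 1) * (w + 2 * n + 2) - α) * M n =
        ((w + 2 * n + 2 - μ) * (w + 2 * n + 3 - μ) - β) * M (n + 1) := by
      have := S.moment_recursion H (w := w + 2 * n) hμ
        (by simpa using by linarith [(n.cast_nonneg : (0 : ℝ) ≤ n)])
      rwa [shift] at this ⊢
    linear_combination step / 4 + (hpq' / 4 + n * hpq) * M n - (hrs' / 4 + n * hrs) * M (n + 1)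
  have iterated : ∀ n : ℕ, poch p n * poch q n * M 0 = poch r n * poch s n * M n := by
    intro n
    induction n with
    | zero => simp [poch]
    | succ n ih =>
      simp only [poch_succ]
      linear_combination (p + n) * (q + n) * ih + poch r n * poch s n * recursion n
  have asymptotics : Tendsto (fun n : ℕ => (n : ℂ) ^ (1 - μ) * M (n + 1)) atTop
      (𝓝 (2 ^ (μ - 1) * Complex.Gamma (1 - μ) * h 1)) := by
    refine (H.tendsto_cpow_mul_moment hμ (w + 2)).congr fun n => ?_
    rw [show w + 2 + 2 * (n : ℂ) = w + 2 * ((n + 1 : ℕ) : ℂ) by push_cast; ring]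
  have key := inv_Gamma_mul_eq_of_poch_mul_eq (by linear_combination hrs - hpq) iterated asymptotics
  have gp := Complex.Gamma_ne_zero_of_re_pos hp
  have gq := Complex.Gamma_ne_zero_of_re_pos hq
  rw [← M_zero]
  calc M 0 = Complex.Gamma p * Complex.Gamma q *
        ((Complex.Gamma p)⁻¹ * (Complex.Gamma q)⁻¹ * M 0) := by field_simp
    _ = _ := by rw [key]; ring

end PowerGrowth

/-! ### Mellin transforms of the Legendre kernels -/

lemma PowerGrowth.mul {N M : ℝ} {h h1 g g1 : ℝ → ℂ} (H : PowerGrowth N h h1)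
    (G : PowerGrowth M g g1) :
    PowerGrowth (N + M) (fun t => h t * g t) (fun t => h1 t * g t + h t * g1 t) := by
  obtain ⟨C, hC0, hC⟩ := H.bound
  obtain ⟨D, hD0, hD⟩ := G.bound
  refine ⟨fun t ht => (H.hasDerivAt t ht).mul (G.hasDerivAt t ht), 2 * (C * D), by positivity,
    fun t ht => ?_⟩
  obtain ⟨hh, hh1⟩ := hC t ht
  obtain ⟨hg, hg1⟩ := hD t ht
  have t0 := ht.1
  have split : t ^ (-(N + M)) = t ^ (-N) * t ^ (-M) := by rw [neg_add, Real.rpow_add t0]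
  have split_left : t ^ (-(N + M) - 1) = t ^ (-N - 1) * t ^ (-M) := by
    rw [← Real.rpow_add t0]; ring_nf
  have split_right : t ^ (-(N + M) - 1) = t ^ (-N) * t ^ (-M - 1) := by
    rw [← Real.rpow_add t0]; ring_nf
  constructor
  · calc ‖h t * g t‖ ≤ C * t ^ (-N) * (D * t ^ (-M)) := by rw [norm_mul]; gcongr
      _ = C * D * t ^ (-(N + M)) := by rw [split]; ring
      _ ≤ 2 * (C * D) * t ^ (-(N + M)) := mul_le_mul_of_nonneg_right
          (by linarith [mul_nonneg hC0 hD0]) (by positivity)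
  · calc ‖h1 t * g t + h t * g1 t‖ ≤ ‖h1 t‖ * ‖g t‖ + ‖h t‖ * ‖g1 t‖ := by
          simpa only [norm_mul] using norm_add_le (h1 t * g t) (h t * g1 t)
      _ ≤ C * t ^ (-N - 1) * (D * t ^ (-M)) + C * t ^ (-N) * (D * t ^ (-M - 1)) := by gcongr
      _ = C * D * (t ^ (-N - 1) * t ^ (-M)) + C * D * (t ^ (-N) * t ^ (-M - 1)) := by ring
      _ = 2 * (C * D) * t ^ (-(N + M) - 1) := by rw [← split_left, ← split_right]; ring

section GaussComp

variable (a b : ℂ) {c : ℂ} {φ : ℝ → ℝ}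

lemma hasDerivAt_gauss_comp (hc : ∀ m : ℕ, c ≠ -m) {d t : ℝ} (hφ : HasDerivAt φ d t)
    (ht : |φ t| < 1) :
    HasDerivAt (fun t => ₂F₁ a b c ((φ t : ℝ) : ℂ)) (d * gaussDeriv a b c (φ t)) t := by
  rw [mul_comm]
  exact (hasDerivAt_gauss a b hc (by rwa [Complex.norm_real])).comp_of_eq t hφ.ofReal_comp rfl

lemma hasDerivAt_gaussDeriv_comp (hc : ∀ m : ℕ, c ≠ -m) {d t : ℝ} (hφ : HasDerivAt φ d t)
    (ht : |φ t| < 1) :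
    HasDerivAt (fun t => gaussDeriv a b c ((φ t : ℝ) : ℂ)) (d * gaussDeriv2 a b c (φ t)) t := by
  rw [mul_comm]
  exact (hasDerivAt_gaussDeriv a b hc (by rwa [Complex.norm_real])).comp_of_eq t hφ.ofReal_comp rfl

variable {a b}

lemma exists_norm_gauss_comp_le (hc : ∀ m : ℕ, c ≠ -m) {s : ℝ} (hs : 0 < s)
    (h : (a + b - c).re ≤ s) {κ δ : ℝ} (hδ : 0 < δ)
    (hφ : ∀ t ∈ Ioc (0 : ℝ) 1, δ * t ^ κ ≤ 1 - |φ t|) :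
    ∃ K, 0 < K ∧ ∀ t ∈ Ioc (0 : ℝ) 1, ‖₂F₁ a b c ((φ t : ℝ) : ℂ)‖ ≤ K * t ^ (-(κ * s)) := by
  obtain ⟨K, hK0, hK⟩ := gauss_norm_le (a := a) (b := b) hc hs h
  refine ⟨K * δ ^ (-s), by positivity, fun t ht => ?_⟩
  have t0 := ht.1
  have gap : 0 < δ * t ^ κ := by positivity
  calc _ ≤ K * (1 - |φ t|) ^ (-s) := by
        simpa [Complex.norm_real] using hK (φ t : ℝ) (by
          rw [Complex.norm_real, Real.norm_eq_abs]; linarith [hφ t ht])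
    _ ≤ K * (δ * t ^ κ) ^ (-s) := mul_le_mul_of_nonneg_left
        (Real.rpow_le_rpow_of_nonpos gap (hφ t ht) (by linarith)) hK0.le
    _ = _ := by rw [Real.mul_rpow hδ.le (by positivity), ← Real.rpow_mul t0.le]; ring_nf

lemma powerGrowth_gauss_comp (hc : ∀ m : ℕ, c ≠ -m) {s : ℝ} (hs : 0 < s)
    (h : (a + b - c).re ≤ s) {κ δ D : ℝ} (hκ : κ ≤ 1) (hδ : 0 < δ) {φ' : ℝ → ℝ}
    (hφ : ∀ t ∈ Ioc (0 : ℝ) 1, δ * t ^ κ ≤ 1 - |φ t|)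
    (hφ' : ∀ t ∈ Ioc (0 : ℝ) 1, HasDerivAt φ (φ' t) t) (hD : ∀ t ∈ Ioc (0 : ℝ) 1, |φ' t| ≤ D) :
    PowerGrowth (κ * s) (fun t => ₂F₁ a b c ((φ t : ℝ) : ℂ))
      (fun t => φ' t * gaussDeriv a b c (φ t)) := by
  obtain ⟨K, hK0, hK⟩ := exists_norm_gauss_comp_le hc hs h hδ hφ
  obtain ⟨L, hL0, hL⟩ := exists_norm_gauss_comp_le (a := a + 1) (b := b + 1)
    (ne_neg_natCast_add_one hc) (s := s + 1) (by linarith)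
    (by simp only [Complex.sub_re, Complex.add_re, Complex.one_re] at h ⊢; linarith) hδ hφ
  have hD0 : 0 ≤ D := (abs_nonneg _).trans (hD 1 ⟨one_pos, le_rfl⟩)
  refine ⟨fun t ht => hasDerivAt_gauss_comp a b hc (hφ' t ht) ?_, K + D * (‖a * b / c‖ * L),
    by positivity, fun t ht => ⟨(hK t ht).trans ?_, ?_⟩⟩
  · have := mul_pos hδ (Real.rpow_pos_of_pos ht.1 κ)
    linarith [hφ t ht]
  · have := ht.1
    gcongr
    linarith [show 0 ≤ D * (‖a * b / c‖ * L) by positivity]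
  · have t0 := ht.1
    calc _ = |φ' t| * (‖a * b / c‖ * ‖₂F₁ (a + 1) (b + 1) (c + 1) ((φ t : ℝ) : ℂ)‖) := by
          rw [gaussDeriv, norm_mul, norm_mul, Complex.norm_real, Real.norm_eq_abs]
      _ ≤ D * (‖a * b / c‖ * (L * t ^ (-(κ * (s + 1))))) := by
          gcongr
          exacts [hD t ht, hL t ht]
      _ ≤ D * (‖a * b / c‖ * (L * t ^ (-(κ * s) - 1))) := by
          gcongr 3
          exact Real.rpow_le_rpow_of_exponent_ge t0 ht.2 (by linarith)
      _ = D * (‖a * b / c‖ * L) * t ^ (-(κ * s) - 1) := by ring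
      _ ≤ _ := by gcongr; linarith

end GaussComp

lemma one_sub_ne_neg_natCast {μ : ℂ} (hμ : μ.re < 1) : ∀ m : ℕ, 1 - μ ≠ -m :=
  ne_neg_natCast_of_re_pos (by simpa using hμ)

/-- The regular factor of the kernel of `E_{0+}^{ν,μ}`, up to `1 / Γ(1 - μ)`. -/
noncomputable def cutFactor (ν μ : ℂ) (t : ℝ) : ℂ :=
  ₂F₁ (-ν) (ν + 1) (1 - μ) (((1 - t) / 2 : ℝ) : ℂ)

lemma cutFactor_one (ν μ : ℂ) : cutFactor ν μ 1 = 1 := by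
  simp [cutFactor]

lemma hasDerivAt_one_sub_div_two (t : ℝ) :
    HasDerivAt (fun t : ℝ => (1 - t) / 2) (-1 / 2) t :=
  ((hasDerivAt_id t).const_sub 1).div_const 2

lemma abs_one_sub_div_two {t : ℝ} (ht : t ≤ 1) : |(1 - t) / 2| = (1 - t) / 2 :=
  abs_of_nonneg (by linarith)

section CutFactor

variable (ν : ℂ) {μ : ℂ}

lemma powerGrowth_cutFactor (hμ : μ.re < 1) :
    PowerGrowth 0 (cutFactor ν μ) (fun t =>
      (-1 / 2 : ℝ) * gaussDeriv (-ν) (ν + 1) (1 - μ) (((1 - t) / 2 : ℝ) : ℂ)) := by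
  set x := (-ν + (ν + 1) - (1 - μ)).re
  rw [← zero_mul (|x| + 1)]
  refine powerGrowth_gauss_comp (φ' := fun _ => -1 / 2) (one_sub_ne_neg_natCast hμ) (by positivity)
    (by linarith [le_abs_self x]) zero_le_one one_half_pos (fun t ht => ?_)
    (fun t _ => hasDerivAt_one_sub_div_two t) fun t _ => le_rfl
  rw [Real.rpow_zero, abs_one_sub_div_two ht.2]
  linarith [ht.1]

lemma isMellinSolution_cutFactor (hμ : μ.re < 1) :
    IsMellinSolution μ 0 (ν * (ν + 1)) (cutFactor ν μ)
      (fun t => (-1 / 2 : ℝ) * gaussDeriv (-ν) (ν + 1) (1 - μ) (((1 - t) / 2 : ℝ) : ℂ))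
      (fun t => (-1 / 2 : ℝ) *
        ((-1 / 2 : ℝ) * gaussDeriv2 (-ν) (ν + 1) (1 - μ) (((1 - t) / 2 : ℝ) : ℂ))) := by
  have hlt : ∀ t ∈ Ioo (0 : ℝ) 1, |(1 - t) / 2| < 1 := fun t ht => by
    rw [abs_one_sub_div_two ht.2.le]
    linarith [ht.1]
  refine ⟨fun t ht => ?_, fun t ht => ?_⟩
  · exact (hasDerivAt_gaussDeriv_comp (-ν) (ν + 1) (one_sub_ne_neg_natCast hμ)
      (hasDerivAt_one_sub_div_two t) (hlt t ht)).const_mul _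
  · have ode := gauss_ode (-ν) (ν + 1) (one_sub_ne_neg_natCast hμ) (x := (((1 - t) / 2 : ℝ) : ℂ))
      (by rw [Complex.norm_real]; exact hlt t ht)
    rw [cutFactor]
    push_cast at ode ⊢
    linear_combination (t : ℂ) ^ 2 * ode

lemma hasMoment_cutFactor {w : ℂ} (hμ : μ.re < 1) (hw : -1 < w.re) :
    HasMoment (fun t => ((1 - t : ℝ) : ℂ) ^ (-μ) * cutFactor ν μ t) w
      (2 ^ (μ - 1) * Complex.Gamma (1 - μ) *
        (Complex.Gamma ((w + 1) / 2) * Complex.Gamma ((w + 2) / 2)) *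
        ((Complex.Gamma ((w + 2 - ν - μ) / 2))⁻¹ * (Complex.Gamma ((w + 3 + ν - μ) / 2))⁻¹)) := by
  have h := (isMellinSolution_cutFactor ν hμ).hasMoment (powerGrowth_cutFactor ν hμ) hμ
    (by linarith) (p := (w + 1) / 2) (q := (w + 2) / 2) (r := (w + 2 - ν - μ) / 2)
    (s := (w + 3 + ν - μ) / 2) (by simpa using by linarith) (by simpa using by linarith)
    (by ring) (by ring) (by ring) (by ring)
  rwa [cutFactor_one, mul_one] at h

end CutFactor

/-- The base of the power in `outerFactor`. -/
noncomputable def outerBase (t : ℝ) : ℝ := (1 + t) / (2 * t)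

/-- The argument of the hypergeometric function in `outerFactor`. -/
noncomputable def outerArg (t : ℝ) : ℝ := (1 - t) / (1 + t)

/-- The regular factor of the kernel of `B_{0+}^{ν,μ}`, up to `1 / Γ(1 - μ)`. A Pfaff transformation
has moved the argument of the hypergeometric function into `[0, 1)`. -/
noncomputable def outerFactor (ν μ : ℂ) (t : ℝ) : ℂ :=
  (outerBase t : ℂ) ^ ν * ₂F₁ (-ν) (-μ - ν) (1 - μ) (outerArg t : ℂ)

/-- The derivative of `outerFactor`. -/
noncomputable def outerFactorDeriv (ν μ : ℂ) (t : ℝ) : ℂ :=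
  (outerBase t : ℂ) ^ ν * (-ν / (t * (1 + t))) * ₂F₁ (-ν) (-μ - ν) (1 - μ) (outerArg t : ℂ) +
    (outerBase t : ℂ) ^ ν *
      ((-2 / (1 + t) ^ 2 : ℝ) * gaussDeriv (-ν) (-μ - ν) (1 - μ) (outerArg t : ℂ))

/-- The second derivative of `outerFactor`. -/
noncomputable def outerFactorDeriv2 (ν μ : ℂ) (t : ℝ) : ℂ :=
  (outerBase t : ℂ) ^ ν *
    ((ν ^ 2 + ν * (1 + 2 * t)) / (t * (1 + t)) ^ 2 *
        ₂F₁ (-ν) (-μ - ν) (1 - μ) (outerArg t : ℂ) +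
      (4 * ν / (t * (1 + t) ^ 3) + 4 / (1 + t) ^ 3) *
        gaussDeriv (-ν) (-μ - ν) (1 - μ) (outerArg t : ℂ) +
      4 / (1 + t) ^ 4 * gaussDeriv2 (-ν) (-μ - ν) (1 - μ) (outerArg t : ℂ))

lemma outerFactor_one (ν μ : ℂ) : outerFactor ν μ 1 = 1 := by
  rw [outerFactor, outerBase, outerArg, show ((1 + 1) / (2 * 1) : ℝ) = 1 by norm_num]
  simp

lemma hasDerivAt_outerBase {t : ℝ} (ht : 0 < t) :
    HasDerivAt outerBase (-1 / (2 * t ^ 2)) t := by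
  refine (((hasDerivAt_id t).const_add 1).div ((hasDerivAt_id t).const_mul 2)
    (by simp [ht.ne'])).congr_deriv ?_
  simp only [id]
  field_simp
  ring

lemma hasDerivAt_outerBase_cpow {t : ℝ} (ht : 0 < t) (ν : ℂ) :
    HasDerivAt (fun t : ℝ => (outerBase t : ℂ) ^ ν)
      ((outerBase t : ℂ) ^ ν * (-ν / (t * (1 + t)))) t := by
  have hpos : 0 < outerBase t := by rw [outerBase]; positivity
  refine ((hasDerivAt_ofReal_cpow hpos ν).scomp t (hasDerivAt_outerBase ht)).congr_deriv ?_
  have hne : (outerBase t : ℂ) ≠ 0 := by exact_mod_cast hpos.ne'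
  have t0 : (t : ℂ) ≠ 0 := by exact_mod_cast ht.ne'
  have t1 : (1 + t : ℂ) ≠ 0 := by exact_mod_cast (by linarith : (1 + t : ℝ) ≠ 0)
  rw [Complex.cpow_sub _ _ hne, Complex.cpow_one, Complex.real_smul]
  generalize (outerBase t : ℂ) ^ ν = X
  rw [outerBase]
  push_cast
  field_simp

lemma hasDerivAt_outerArg {t : ℝ} (ht : 0 < t) :
    HasDerivAt outerArg (-2 / (1 + t) ^ 2) t := by
  refine (((hasDerivAt_id t).const_sub 1).div ((hasDerivAt_id t).const_add 1)
    (by simp only [id]; linarith)).congr_deriv ?_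
  simp only [id]
  ring

lemma le_one_sub_abs_outerArg {t : ℝ} (ht : t ∈ Ioc (0 : ℝ) 1) : t ≤ 1 - |outerArg t| := by
  have h1 : 0 < 1 + t := by linarith [ht.1]
  rw [outerArg, abs_of_nonneg (div_nonneg (by linarith [ht.2]) h1.le), le_sub_comm, div_le_iff₀ h1]
  nlinarith [ht.1, ht.2]

lemma norm_outerBase_cpow_le {t : ℝ} (ht : t ∈ Ioc (0 : ℝ) 1) (ν : ℂ) :
    ‖(outerBase t : ℂ) ^ ν‖ ≤ 2 ^ |ν.re| * t ^ (-ν.re) := by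
  have t0 := ht.1
  have hv : 0 < (1 + t) / 2 := by linarith
  rw [norm_ofReal_cpow (by rw [outerBase]; positivity),
    show outerBase t = (1 + t) / 2 * t⁻¹ by rw [outerBase]; field_simp,
    Real.mul_rpow hv.le (by positivity), Real.inv_rpow t0.le, ← Real.rpow_neg t0.le]
  refine mul_le_mul_of_nonneg_right ?_ (by positivity)
  calc ((1 + t) / 2) ^ ν.re ≤ ((1 + t) / 2) ^ (-|ν.re|) :=
        Real.rpow_le_rpow_of_exponent_ge hv (by linarith [ht.2]) (neg_abs_le _)
    _ ≤ (1 / 2) ^ (-|ν.re|) :=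
        Real.rpow_le_rpow_of_nonpos (by norm_num) (by linarith) (by linarith [abs_nonneg ν.re])
    _ = 2 ^ |ν.re| := by
        rw [one_div, Real.inv_rpow (by norm_num), Real.rpow_neg (by norm_num), inv_inv]

lemma powerGrowth_outerBase_cpow (ν : ℂ) :
    PowerGrowth ν.re (fun t => (outerBase t : ℂ) ^ ν)
      (fun t => (outerBase t : ℂ) ^ ν * (-ν / (t * (1 + t)))) := by
  refine ⟨fun t ht => hasDerivAt_outerBase_cpow ht.1 ν, 2 ^ |ν.re| * (1 + ‖ν‖), by positivity,
    fun t ht => ⟨(norm_outerBase_cpow_le ht ν).trans ?_, ?_⟩⟩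
  · have := ht.1
    gcongr
    exact le_mul_of_one_le_right (by positivity) (by linarith [norm_nonneg ν])
  · have t0 := ht.1
    have log_deriv : ‖-ν / (t * (1 + t) : ℂ)‖ ≤ ‖ν‖ * t⁻¹ := by
      rw [norm_div, norm_neg, ← Complex.ofReal_one, ← Complex.ofReal_add, ← Complex.ofReal_mul,
        Complex.norm_real, Real.norm_of_nonneg (by positivity), div_eq_mul_inv]
      gcongr
      nlinarith
    calc _ ≤ 2 ^ |ν.re| * t ^ (-ν.re) * (‖ν‖ * t⁻¹) := by
          rw [norm_mul]
          gcongr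
          exact norm_outerBase_cpow_le ht ν
      _ = 2 ^ |ν.re| * ‖ν‖ * t ^ (-ν.re - 1) := by rw [Real.rpow_sub_one t0.ne']; ring
      _ ≤ _ := by gcongr; linarith

section OuterFactor

variable (ν : ℂ) {μ : ℂ}

lemma powerGrowth_outerFactor (hμ : μ.re < 1) {s : ℝ} (hs : 0 < s) (hs' : -1 - 2 * ν.re ≤ s) :
    PowerGrowth (ν.re + s) (outerFactor ν μ) (outerFactorDeriv ν μ) := by
  refine (powerGrowth_outerBase_cpow ν).mul ?_
  rw [← one_mul s]
  refine powerGrowth_gauss_comp (φ' := fun t => -2 / (1 + t) ^ 2) (D := 2)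
    (one_sub_ne_neg_natCast hμ) hs (by simpa using by linarith) le_rfl one_pos
    (fun t ht => by simpa using le_one_sub_abs_outerArg ht) (fun t ht => hasDerivAt_outerArg ht.1)
    fun t ht => ?_
  have := ht.1
  rw [abs_div, abs_neg, abs_two, abs_of_pos (by positivity), div_le_iff₀ (by positivity)]
  nlinarith

lemma hasDerivAt_outerFactorDeriv (hμ : μ.re < 1) {t : ℝ} (ht : t ∈ Ioo (0 : ℝ) 1) :
    HasDerivAt (outerFactorDeriv ν μ) (outerFactorDeriv2 ν μ t) t := by
  have t0 : (t : ℂ) ≠ 0 := by exact_mod_cast ht.1.ne'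
  have t1 : (1 + t : ℂ) ≠ 0 := by exact_mod_cast (by linarith [ht.1] : (1 + t : ℝ) ≠ 0)
  have hlt : |outerArg t| < 1 := by linarith [le_one_sub_abs_outerArg ⟨ht.1, ht.2.le⟩, ht.1]
  have dt : HasDerivAt (fun t : ℝ => (t : ℂ)) 1 t := by simpa using (hasDerivAt_id t).ofReal_comp
  have log_deriv := (hasDerivAt_const t (-ν)).div (dt.mul (dt.const_add 1)) (mul_ne_zero t0 t1)
  have arg_deriv : HasDerivAt (fun t : ℝ => -2 / (1 + t) ^ 2) (4 / (1 + t) ^ 3) t := by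
    have h1 : 1 + t ≠ 0 := by linarith [ht.1]
    refine ((hasDerivAt_const t (-2 : ℝ)).div (((hasDerivAt_id t).const_add 1).pow 2)
      (pow_ne_zero 2 h1)).congr_deriv ?_
    simp only [id, Pi.pow_apply]
    field_simp
    ring
  have hc := one_sub_ne_neg_natCast hμ
  have base := hasDerivAt_outerBase_cpow ht.1 ν
  refine (((base.mul log_deriv).mul (hasDerivAt_gauss_comp (-ν) (-μ - ν) hc
    (hasDerivAt_outerArg ht.1) hlt)).add (base.mul (arg_deriv.ofReal_comp.mul
      (hasDerivAt_gaussDeriv_comp (-ν) (-μ - ν) hc (hasDerivAt_outerArg ht.1) hlt)))).congr_deriv ?_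
  simp only [outerFactorDeriv2, Pi.mul_apply, Pi.div_apply]
  push_cast
  field_simp
  ring

lemma isMellinSolution_outerFactor (hμ : μ.re < 1) :
    IsMellinSolution μ (ν * (ν + 1)) 0 (outerFactor ν μ) (outerFactorDeriv ν μ)
      (outerFactorDeriv2 ν μ) := by
  refine ⟨fun t ht => hasDerivAt_outerFactorDeriv ν hμ ht, fun t ht => ?_⟩
  have ode := gauss_ode (-ν) (-μ - ν) (one_sub_ne_neg_natCast hμ) (x := (outerArg t : ℂ))
    (by rw [Complex.norm_real, Real.norm_eq_abs]
        linarith [le_one_sub_abs_outerArg ⟨ht.1, ht.2.le⟩, ht.1])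
  have t0 : (t : ℂ) ≠ 0 := by exact_mod_cast ht.1.ne'
  have t1 : (1 + t : ℂ) ≠ 0 := by exact_mod_cast (by linarith [ht.1] : (1 + t : ℝ) ≠ 0)
  have arg : (outerArg t : ℂ) = (1 - t) / (1 + t) := by rw [outerArg]; push_cast; rfl
  rw [outerFactor, outerFactorDeriv, outerFactorDeriv2]
  generalize ₂F₁ (-ν) (-μ - ν) (1 - μ) (outerArg t : ℂ) = F0 at ode ⊢
  generalize gaussDeriv (-ν) (-μ - ν) (1 - μ) (outerArg t : ℂ) = F1 at ode ⊢
  generalize gaussDeriv2 (-ν) (-μ - ν) (1 - μ) (outerArg t : ℂ) = F2 at ode ⊢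
  generalize (outerBase t : ℂ) ^ ν = X
  rw [arg, ← sub_eq_zero] at ode
  rw [← sub_eq_zero]
  refine Eq.trans ?_ (mul_eq_zero_of_right (X * (2 * t / (1 + t))) ode)
  push_cast
  field_simp
  ring

lemma hasMoment_outerFactor {w : ℂ} (hμ : μ.re < 1) (hw : ν.re - 1 < w.re)
    (hw' : -ν.re - 2 < w.re) :
    HasMoment (fun t => ((1 - t : ℝ) : ℂ) ^ (-μ) * outerFactor ν μ t) w
      (2 ^ (μ - 1) * Complex.Gamma (1 - μ) *
        (Complex.Gamma ((w + ν + 2) / 2) * Complex.Gamma ((w + 1 - ν) / 2)) *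
        ((Complex.Gamma ((w + 2 - μ) / 2))⁻¹ * (Complex.Gamma ((w + 3 - μ) / 2))⁻¹)) := by
  obtain ⟨s, hs, hsw⟩ := exists_between
    (show max 0 (-1 - 2 * ν.re) < w.re + 1 - ν.re from max_lt (by linarith) (by linarith))
  obtain ⟨hs0, hs1⟩ := max_lt_iff.1 hs
  have h := (isMellinSolution_outerFactor ν hμ).hasMoment (powerGrowth_outerFactor ν hμ hs0 hs1.le)
    hμ (by linarith) (p := (w + ν + 2) / 2) (q := (w + 1 - ν) / 2) (r := (w + 2 - μ) / 2)
    (s := (w + 3 - μ) / 2) (by simpa using by linarith) (by simpa using by linarith)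
    (by ring) (by ring) (by ring) (by ring)
  rwa [outerFactor_one, mul_one] at h

end OuterFactor

/-! ### Homogeneous kernels -/

section CpowOfPos

variable {x y : ℝ}

lemma mul_cpow_of_pos (hx : 0 < x) (hy : 0 < y) (s : ℂ) :
    ((x * y : ℝ) : ℂ) ^ s = (x : ℂ) ^ s * (y : ℂ) ^ s := by
  rw [Complex.ofReal_mul, Complex.mul_cpow_ofReal_nonneg hx.le hy.le]

lemma inv_cpow_of_pos (hx : 0 < x) (s : ℂ) : ((x⁻¹ : ℝ) : ℂ) ^ s = (x : ℂ) ^ (-s) := by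
  rw [Complex.ofReal_inv, Complex.inv_cpow, Complex.cpow_neg]
  rw [Complex.arg_ofReal_of_nonneg hx.le]
  exact Real.pi_ne_zero.symm

lemma div_cpow_of_pos (hx : 0 < x) (hy : 0 < y) (s : ℂ) :
    ((x / y : ℝ) : ℂ) ^ s = (x : ℂ) ^ s * (y : ℂ) ^ (-s) := by
  rw [div_eq_mul_inv, mul_cpow_of_pos hx (inv_pos.2 hy), inv_cpow_of_pos hy]

lemma cpow_add_of_pos (hx : 0 < x) (s r : ℂ) : (x : ℂ) ^ (s + r) = (x : ℂ) ^ s * (x : ℂ) ^ r :=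
  Complex.cpow_add _ _ (Complex.ofReal_ne_zero.2 hx.ne')

lemma sq_cpow_of_pos (hx : 0 < x) (s : ℂ) : ((x ^ 2 : ℝ) : ℂ) ^ s = (x : ℂ) ^ (2 * s) := by
  rw [sq, mul_cpow_of_pos hx hx, ← cpow_add_of_pos hx, two_mul]

end CpowOfPos

/-- `K(x, t) = x^κ k(t / x)` for `0 < t < x`: a kernel on `0 < t < x` that is homogeneous of
degree `κ`, together with its profile `k` on `(0, 1)`. -/
def IsLeftHomogeneous (K : ℝ → ℝ → ℂ) (κ : ℂ) (k : ℝ → ℂ) : Prop :=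
  ∀ x t : ℝ, 0 < t → t < x → K x t = (x : ℂ) ^ κ * k (t / x)

/-- `K(x, t) = x^κ k(x / t)` for `0 < x < t`, the analogue of `IsLeftHomogeneous` for kernels on
`0 < x < t`. -/
def IsRightHomogeneous (K : ℝ → ℝ → ℂ) (κ : ℂ) (k : ℝ → ℂ) : Prop :=
  ∀ x t : ℝ, 0 < x → x < t → K x t = (x : ℂ) ^ κ * k (x / t)

lemma IsLeftHomogeneous.swap {K : ℝ → ℝ → ℂ} {κ : ℂ} {k : ℝ → ℂ} (h : IsLeftHomogeneous K κ k) :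
    IsRightHomogeneous (fun x t => K t x) κ (fun s => k s * (s : ℂ) ^ (-κ)) := by
  intro x t hx hxt
  have ht := hx.trans hxt
  have hxκ : (x : ℂ) ^ κ * (x : ℂ) ^ (-κ) = 1 := by
    rw [← cpow_add_of_pos hx, add_neg_cancel, Complex.cpow_zero]
  simp only [h t x hx hxt, div_cpow_of_pos hx ht, neg_neg]
  linear_combination -((t : ℂ) ^ κ * k (x / t)) * hxκ

lemma HasMoment.swap {k : ℝ → ℂ} {κ w m : ℂ} (h : HasMoment k (-w - 2 - κ) m) :
    HasMoment (fun s : ℝ => k s * (s : ℂ) ^ (-κ)) (-w - 2) m :=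
  HasMoment.mul_cpow (-κ) (by rwa [← sub_eq_add_neg])

lemma integral_image_of_eqOn {S T : Set ℝ} {φ φ' : ℝ → ℝ} {F G : ℝ → ℂ} (hS : MeasurableSet S)
    (hφ : ∀ s ∈ S, HasDerivWithinAt φ (φ' s) S s) (hinj : InjOn φ S) (himage : φ '' S = T)
    (h : EqOn (fun s => |φ' s| • F (φ s)) G S) :
    (IntegrableOn F T ↔ IntegrableOn G S) ∧ ∫ t in T, F t = ∫ s in S, G s := by
  subst himage
  exact ⟨(integrableOn_image_iff_integrableOn_abs_deriv_smul hS hφ hinj F).trans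
      (integrableOn_congr_fun h hS),
    (integral_image_eq_integral_abs_deriv_smul hS hφ hinj F).trans (setIntegral_congr_fun hS h)⟩

lemma image_sq_Ioo : (fun s : ℝ => s ^ 2) '' Ioo 0 1 = Ioo 0 1 := by
  ext v
  constructor
  · rintro ⟨s, hs, rfl⟩
    exact ⟨pow_pos hs.1 2, pow_lt_one₀ hs.1.le hs.2 two_ne_zero⟩
  · intro hv
    refine ⟨√v, ⟨Real.sqrt_pos.2 hv.1, ?_⟩, Real.sq_sqrt hv.1.le⟩
    rw [Real.sqrt_lt' one_pos]
    simpa using hv.2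

lemma HasMoment.comp_sq {k : ℝ → ℂ} {w m : ℂ} (h : HasMoment k ((w - 1) / 2) m) :
    HasMoment (fun s => 2 * k (s ^ 2)) w m := by
  have heq : EqOn (fun s : ℝ => |2 * s| • (k (s ^ 2) * ((s ^ 2 : ℝ) : ℂ) ^ ((w - 1) / 2)))
      (fun s : ℝ => 2 * k (s ^ 2) * (s : ℂ) ^ w) (Ioo 0 1) := by
    intro s hs
    have hw : (s : ℂ) ^ w = (s : ℂ) ^ (w - 1) * s := by
      simpa using cpow_add_of_pos hs.1 (w - 1) 1
    simp only
    rw [abs_of_pos (mul_pos two_pos hs.1), sq_cpow_of_pos hs.1, Complex.real_smul,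
      mul_div_cancel₀ _ two_ne_zero, hw]
    push_cast
    ring
  obtain ⟨hint, hval⟩ := integral_image_of_eqOn measurableSet_Ioo
    (fun s _ => by simpa using (hasDerivAt_pow 2 s).hasDerivWithinAt)
    (fun a ha b hb hab => (pow_left_inj₀ ha.1.le hb.1.le two_ne_zero).1 hab) image_sq_Ioo
    (F := fun v => k v * (v : ℂ) ^ ((w - 1) / 2)) heq
  exact ⟨hint.1 h.integrable, hval.symm.trans h.integral⟩

/-! ### The kernels of the Riemann–Liouville and Erdélyi–Kober operators -/

/-- The profile on `(0, 1)` of the Riemann–Liouville kernel of order `α`. -/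
noncomputable def rlProfile (α : ℂ) (s : ℝ) : ℂ :=
  (Complex.Gamma α)⁻¹ * ((1 - s : ℝ) : ℂ) ^ (α - 1)

/-- The profile on `(0, 1)` of both Erdélyi–Kober kernels of order `α`. -/
noncomputable def ekProfile (α y : ℂ) (s : ℝ) : ℂ :=
  2 / Complex.Gamma α * (((1 - s ^ 2 : ℝ) : ℂ) ^ (α - 1) * (s : ℂ) ^ (2 * y + 1))

lemma isLeftHomogeneous_rlKerL (α : ℂ) : IsLeftHomogeneous (rlKerL α) (α - 1) (rlProfile α) := by
  intro x t ht htx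
  have hx := ht.trans htx
  have hpos : 0 < 1 - t / x := sub_pos.2 ((div_lt_one hx).2 htx)
  rw [rlKerL, rlProfile, show x - t = x * (1 - t / x) by field_simp, mul_cpow_of_pos hx hpos]
  ring

lemma hasMoment_rlProfile {α w : ℂ} (hα : 0 < α.re) (hw : -1 < w.re) :
    HasMoment (rlProfile α) w (Complex.Gamma (w + 1) * (Complex.Gamma (w + 1 + α))⁻¹) := by
  have h := (hasMoment_one_sub_cpow (p := w + 1) hα (by simpa using by linarith)).const_mul
    (Complex.Gamma α)⁻¹
  rw [add_sub_cancel_right] at h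
  have hΓ := Complex.Gamma_ne_zero_of_re_pos hα
  convert (show HasMoment (rlProfile α) w _ from h) using 1
  field_simp

lemma hasMoment_ekProfile {α y w : ℂ} (hα : 0 < α.re) (hw : 0 < (y + 1 + w / 2).re) :
    HasMoment (ekProfile α y) w
      (Complex.Gamma (y + 1 + w / 2) * (Complex.Gamma (α + y + 1 + w / 2))⁻¹) := by
  have hbeta := hasMoment_one_sub_cpow hα hw
  rw [show y + 1 + w / 2 - 1 = (w + (2 * y + 1) - 1) / 2 by ring] at hbeta
  have h := (hbeta.comp_sq.mul_cpow (2 * y + 1)).const_mul (Complex.Gamma α)⁻¹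
  have hΓ := Complex.Gamma_ne_zero_of_re_pos hα
  convert h using 1
  · funext s
    rw [ekProfile]
    ring
  · rw [show α + y + 1 + w / 2 = y + 1 + w / 2 + α by ring]
    field_simp

lemma isLeftHomogeneous_ekKerL (α y : ℂ) :
    IsLeftHomogeneous (ekKerL α y) (-1) (ekProfile α y) := by
  intro x t ht htx
  have hx := ht.trans htx
  have hpos : 0 < t / x := div_pos ht hx
  have hsq : 0 < 1 - (t / x) ^ 2 :=
    sub_pos.2 (pow_lt_one₀ hpos.le ((div_lt_one hx).2 htx) two_ne_zero)
  have ht_cpow : (t : ℂ) ^ (2 * y + 1) =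
      (x : ℂ) ^ (2 * y + 1) * ((t / x : ℝ) : ℂ) ^ (2 * y + 1) := by
    rw [← mul_cpow_of_pos hx hpos, mul_div_cancel₀ _ hx.ne']
  have hx_cpow : (x : ℂ) ^ (-1 : ℂ) =
      (x : ℂ) ^ (-2 * (α + y)) * (x : ℂ) ^ (2 * (α - 1)) * (x : ℂ) ^ (2 * y + 1) := by
    rw [← cpow_add_of_pos hx, ← cpow_add_of_pos hx]
    ring_nf
  rw [ekKerL, ekProfile, show x ^ 2 - t ^ 2 = x ^ 2 * (1 - (t / x) ^ 2) by field_simp,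
    mul_cpow_of_pos (pow_pos hx 2) hsq, sq_cpow_of_pos hx, ht_cpow, hx_cpow]
  ring

lemma isRightHomogeneous_ekKerR (α y : ℂ) :
    IsRightHomogeneous (ekKerR α y) (-1) (ekProfile α y) := by
  intro x t hx hxt
  have ht := hx.trans hxt
  have hpos : 0 < x / t := div_pos hx ht
  have hsq : 0 < 1 - (x / t) ^ 2 :=
    sub_pos.2 (pow_lt_one₀ hpos.le ((div_lt_one ht).2 hxt) two_ne_zero)
  have ht_cpow : (t : ℂ) ^ (-(2 * y + 1)) =
      (t : ℂ) ^ (2 * (α - 1)) * (t : ℂ) ^ (2 * (1 - α - y) - 1) := by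
    rw [← cpow_add_of_pos ht]
    ring_nf
  have hx_cpow : (x : ℂ) ^ (2 * y) = (x : ℂ) ^ (-1 : ℂ) * (x : ℂ) ^ (2 * y + 1) := by
    rw [← cpow_add_of_pos hx]
    ring_nf
  rw [ekKerR, ekProfile, show t ^ 2 - x ^ 2 = t ^ 2 * (1 - (x / t) ^ 2) by field_simp,
    mul_cpow_of_pos (pow_pos ht 2) hsq, sq_cpow_of_pos ht, div_cpow_of_pos hx ht, ht_cpow, hx_cpow]
  ring

/-! ### The kernels of the Buschman–Erdélyi operators -/

lemma sq_sub_sq_cpow_mul_div_cpow {x t : ℝ} (ht : 0 < t) (htx : t < x) (μ : ℂ) :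
    ((x ^ 2 - t ^ 2 : ℝ) : ℂ) ^ (-μ / 2) * (((1 + t / x) / (1 - t / x) : ℝ) : ℂ) ^ (μ / 2) =
      (x : ℂ) ^ (-μ) * ((1 - t / x : ℝ) : ℂ) ^ (-μ) := by
  have hx := ht.trans htx
  have hpos : 0 < 1 - t / x := sub_pos.2 ((div_lt_one hx).2 htx)
  have hpos' : 0 < 1 + t / x := by positivity
  have hsub : ((1 - t / x : ℝ) : ℂ) ^ (-μ) =
      ((1 - t / x : ℝ) : ℂ) ^ (-μ / 2) * ((1 - t / x : ℝ) : ℂ) ^ (-(μ / 2)) := by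
    rw [← cpow_add_of_pos hpos]
    ring_nf
  have hadd : ((1 + t / x : ℝ) : ℂ) ^ (-μ / 2) * ((1 + t / x : ℝ) : ℂ) ^ (μ / 2) = 1 := by
    rw [← cpow_add_of_pos hpos', neg_div, neg_add_cancel, Complex.cpow_zero]
  rw [show x ^ 2 - t ^ 2 = x ^ 2 * ((1 - t / x) * (1 + t / x)) by field_simp; ring,
    mul_cpow_of_pos (pow_pos hx 2) (mul_pos hpos hpos'), sq_cpow_of_pos hx,
    mul_cpow_of_pos hpos hpos', div_cpow_of_pos hpos' hpos, mul_div_cancel₀ _ two_ne_zero, hsub]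
  linear_combination ((x : ℂ) ^ (-μ) * ((1 - t / x : ℝ) : ℂ) ^ (-μ / 2) *
    ((1 - t / x : ℝ) : ℂ) ^ (-(μ / 2))) * hadd

/-- The profile on `(0, 1)` of the kernel of `E_{0+}^{ν,μ}`. -/
noncomputable def kerEProfile (ν μ : ℂ) (s : ℝ) : ℂ :=
  (Complex.Gamma (1 - μ))⁻¹ * (((1 - s : ℝ) : ℂ) ^ (-μ) * cutFactor ν μ s)

/-- The profile on `(0, 1)` of the kernel of `B_{0+}^{ν,μ}`. -/
noncomputable def kerBProfile (ν μ : ℂ) (s : ℝ) : ℂ :=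
  (Complex.Gamma (1 - μ))⁻¹ * (((1 - s : ℝ) : ℂ) ^ (-μ) * outerFactor ν μ s)

lemma isLeftHomogeneous_kerEL (ν μ : ℂ) :
    IsLeftHomogeneous (kerEL ν μ) (-μ) (kerEProfile ν μ) := by
  intro x t ht htx
  have hlt : t / x < 1 := (div_lt_one (ht.trans htx)).2 htx
  rw [kerEL, legendreCut, gaussF, if_neg (by linarith), kerEProfile, cutFactor]
  linear_combination ((Complex.Gamma (1 - μ))⁻¹ *
    ₂F₁ (-ν) (ν + 1) (1 - μ) (((1 - t / x) / 2 : ℝ) : ℂ)) * sq_sub_sq_cpow_mul_div_cpow ht htx μ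

lemma legendreP_inv_eq (ν μ : ℂ) {s : ℝ} (hs : s ∈ Ioo (0 : ℝ) 1) :
    legendreP ν μ s⁻¹ = (Complex.Gamma (1 - μ))⁻¹ * (((1 + s) / (1 - s) : ℝ) : ℂ) ^ (μ / 2) *
      outerFactor ν μ s := by
  have hs0 := hs.1.ne'
  have hone_sub : 1 - s ≠ 0 := by linarith [hs.2]
  have hone_add : 1 + s ≠ 0 := by linarith [hs.1]
  have hinv : 1 < s⁻¹ := one_lt_inv_iff₀.2 hs
  have hratio : (s⁻¹ + 1) / (s⁻¹ - 1) = (1 + s) / (1 - s) := by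
    rw [div_eq_div_iff (by linarith) hone_sub]
    field_simp
  have hbase : 1 - (1 - s⁻¹) / 2 = outerBase s := by
    rw [outerBase]
    field_simp
    ring
  have harg : (1 - s⁻¹) / 2 / ((1 - s⁻¹) / 2 - 1) = outerArg s := by
    rw [outerArg, div_eq_div_iff (by linarith) hone_add]
    field_simp
    ring
  rw [legendreP, gaussF, if_pos (by linarith), hratio, hbase, harg, outerFactor, neg_neg,
    show 1 - μ - (ν + 1) = -μ - ν by ring]

lemma isLeftHomogeneous_kerBL (ν μ : ℂ) :
    IsLeftHomogeneous (kerBL ν μ) (-μ) (kerBProfile ν μ) := by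
  intro x t ht htx
  have hx := ht.trans htx
  rw [kerBL, ← inv_div t x, legendreP_inv_eq ν μ ⟨div_pos ht hx, (div_lt_one hx).2 htx⟩,
    kerBProfile]
  linear_combination ((Complex.Gamma (1 - μ))⁻¹ * outerFactor ν μ (t / x)) *
    sq_sub_sq_cpow_mul_div_cpow ht htx μ

/-- The Mellin symbol of `B_{0+}^{ν,μ}`: this operator sends `x^w` to `symB ν μ w * x^(w+1-μ)`. -/
noncomputable def symB (ν μ w : ℂ) : ℂ :=
  2 ^ w * (Complex.Gamma ((w + ν + 2) / 2) * Complex.Gamma ((w + 1 - ν) / 2)) *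
    ((√Real.pi : ℂ)⁻¹ * (Complex.Gamma (w + 2 - μ))⁻¹)

/-- The Mellin symbol of `E_{0+}^{ν,μ}`: this operator sends `x^w` to `symE ν μ w * x^(w+1-μ)`. -/
noncomputable def symE (ν μ w : ℂ) : ℂ :=
  2 ^ (μ - 1 - w) * √Real.pi * Complex.Gamma (w + 1) *
    ((Complex.Gamma ((w + 2 - ν - μ) / 2))⁻¹ * (Complex.Gamma ((w + 3 + ν - μ) / 2))⁻¹)

lemma hasMoment_kerBProfile (ν : ℂ) {μ w : ℂ} (hμ : μ.re < 1) (hw : ν.re - 1 < w.re)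
    (hw' : -ν.re - 2 < w.re) : HasMoment (kerBProfile ν μ) w (symB ν μ w) := by
  have h := (hasMoment_outerFactor ν hμ hw hw').const_mul (Complex.Gamma (1 - μ))⁻¹
  have hΓ := Complex.Gamma_ne_zero_of_re_pos (s := 1 - μ) (by simpa using hμ)
  have hdup := Complex.Gamma_mul_Gamma_add_half ((w + 2 - μ) / 2)
  rw [show (w + 2 - μ) / 2 + 1 / 2 = (w + 3 - μ) / 2 by ring,
    show 2 * ((w + 2 - μ) / 2) = w + 2 - μ by ring] at hdup
  convert (show HasMoment (kerBProfile ν μ) w _ from h) using 1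
  rw [symB, ← mul_inv (Complex.Gamma ((w + 2 - μ) / 2)), hdup,
    show 1 - (w + 2 - μ) = -(w + (1 - μ)) by ring, Complex.cpow_neg,
    show μ - 1 = -(1 - μ) by ring, Complex.cpow_neg, Complex.cpow_add _ _ two_ne_zero]
  have htwo : (2 : ℂ) ^ (1 - μ) ≠ 0 := by simp [Complex.cpow_eq_zero_iff]
  field_simp

lemma hasMoment_kerEProfile (ν : ℂ) {μ w : ℂ} (hμ : μ.re < 1) (hw : -1 < w.re) :
    HasMoment (kerEProfile ν μ) w (symE ν μ w) := by
  have h := (hasMoment_cutFactor ν hμ hw).const_mul (Complex.Gamma (1 - μ))⁻¹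
  have hΓ := Complex.Gamma_ne_zero_of_re_pos (s := 1 - μ) (by simpa using hμ)
  have hdup := Complex.Gamma_mul_Gamma_add_half ((w + 1) / 2)
  rw [show (w + 1) / 2 + 1 / 2 = (w + 2) / 2 by ring,
    show 2 * ((w + 1) / 2) = w + 1 by ring] at hdup
  convert (show HasMoment (kerEProfile ν μ) w _ from h) using 1
  rw [symE, hdup, show μ - 1 - w = (μ - 1) + (1 - (w + 1)) by ring,
    Complex.cpow_add _ _ two_ne_zero]
  field_simp

/-! ### Superpositions of powers along a vertical line -/

/-- The point `γ + 2πiξ` of the vertical line through `γ`. -/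
noncomputable def line (γ ξ : ℝ) : ℂ := γ + (2 * Real.pi * ξ : ℝ) * Complex.I

@[simp] lemma line_re (γ ξ : ℝ) : (line γ ξ).re = γ := by simp [line]

lemma continuous_line (γ : ℝ) : Continuous (line γ) := by unfold line; fun_prop

lemma norm_line_add_le (γ ξ : ℝ) (s : ℂ) :
    ‖line γ ξ + s‖ ≤ (|γ| + ‖s‖ + 2 * Real.pi) * (1 + |ξ|) := by
  have h : ‖line γ ξ + s‖ ≤ |γ| + 2 * Real.pi * |ξ| + ‖s‖ := by
    refine (norm_add_le _ _).trans (add_le_add ((norm_add_le _ _).trans (le_of_eq ?_)) le_rfl)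
    rw [norm_mul, Complex.norm_real, Complex.norm_real, Complex.norm_I, Real.norm_eq_abs,
      Real.norm_eq_abs, abs_mul, abs_of_pos Real.two_pi_pos, mul_one]
  nlinarith [abs_nonneg γ, abs_nonneg ξ, norm_nonneg s, Real.pi_pos]

/-- `φ` is integrable against every polynomial. This decay makes superpositions of powers with
density `φ` smooth, with derivatives computed under the integral sign. -/
def Rapid (φ : ℝ → ℂ) : Prop :=
  ∀ n : ℕ, Integrable fun ξ : ℝ => ((1 + |ξ| : ℝ) : ℂ) ^ n * φ ξ

section Superpositions

variable {φ : ℝ → ℂ}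

lemma Rapid.integrable (h : Rapid φ) : Integrable φ := by simpa using h 0

lemma norm_one_add_abs (ξ : ℝ) : ‖((1 + |ξ| : ℝ) : ℂ)‖ = 1 + |ξ| := by
  rw [Complex.norm_real, Real.norm_of_nonneg (by positivity)]

lemma Rapid.line_mul (h : Rapid φ) (γ : ℝ) (s : ℂ) :
    Rapid fun ξ => (line γ ξ + s) * φ ξ := by
  intro n
  refine Integrable.mono' ((h (n + 1)).norm.const_mul (|γ| + ‖s‖ + 2 * Real.pi)) ?_
    (Eventually.of_forall fun ξ => ?_)
  · refine Continuous.aestronglyMeasurable (by fun_prop) |>.mul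
      (((continuous_line γ).add continuous_const).aestronglyMeasurable.mul
        h.integrable.aestronglyMeasurable)
  · rw [norm_mul, norm_mul, norm_mul, norm_pow, norm_pow, norm_one_add_abs]
    calc _ ≤ (1 + |ξ|) ^ n * (((|γ| + ‖s‖ + 2 * Real.pi) * (1 + |ξ|)) * ‖φ ξ‖) := by
          gcongr; exact norm_line_add_le γ ξ s
      _ = _ := by ring

lemma Rapid.const_mul (h : Rapid φ) (c : ℂ) : Rapid fun ξ => c * φ ξ := fun n =>
  ((h n).const_mul c).congr (Eventually.of_forall fun ξ => by ring)

lemma Rapid.comp_neg (h : Rapid φ) : Rapid fun ξ => φ (-ξ) := fun n => by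
  simpa only [abs_neg] using (h n).comp_neg

/-- `∫ φ(ξ) x^(γ + 2πiξ + s) dξ`, a superposition of powers along a vertical line. -/
noncomputable def superpos (φ : ℝ → ℂ) (γ : ℝ) (s : ℂ) (x : ℝ) : ℂ :=
  ∫ ξ : ℝ, φ ξ * (x : ℂ) ^ (line γ ξ + s)

lemma continuous_cpow_line {x : ℝ} (hx : 0 < x) (γ : ℝ) (s : ℂ) :
    Continuous fun ξ : ℝ => (x : ℂ) ^ (line γ ξ + s) := by
  have hx0 : (x : ℂ) ≠ 0 := by exact_mod_cast hx.ne'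
  have := (continuous_line γ).add (continuous_const (y := s))
  exact this.const_cpow (Or.inl hx0)

lemma norm_cpow_line {x : ℝ} (hx : 0 < x) (γ ξ : ℝ) (s : ℂ) :
    ‖(x : ℂ) ^ (line γ ξ + s)‖ = x ^ (γ + s.re) := by
  rw [norm_ofReal_cpow hx]; simp

lemma Rapid.integrable_superpos (h : Rapid φ) (γ : ℝ) (s : ℂ) {x : ℝ} (hx : 0 < x) :
    Integrable fun ξ : ℝ => φ ξ * (x : ℂ) ^ (line γ ξ + s) := by
  refine h.integrable.mul_bdd (c := x ^ (γ + s.re))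
    (continuous_cpow_line hx γ s).aestronglyMeasurable (Eventually.of_forall fun ξ => ?_)
  rw [norm_cpow_line hx]

lemma rpow_le_rpow_add_rpow {a b y : ℝ} (ha : 0 < a) (hay : a ≤ y) (hyb : y ≤ b) (r : ℝ) :
    y ^ r ≤ a ^ r + b ^ r := by
  have hy := ha.trans_le hay
  rcases le_total 0 r with hr | hr
  · exact (Real.rpow_le_rpow hy.le hyb hr).trans (le_add_of_nonneg_left (Real.rpow_nonneg ha.le r))
  · exact (Real.rpow_le_rpow_of_nonpos ha hay hr).trans
      (le_add_of_nonneg_right (Real.rpow_nonneg (hy.le.trans hyb) r))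

lemma Rapid.hasDerivAt_superpos (h : Rapid φ) (γ : ℝ) (s : ℂ) {x : ℝ} (hx : 0 < x) :
    HasDerivAt (superpos φ γ s)
      (superpos (fun ξ => (line γ ξ + s) * φ ξ) γ (s - 1) x) x := by
  have hball : ∀ y ∈ Metric.ball x (x / 2), x / 2 < y ∧ y < 3 * x / 2 := by
    intro y hy
    rw [Metric.mem_ball, Real.dist_eq, abs_lt] at hy
    constructor <;> linarith [hy.1, hy.2]
  have hball_pos : ∀ y ∈ Metric.ball x (x / 2), 0 < y := fun y hy =>
    (half_pos hx).trans (hball y hy).1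
  refine (hasDerivAt_integral_of_dominated_loc_of_deriv_le (𝕜 := ℝ) (μ := volume)
    (F := fun y ξ => φ ξ * (y : ℂ) ^ (line γ ξ + s))
    (F' := fun y ξ => (line γ ξ + s) * φ ξ * (y : ℂ) ^ (line γ ξ + (s - 1)))
    (s := Metric.ball x (x / 2))
    (bound := fun ξ => ‖(line γ ξ + s) * φ ξ‖ *
      ((x / 2) ^ (γ + (s - 1).re) + (3 * x / 2) ^ (γ + (s - 1).re)))
    (Metric.ball_mem_nhds x (half_pos hx)) ?_ (h.integrable_superpos γ s hx)
    ((h.line_mul γ s).integrable_superpos γ (s - 1) hx).aestronglyMeasurable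
    (Eventually.of_forall fun ξ y hy => ?_) ((h.line_mul γ s).integrable.norm.mul_const _)
    (Eventually.of_forall fun ξ y hy => ?_)).2
  · filter_upwards [eventually_gt_nhds hx] with y hy
    exact (h.integrable_superpos γ s hy).aestronglyMeasurable
  · rw [norm_mul, norm_cpow_line (hball_pos y hy)]
    gcongr
    exact rpow_le_rpow_add_rpow (half_pos hx) (hball y hy).1.le (hball y hy).2.le _
  · refine ((hasDerivAt_ofReal_cpow (hball_pos y hy) (line γ ξ + s)).const_mul (φ ξ)).congr_deriv ?_
    rw [add_sub_assoc]
    ring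

end Superpositions

section Fubini

variable {φ : ℝ → ℂ} {D : Set ℝ} {g : ℝ → ℂ}

lemma integrable_prod_cpow (hφ : Integrable φ) (hD : MeasurableSet D)
    (hD0 : D ⊆ Ioi 0) (γ : ℝ) (s : ℂ)
    (hg : IntegrableOn (fun t : ℝ => g t * (t : ℂ) ^ (line γ 0 + s)) D) :
    Integrable (fun p : ℝ × ℝ => φ p.1 * (g p.2 * (p.2 : ℂ) ^ (line γ p.1 + s)))
      (volume.prod (volume.restrict D)) := by
  have h1 := hφ.mul_prod hg
  have hm : Measurable fun p : ℝ × ℝ =>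
      (p.2 : ℂ) ^ ((2 * Real.pi * p.1 : ℝ) * Complex.I : ℂ) := by
    fun_prop
  have hae : ∀ᵐ p : ℝ × ℝ ∂(volume.prod (volume.restrict D)), p.2 ∈ D :=
    Measure.quasiMeasurePreserving_snd.ae (ae_restrict_mem hD)
  have h2 := h1.mul_bdd (c := 1) hm.aestronglyMeasurable (by
    filter_upwards [hae] with p hp
    rw [norm_ofReal_cpow (hD0 hp)]
    simp)
  refine h2.congr ?_
  filter_upwards [hae] with p hp
  have hline : line γ p.1 + s = line γ 0 + s + (2 * Real.pi * p.1 : ℝ) * Complex.I := by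
    simp only [line, mul_zero, Complex.ofReal_zero, zero_mul, add_zero]
    ring
  rw [hline, cpow_add_of_pos (hD0 hp) (line γ 0 + s)]
  ring

lemma integral_mul_superpos (hφ : Integrable φ) (hD : MeasurableSet D)
    (hD0 : D ⊆ Ioi 0) (γ : ℝ) (s : ℂ)
    (hg : IntegrableOn (fun t : ℝ => g t * (t : ℂ) ^ (line γ 0 + s)) D) :
    IntegrableOn (fun t => g t * superpos φ γ s t) D ∧
      ∫ t in D, g t * superpos φ γ s t =
        ∫ ξ, φ ξ * ∫ t in D, g t * (t : ℂ) ^ (line γ ξ + s) := by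
  have hi := integrable_prod_cpow hφ hD hD0 γ s hg
  have e : ∀ t, ∫ ξ, φ ξ * (g t * (t : ℂ) ^ (line γ ξ + s)) = g t * superpos φ γ s t := by
    intro t
    rw [superpos, ← integral_const_mul]
    exact integral_congr_ae (Eventually.of_forall fun ξ => by simp only; ring)
  constructor
  · have := hi.integral_prod_right
    simp only [e] at this
    exact this
  · have := integral_integral_swap (f := fun ξ t => φ ξ * (g t * (t : ℂ) ^ (line γ ξ + s))) hi
    simp only [e, integral_const_mul] at this
    exact this.symm

lemma Rapid.of_moment (hφ : Rapid φ) {k : ℝ → ℂ} {γ : ℝ} {s : ℂ} {m : ℂ → ℂ}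
    (hk : ∀ w : ℂ, w.re = γ → HasMoment k (w + s) (m w)) :
    Rapid fun ξ => m (line γ ξ) * φ ξ := by
  intro n
  have hi := (integrable_prod_cpow (hφ n) measurableSet_Ioo (fun t ht => ht.1) γ s
    (hk (line γ 0) (line_re _ _)).integrable).integral_prod_left
  refine hi.congr (Eventually.of_forall fun ξ => ?_)
  simp only
  rw [integral_const_mul, (hk (line γ ξ) (line_re _ _)).integral]
  ring

end Fubini

/-! ### Homogeneous kernels applied to powers -/

section IntegralCpow

variable {K : ℝ → ℝ → ℂ} {κ w m : ℂ} {k : ℝ → ℂ} {x : ℝ}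

lemma IsLeftHomogeneous.integral_cpow (hK : IsLeftHomogeneous K κ k) (h : HasMoment k w m)
    (hx : 0 < x) :
    IntegrableOn (fun t : ℝ => K x t * (t : ℂ) ^ w) (Ioo 0 x) ∧
      ∫ t in Ioo 0 x, K x t * (t : ℂ) ^ w = m * (x : ℂ) ^ (w + (κ + 1)) := by
  have heq : EqOn (fun s : ℝ => |x| • (K x (x * s) * ((x * s : ℝ) : ℂ) ^ w))
      (fun s : ℝ => (x : ℂ) ^ (w + (κ + 1)) * (k s * (s : ℂ) ^ w)) (Ioo 0 1) := by
    intro s hs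
    simp only
    rw [hK x (x * s) (mul_pos hx hs.1) (mul_lt_of_lt_one_right hx hs.2),
      mul_div_cancel_left₀ _ hx.ne', mul_cpow_of_pos hx hs.1, abs_of_pos hx, Complex.real_smul,
      cpow_add_of_pos hx, cpow_add_of_pos hx, Complex.cpow_one]
    ring
  obtain ⟨hint, hval⟩ := integral_image_of_eqOn measurableSet_Ioo
    (fun s _ => by simpa using ((hasDerivAt_id s).const_mul x).hasDerivWithinAt)
    (mul_right_injective₀ hx.ne').injOn
    (show (fun s => x * s) '' Ioo 0 1 = Ioo 0 x by simp [image_mul_left_Ioo hx])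
    (F := fun t => K x t * (t : ℂ) ^ w) heq
  refine ⟨hint.2 (h.integrable.const_mul _), ?_⟩
  rw [hval, integral_const_mul, h.integral, mul_comm]

lemma image_const_div_Ioo_zero_one (hx : 0 < x) : (fun s : ℝ => x / s) '' Ioo 0 1 = Ioi x := by
  ext t
  constructor
  · rintro ⟨s, hs, rfl⟩
    exact (lt_div_iff₀ hs.1).2 (mul_lt_of_lt_one_right hx hs.2)
  · intro ht
    have ht0 : 0 < t := hx.trans ht
    exact ⟨x / t, ⟨div_pos hx ht0, (div_lt_one ht0).2 ht⟩, div_div_cancel₀ hx.ne'⟩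

lemma IsRightHomogeneous.integral_cpow (hK : IsRightHomogeneous K κ k)
    (h : HasMoment k (-w - 2) m) (hx : 0 < x) :
    IntegrableOn (fun t : ℝ => K x t * (t : ℂ) ^ w) (Ioi x) ∧
      ∫ t in Ioi x, K x t * (t : ℂ) ^ w = m * (x : ℂ) ^ (w + (κ + 1)) := by
  have hderiv : ∀ s ∈ Ioo (0 : ℝ) 1,
      HasDerivWithinAt (fun s : ℝ => x / s) (-x / s ^ 2) (Ioo 0 1) s := fun s hs =>
    (((hasDerivAt_const s x).div (hasDerivAt_id s) hs.1.ne').congr_deriv (by simp)).hasDerivWithinAt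
  have hinj : InjOn (fun s : ℝ => x / s) (Ioo 0 1) := fun a _ b _ hab =>
    inv_injective (mul_left_cancel₀ hx.ne' (by simpa only [div_eq_mul_inv] using hab))
  have heq : EqOn (fun s : ℝ => |-x / s ^ 2| • (K x (x / s) * ((x / s : ℝ) : ℂ) ^ w))
      (fun s : ℝ => (x : ℂ) ^ (w + (κ + 1)) * (k s * (s : ℂ) ^ (-w - 2))) (Ioo 0 1) := by
    intro s hs
    have hs0 : (s : ℂ) ≠ 0 := Complex.ofReal_ne_zero.2 hs.1.ne'
    simp only
    rw [hK x (x / s) hx ((lt_div_iff₀ hs.1).2 (mul_lt_of_lt_one_right hx hs.2)),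
      div_div_cancel₀ hx.ne', div_cpow_of_pos hx hs.1, neg_div, abs_neg,
      abs_of_pos (div_pos hx (pow_pos hs.1 2)), Complex.real_smul, cpow_add_of_pos hx,
      cpow_add_of_pos hx, Complex.cpow_one, Complex.cpow_sub _ _ hs0, Complex.cpow_ofNat]
    push_cast
    ring
  obtain ⟨hint, hval⟩ := integral_image_of_eqOn measurableSet_Ioo hderiv hinj
    (image_const_div_Ioo_zero_one hx) (F := fun t => K x t * (t : ℂ) ^ w) heq
  refine ⟨hint.2 (h.integrable.const_mul _), ?_⟩
  rw [hval, integral_const_mul, h.integral, mul_comm]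

end IntegralCpow

/-! ### Functions represented by superpositions of powers -/

/-- A family of open subsets of the half-line, one for each `X > 0`, that covers the half-line. -/
structure IsExhaustion (S : ℝ → Set ℝ) : Prop where
  isOpen : ∀ X, IsOpen (S X)
  pos : ∀ X, 0 < X → ∀ x ∈ S X, 0 < x
  cover : ∀ x, 0 < x → ∃ X, 0 < X ∧ x ∈ S X

/-- On each `S X`, the function `f` is the superposition of the powers `x^(γ + 2πiξ + s)` with the
density `m(γ + 2πiξ) Φ_X(ξ)`. An operator that multiplies powers by a factor changes only the
multiplier `m` and the shift `s`, never the densities `Φ`; the density depends on `X` because a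
function of power type at `0` (or at `∞`) need not have a Mellin transform. -/
def IsSuperpos (S : ℝ → Set ℝ) (Φ : ℝ → ℝ → ℂ) (γ : ℝ) (m : ℂ → ℂ) (s : ℂ) (f : ℝ → ℂ) : Prop :=
  ∀ X, 0 < X → Rapid (fun ξ => m (line γ ξ) * Φ X ξ) ∧
    EqOn f (superpos (fun ξ => m (line γ ξ) * Φ X ξ) γ s) (S X)

section IsSuperpos

variable {S : ℝ → Set ℝ} {Φ : ℝ → ℝ → ℂ} {γ : ℝ} {m m' : ℂ → ℂ} {s s' : ℂ} {f g : ℝ → ℂ}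

lemma IsSuperpos.cast (h : IsSuperpos S Φ γ m s f) (hm : ∀ w : ℂ, w.re = γ → m w = m' w)
    (hs : s = s') : IsSuperpos S Φ γ m' s' f := by
  subst hs
  intro X hX
  have hmΦ : (fun ξ => m' (line γ ξ) * Φ X ξ) = fun ξ => m (line γ ξ) * Φ X ξ :=
    funext fun ξ => by rw [hm _ (line_re _ _)]
  rw [hmΦ]
  exact h X hX

lemma IsSuperpos.congr (hS : IsExhaustion S) (h : IsSuperpos S Φ γ m s f)
    (hgf : EqOn g f (Ioi 0)) : IsSuperpos S Φ γ m s g := fun X hX =>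
  ⟨(h X hX).1, fun x hx => (hgf (hS.pos X hX x hx)).trans ((h X hX).2 hx)⟩

lemma IsSuperpos.eqOn (hS : IsExhaustion S) (hf : IsSuperpos S Φ γ m s f)
    (hg : IsSuperpos S Φ γ m' s' g) (hm : ∀ w : ℂ, w.re = γ → m w = m' w) (hs : s = s') :
    EqOn f g (Ioi 0) := by
  intro x hx
  obtain ⟨X, hX, hxX⟩ := hS.cover x hx
  rw [((hf.cast hm hs) X hX).2 hxX, (hg X hX).2 hxX]

lemma IsSuperpos.hasDerivAt (hS : IsExhaustion S) (h : IsSuperpos S Φ γ m s f) {X : ℝ} (hX : 0 < X)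
    {x : ℝ} (hx : x ∈ S X) :
    HasDerivAt f (superpos (fun ξ => (line γ ξ + s) * (m (line γ ξ) * Φ X ξ)) γ (s - 1) x) x := by
  refine ((h X hX).1.hasDerivAt_superpos γ s (hS.pos X hX x hx)).congr_of_eventuallyEq ?_
  filter_upwards [(hS.isOpen X).mem_nhds hx] with y hy using (h X hX).2 hy

lemma IsSuperpos.deriv (hS : IsExhaustion S) (h : IsSuperpos S Φ γ m s f) :
    IsSuperpos S Φ γ (fun w => (w + s) * m w) (s - 1) (deriv f) := by
  intro X hX
  simp only [mul_assoc]
  exact ⟨(h X hX).1.line_mul γ s, fun x hx => (h.hasDerivAt hS hX hx).deriv⟩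

lemma IsSuperpos.differentiableOn (hS : IsExhaustion S) (h : IsSuperpos S Φ γ m s f) :
    DifferentiableOn ℝ f (Ioi 0) := by
  intro x hx
  obtain ⟨X, hX, hxX⟩ := hS.cover x hx
  exact (h.hasDerivAt hS hX hxX).differentiableAt.differentiableWithinAt

lemma IsSuperpos.contDiffOn (hS : IsExhaustion S) (n : ℕ) (h : IsSuperpos S Φ γ m s f) :
    ContDiffOn ℝ n f (Ioi 0) := by
  induction n generalizing m s f with
  | zero => exact contDiffOn_zero.2 (h.differentiableOn hS).continuousOn
  | succ n ih =>
    push_cast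
    rw [contDiffOn_succ_iff_deriv_of_isOpen isOpen_Ioi]
    exact ⟨h.differentiableOn hS, by simp, ih (h.deriv hS)⟩

lemma IsSuperpos.const_mul (h : IsSuperpos S Φ γ m s f) (c : ℂ) :
    IsSuperpos S Φ γ (fun w => c * m w) s (fun x => c * f x) := by
  intro X hX
  simp only [mul_assoc]
  refine ⟨(h X hX).1.const_mul c, fun x hx => ?_⟩
  simp only [(h X hX).2 hx, superpos, mul_assoc, ← integral_const_mul]

lemma IsSuperpos.cpow_mul (hS : IsExhaustion S) (h : IsSuperpos S Φ γ m s f) (c : ℂ) :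
    IsSuperpos S Φ γ m (s + c) (fun x => (x : ℂ) ^ c * f x) := by
  intro X hX
  refine ⟨(h X hX).1, fun x hx => ?_⟩
  simp only [(h X hX).2 hx, superpos, ← integral_const_mul, ← add_assoc,
    cpow_add_of_pos (hS.pos X hX x hx) _ c]
  exact integral_congr_ae (Eventually.of_forall fun ξ => by ring)

lemma IsSuperpos.iteratedDeriv (hS : IsExhaustion S) (h : IsSuperpos S Φ γ m s f) (n : ℕ) :
    IsSuperpos S Φ γ (fun w => (descPochhammer ℂ n).eval (w + s) * m w) (s - n)
      (iteratedDeriv n f) := by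
  induction n with
  | zero => simpa using h
  | succ n ih =>
    rw [iteratedDeriv_succ]
    refine (ih.deriv hS).cast (fun w _ => ?_) (by push_cast; ring)
    rw [descPochhammer_succ_eval]
    ring

lemma IsSuperpos.derivSq (hS : IsExhaustion S) (h : IsSuperpos S Φ γ m s f) :
    IsSuperpos S Φ γ (fun w => (w + s) / 2 * m w) (s - 2) (derivSq f) := by
  have hmul := (((h.deriv hS).cpow_mul hS (-1)).const_mul (1 / 2)).congr hS
    (g := BuschmanErdelyi.derivSq f) fun x _ => by
      simp only [BuschmanErdelyi.derivSq, Complex.cpow_neg_one]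
      ring
  exact hmul.cast (fun w _ => by ring) (by ring)

lemma IsSuperpos.derivSq_iterate (hS : IsExhaustion S) (h : IsSuperpos S Φ γ m s f) (n : ℕ) :
    IsSuperpos S Φ γ (fun w => (descPochhammer ℂ n).eval ((w + s) / 2) * m w) (s - 2 * n)
      (BuschmanErdelyi.derivSq^[n] f) := by
  induction n with
  | zero => simpa using h
  | succ n ih =>
    rw [Function.iterate_succ_apply']
    refine (ih.derivSq hS).cast (fun w _ => ?_) (by push_cast; ring)
    rw [descPochhammer_succ_eval]
    ring

end IsSuperpos

/-! ### Integral operators on superpositions -/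

/-- The intervals `(0, X)`, the exhaustion for functions of power type at `0`. -/
def leftSets (X : ℝ) : Set ℝ := Ioo 0 X

/-- The half-lines `(X, ∞)`, the exhaustion for functions of power type at `∞`. -/
def rightSets (X : ℝ) : Set ℝ := Ioi X

lemma isExhaustion_leftSets : IsExhaustion leftSets where
  isOpen _ := isOpen_Ioo
  pos _ _ _ hx := hx.1
  cover x hx := ⟨x + 1, by positivity, hx, lt_add_one x⟩

lemma isExhaustion_rightSets : IsExhaustion rightSets where
  isOpen _ := isOpen_Ioi
  pos _ hX _ hx := hX.trans hx
  cover x hx := ⟨x / 2, half_pos hx, half_lt_self hx⟩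

section IntegralOperators

variable {Φ : ℝ → ℝ → ℂ} {γ : ℝ} {a m : ℂ → ℂ} {s s' κ : ℂ} {f k : ℝ → ℂ} {K : ℝ → ℝ → ℂ}

lemma integral_mul_eq_superpos {φ g : ℝ → ℂ} {D : Set ℝ} {x : ℝ} (hφ : Integrable φ)
    (hD : MeasurableSet D) (hD0 : D ⊆ Ioi 0) (hf : EqOn f (superpos φ γ s) D)
    (hg : ∀ w : ℂ, w.re = γ → IntegrableOn (fun t : ℝ => g t * (t : ℂ) ^ (w + s)) D ∧
      ∫ t in D, g t * (t : ℂ) ^ (w + s) = a w * (x : ℂ) ^ (w + s')) :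
    IntegrableOn (fun t => g t * f t) D ∧
      ∫ t in D, g t * f t = superpos (fun ξ => a (line γ ξ) * φ ξ) γ s' x := by
  have hgf : EqOn (fun t => g t * f t) (fun t => g t * superpos φ γ s t) D := fun t ht => by
    simp only [hf ht]
  obtain ⟨hint, hval⟩ := integral_mul_superpos hφ hD hD0 γ s (hg _ (line_re γ 0)).1
  refine ⟨hint.congr_fun hgf.symm hD, ?_⟩
  rw [setIntegral_congr_fun hD hgf, hval, superpos]
  refine integral_congr_ae (Eventually.of_forall fun ξ => ?_)
  simp only
  rw [(hg _ (line_re γ ξ)).2]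
  ring

lemma IsSuperpos.leftInt (h : IsSuperpos leftSets Φ γ m s f) (hK : IsLeftHomogeneous K κ k)
    (hk : ∀ w : ℂ, w.re = γ → HasMoment k (w + s) (a w)) :
    LeftConverges K f ∧
      IsSuperpos leftSets Φ γ (fun w => a w * m w) (s + (κ + 1)) (leftInt K f) := by
  have hint : ∀ X, 0 < X → ∀ x ∈ leftSets X, IntegrableOn (fun t => K x t * f t) (Ioo 0 x) ∧
      BuschmanErdelyi.leftInt K f x =
        superpos (fun ξ => a (line γ ξ) * (m (line γ ξ) * Φ X ξ)) γ (s + (κ + 1)) x :=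
    fun X hX x hx => integral_mul_eq_superpos (h X hX).1.integrable measurableSet_Ioo
      (fun t ht => ht.1) (fun t ht => (h X hX).2 ⟨ht.1, ht.2.trans hx.2⟩) fun w hw => by
        simpa only [add_assoc] using hK.integral_cpow (hk w hw) hx.1
  refine ⟨fun x hx => ?_, fun X hX => ?_⟩
  · obtain ⟨X, hX, hxX⟩ := isExhaustion_leftSets.cover x hx
    exact (hint X hX x hxX).1
  · simp only [mul_assoc]
    exact ⟨(h X hX).1.of_moment hk, fun x hx => (hint X hX x hx).2⟩

lemma Rapid.of_moment_neg {φ : ℝ → ℂ} (hφ : Rapid φ)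
    (hk : ∀ w : ℂ, w.re = γ → HasMoment k (-(w + s) - 2) (a w)) :
    Rapid fun ξ => a (line γ ξ) * φ ξ := by
  have hk' : ∀ w : ℂ, w.re = -γ → HasMoment k (w + (-s - 2)) (a (-w)) := fun w hw => by
    convert hk (-w) (by simp [hw]) using 1
    ring
  have hline : ∀ ξ, -line (-γ) (-ξ) = line γ ξ := fun ξ => by
    simp only [line]
    push_cast
    ring
  simpa only [hline, neg_neg] using (hφ.comp_neg.of_moment hk').comp_neg

lemma IsSuperpos.rightInt (h : IsSuperpos rightSets Φ γ m s f) (hK : IsRightHomogeneous K κ k)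
    (hk : ∀ w : ℂ, w.re = γ → HasMoment k (-(w + s) - 2) (a w)) :
    RightConverges K f ∧
      IsSuperpos rightSets Φ γ (fun w => a w * m w) (s + (κ + 1)) (rightInt K f) := by
  have hint : ∀ X, 0 < X → ∀ x ∈ rightSets X, IntegrableOn (fun t => K x t * f t) (Ioi x) ∧
      BuschmanErdelyi.rightInt K f x =
        superpos (fun ξ => a (line γ ξ) * (m (line γ ξ) * Φ X ξ)) γ (s + (κ + 1)) x :=
    fun X hX x hx => integral_mul_eq_superpos (h X hX).1.integrable measurableSet_Ioi
      (fun t ht => (hX.trans hx).trans ht)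
      (fun t ht => (h X hX).2 (show X < t from lt_trans hx ht))
      fun w hw => by simpa only [add_assoc] using hK.integral_cpow (hk w hw) (hX.trans hx)
  refine ⟨fun x hx => ?_, fun X hX => ?_⟩
  · obtain ⟨X, hX, hxX⟩ := isExhaustion_rightSets.cover x hx
    exact (hint X hX x hxX).1
  · simp only [mul_assoc]
    exact ⟨(h X hX).1.of_moment_neg hk, fun x hx => (hint X hX x hx).2⟩

end IntegralOperators

open scoped SchwartzMap FourierTransform ZeroAtInfty

/-! ### Functions of power type as superpositions of powers -/

/-- Smooth on the half-line, with `f^(k)(x) = O(x^(c - k))` along `l`; the common form of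
`PowerTypeZero` and `PowerTypeInfty`. -/
def PowerType (l : Filter ℝ) (c : ℝ) (f : ℝ → ℂ) : Prop :=
  ContDiffOn ℝ ∞ f (Ioi 0) ∧ ∀ k : ℕ, iteratedDeriv k f =O[l] fun x : ℝ => x ^ (c - k)

/-- Smooth, all derivatives being `O(e^(cu))` at `-∞`; the form that functions of power type take
in a logarithmic variable. -/
def ExpType (c : ℝ) (G : ℝ → ℂ) : Prop :=
  ContDiff ℝ ∞ G ∧ ∀ k : ℕ, iteratedDeriv k G =O[atBot] fun u => Real.exp (c * u)

section PowerType

variable {f : ℝ → ℂ} {l : Filter ℝ} {c : ℝ}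

lemma differentiableAt_iteratedDeriv (hf : ContDiffOn ℝ ∞ f (Ioi 0)) (k : ℕ) {x : ℝ}
    (hx : 0 < x) : DifferentiableAt ℝ (iteratedDeriv k f) x := by
  have hwithin := (hf.differentiableOn_iteratedDerivWithin (m := k)
    (by exact_mod_cast ENat.natCast_lt_top k) isOpen_Ioi.uniqueDiffOn x hx).differentiableAt
    (Ioi_mem_nhds hx)
  refine hwithin.congr_of_eventuallyEq ?_
  filter_upwards [Ioi_mem_nhds hx] with y hy
  exact (iteratedDerivWithin_of_isOpen isOpen_Ioi hy).symm

lemma iteratedDeriv_ofReal_mul_deriv (hf : ContDiffOn ℝ ∞ f (Ioi 0)) (k : ℕ) :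
    EqOn (iteratedDeriv k fun x : ℝ => (x : ℂ) * deriv f x)
      (fun x => (x : ℂ) * iteratedDeriv (k + 1) f x + k * iteratedDeriv k f x) (Ioi 0) := by
  induction k with
  | zero =>
    intro x _
    simp [iteratedDeriv_one]
  | succ k ih =>
    intro x hx
    have hid : HasDerivAt (fun t : ℝ => (t : ℂ)) 1 x := by
      simpa using (hasDerivAt_id x).ofReal_comp
    have hk := (differentiableAt_iteratedDeriv hf k hx).hasDerivAt
    have hk1 := (differentiableAt_iteratedDeriv hf (k + 1) hx).hasDerivAt
    rw [← iteratedDeriv_succ] at hk hk1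
    rw [iteratedDeriv_succ, (ih.eventuallyEq_of_mem (Ioi_mem_nhds hx)).deriv_eq]
    refine ((hid.mul hk1).add (hk.const_mul (k : ℂ))).deriv.trans ?_
    push_cast
    ring

lemma PowerType.ofReal_mul_deriv (hl : ∀ᶠ x in l, 0 < x) (h : PowerType l c f) :
    PowerType l c fun x : ℝ => (x : ℂ) * deriv f x := by
  have hderiv : ContDiffOn ℝ ∞ (deriv f) (Ioi 0) :=
    ((contDiffOn_infty_iff_deriv_of_isOpen isOpen_Ioi).1 h.1).2
  refine ⟨Complex.ofRealCLM.contDiff.contDiffOn.mul hderiv, fun k => ?_⟩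
  have heq : (iteratedDeriv k fun x : ℝ => (x : ℂ) * deriv f x) =ᶠ[l]
      fun x => (x : ℂ) * iteratedDeriv (k + 1) f x + k * iteratedDeriv k f x := by
    filter_upwards [hl] with x hx using iteratedDeriv_ofReal_mul_deriv h.1 k hx
  refine heq.trans_isBigO (IsBigO.add ?_ ((h.2 k).const_mul_left _))
  have hid : (fun x : ℝ => (x : ℂ)) =O[l] fun x : ℝ => x :=
    IsBigO.of_bound 1 (Eventually.of_forall fun x => by simp)
  refine (hid.mul (h.2 (k + 1))).congr' EventuallyEq.rfl ?_
  filter_upwards [hl] with x hx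
  nth_rewrite 1 [← Real.rpow_one x]
  rw [← Real.rpow_add hx]
  push_cast
  ring_nf

lemma PowerType.iteratedDeriv_comp_exp_isBigO {l' : Filter ℝ} (hl : ∀ᶠ x in l, 0 < x)
    (ht : Tendsto Real.exp l' l) (h : PowerType l c f) (k : ℕ) :
    iteratedDeriv k (fun u => f (Real.exp u)) =O[l'] fun u => Real.exp (c * u) := by
  induction k generalizing f with
  | zero =>
    have hbase := (h.2 0).comp_tendsto ht
    simp only [iteratedDeriv_zero, Nat.cast_zero, sub_zero] at hbase ⊢
    refine hbase.congr_right fun u => ?_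
    simp only [Function.comp]
    rw [← Real.exp_mul, mul_comm]
  | succ k ih =>
    have hderiv : deriv (fun u => f (Real.exp u)) =
        fun u => ((Real.exp u : ℝ) : ℂ) * deriv f (Real.exp u) := by
      funext u
      have hd : DifferentiableAt ℝ f (Real.exp u) := by
        simpa using differentiableAt_iteratedDeriv h.1 0 (Real.exp_pos u)
      exact (hd.hasDerivAt.scomp u (Real.hasDerivAt_exp u)).deriv
    rw [iteratedDeriv_succ', hderiv]
    exact ih (h.ofReal_mul_deriv hl)

lemma contDiff_comp_exp (h : ContDiffOn ℝ ∞ f (Ioi 0)) :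
    ContDiff ℝ ∞ fun u => f (Real.exp u) :=
  h.comp_contDiff Real.contDiff_exp fun u => Real.exp_pos u

lemma PowerTypeZero.expType {a : ℝ} (h : PowerTypeZero a f) :
    ExpType a fun u => f (Real.exp u) :=
  ⟨contDiff_comp_exp h.1, PowerType.iteratedDeriv_comp_exp_isBigO (l := 𝓝[>] 0)
    eventually_mem_nhdsWithin Real.tendsto_exp_atBot_nhdsGT h⟩

lemma PowerTypeInfty.expType {b : ℝ} (h : PowerTypeInfty b f) :
    ExpType b fun u => f (Real.exp (-u)) := by
  refine ⟨(contDiff_comp_exp h.1).comp contDiff_neg, fun k => ?_⟩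
  have hTop := (PowerType.iteratedDeriv_comp_exp_isBigO (l := atTop) (eventually_gt_atTop 0)
    Real.tendsto_exp_atTop h k).comp_tendsto tendsto_neg_atBot_atTop
  rw [show iteratedDeriv k (fun u => f (Real.exp (-u))) =
      fun u => (-1 : ℝ) ^ k • iteratedDeriv k (fun u => f (Real.exp u)) (-u) from
    funext fun u => iteratedDeriv_comp_neg k (fun u => f (Real.exp u)) u]
  exact (hTop.const_smul_left ((-1 : ℝ) ^ k)).congr_right fun u => by simp

end PowerType

section ExpType

variable {c γ δ : ℝ} {G : ℝ → ℂ}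

lemma ExpType.deriv (h : ExpType c G) : ExpType c (deriv G) :=
  ⟨(contDiff_infty_iff_deriv.1 h.1).2, fun k => by
    simpa only [iteratedDeriv_succ'] using h.2 (k + 1)⟩

lemma ExpType.const_mul (h : ExpType c G) (a : ℂ) : ExpType c fun u => a * G u :=
  ⟨contDiff_const.mul h.1, fun k => ((h.2 k).const_mul_left a).congr_left fun _ =>
    (iteratedDeriv_const_mul_field a G).symm⟩

lemma ExpType.sub {H : ℝ → ℂ} (hG : ExpType c G) (hH : ExpType c H) :
    ExpType c fun u => G u - H u := by
  refine ⟨hG.1.sub hH.1, fun k => ((hG.2 k).sub (hH.2 k)).congr_left fun u => ?_⟩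
  exact (iteratedDeriv_fun_sub (hG.1.contDiffAt.of_le (by exact_mod_cast le_top))
    (hH.1.contDiffAt.of_le (by exact_mod_cast le_top))).symm

lemma deriv_exp_mul (hG : Differentiable ℝ G) (γ : ℝ) :
    deriv (fun u => ((Real.exp (-γ * u) : ℝ) : ℂ) * G u) =
      fun u => ((Real.exp (-γ * u) : ℝ) : ℂ) * (deriv G u - γ * G u) := by
  funext u
  have hexp : HasDerivAt (fun u : ℝ => Real.exp (-γ * u)) (Real.exp (-γ * u) * (-γ)) u := by
    simpa using ((hasDerivAt_id u).const_mul (-γ)).exp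
  refine (hexp.ofReal_comp.mul (hG u).hasDerivAt).deriv.trans ?_
  push_cast
  ring

lemma ExpType.exp_mul (h : ExpType c G) (γ : ℝ) :
    ExpType (c - γ) fun u => ((Real.exp (-γ * u) : ℝ) : ℂ) * G u := by
  have hexp : ContDiff ℝ ∞ fun u : ℝ => ((Real.exp (-γ * u) : ℝ) : ℂ) :=
    Complex.ofRealCLM.contDiff.comp (Real.contDiff_exp.comp (contDiff_const.mul contDiff_id))
  refine ⟨hexp.mul h.1, fun k => ?_⟩
  induction k generalizing G with
  | zero =>
    have hbound : (fun u : ℝ => ((Real.exp (-γ * u) : ℝ) : ℂ)) =O[atBot]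
        fun u => Real.exp (-γ * u) :=
      IsBigO.of_bound 1 (Eventually.of_forall fun u => by rw [Complex.norm_real, one_mul])
    refine (hbound.mul (h.2 0)).congr_right fun u => ?_
    rw [← Real.exp_add]
    ring_nf
  | succ k ih =>
    rw [iteratedDeriv_succ', deriv_exp_mul (h.1.differentiable (by simp))]
    exact ih (h.deriv.sub (h.const_mul γ))

lemma tendsto_pow_mul_exp_atBot (hδ : 0 < δ) (k : ℕ) :
    Tendsto (fun u : ℝ => |u| ^ k * Real.exp (δ * u)) atBot (𝓝 0) := by
  have hpos := ((Real.tendsto_pow_mul_exp_neg_atTop_nhds_zero k).comp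
    (tendsto_neg_atBot_atTop.const_mul_atTop hδ)).const_mul (δ ^ k)⁻¹
  rw [mul_zero] at hpos
  refine hpos.congr' ?_
  filter_upwards [eventually_le_atBot 0] with u hu
  simp only [Function.comp]
  rw [abs_of_nonpos hu, mul_pow, mul_neg, neg_neg, mul_assoc, inv_mul_cancel_left₀ (by positivity)]

lemma ExpType.tendsto_pow_mul_iteratedDeriv (hδ : 0 < δ) (h : ExpType δ G) (k n : ℕ) :
    Tendsto (fun u : ℝ => ‖u‖ ^ k * ‖iteratedDeriv n G u‖) atBot (𝓝 0) := by
  have hO : (fun u : ℝ => ‖u‖ ^ k * ‖iteratedDeriv n G u‖) =O[atBot]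
      fun u => |u| ^ k * Real.exp (δ * u) :=
    (isBigO_refl _ _).mul (h.2 n).norm_left
  exact hO.trans_tendsto (tendsto_pow_mul_exp_atBot hδ k)

lemma exists_contDiff_cutoff (U : ℝ) : ∃ χ : ℝ → ℂ, ContDiff ℝ ∞ χ ∧
    EqOn χ (fun _ => 1) (Iio U) ∧ EqOn χ (fun _ => 0) (Ioi (U + 1)) := by
  refine ⟨fun u => ((Real.smoothTransition (U + 1 - u) : ℝ) : ℂ),
    Complex.ofRealCLM.contDiff.comp (Real.smoothTransition.contDiff.comp
      (contDiff_const.sub contDiff_id)), fun u hu => ?_, fun u hu => ?_⟩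
  · rw [mem_Iio] at hu
    simp only [Real.smoothTransition.one_of_one_le (show 1 ≤ U + 1 - u by linarith),
      Complex.ofReal_one]
  · simp only [Real.smoothTransition.zero_of_nonpos (sub_nonpos.2 (le_of_lt hu)),
      Complex.ofReal_zero]

lemma ExpType.exists_schwartz (hδ : 0 < δ) (h : ExpType δ G) (U : ℝ) :
    ∃ g : 𝓢(ℝ, ℂ), EqOn g G (Iio U) := by
  obtain ⟨χ, hχ, hχ1, hχ0⟩ := exists_contDiff_cutoff U
  have hsmooth : ContDiff ℝ ∞ fun u => χ u * G u := hχ.mul h.1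
  have hleft : EqOn (fun u => χ u * G u) G (Iio U) := fun u hu => by simp [hχ1 hu]
  have hright : EqOn (fun u => χ u * G u) (fun _ => 0) (Ioi (U + 1)) := fun u hu => by
    simp [hχ0 hu]
  refine ⟨⟨fun u => χ u * G u, hsmooth, fun k n => ?_⟩, hleft⟩
  have hcont : Continuous fun u : ℝ => ‖u‖ ^ k * ‖iteratedDeriv n (fun u => χ u * G u) u‖ :=
    (continuous_norm.pow k).mul
      (hsmooth.continuous_iteratedDeriv n (by exact_mod_cast le_top)).norm
  have hlim : Tendsto (fun u : ℝ => ‖u‖ ^ k * ‖iteratedDeriv n (fun u => χ u * G u) u‖)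
      (cocompact ℝ) (𝓝 0) := by
    rw [cocompact_eq_atBot_atTop, tendsto_sup]
    constructor
    · refine (h.tendsto_pow_mul_iteratedDeriv hδ k n).congr' ?_
      filter_upwards [eventually_lt_atBot U] with u hu
      rw [hleft.iteratedDeriv_of_isOpen isOpen_Iio n hu]
    · refine tendsto_const_nhds.congr' ?_
      filter_upwards [eventually_gt_atTop (U + 1)] with u hu
      rw [hright.iteratedDeriv_of_isOpen isOpen_Ioi n hu, iteratedDeriv_const]
      simp
  let F : C₀(ℝ, ℝ) := ⟨⟨_, hcont⟩, hlim⟩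
  refine ⟨‖F.toBCF‖, fun u => ?_⟩
  rw [norm_iteratedFDeriv_eq_norm_iteratedDeriv]
  exact (le_abs_self _).trans (F.toBCF.norm_coe_le_norm u)

lemma rapid_schwartz (ψ : 𝓢(ℝ, ℂ)) : Rapid ψ := by
  intro n
  have hi : Integrable fun ξ : ℝ => 2 ^ (n - 1) * (‖ψ ξ‖ + ‖ξ‖ ^ n * ‖ψ ξ‖) :=
    (ψ.integrable.norm.add (ψ.integrable_pow_mul volume n)).const_mul _
  refine hi.mono' (Continuous.aestronglyMeasurable (by fun_prop)) (Eventually.of_forall fun ξ => ?_)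
  rw [norm_mul, norm_pow, norm_one_add_abs, Real.norm_eq_abs]
  calc (1 + |ξ|) ^ n * ‖ψ ξ‖ ≤ 2 ^ (n - 1) * (1 ^ n + |ξ| ^ n) * ‖ψ ξ‖ := by
        gcongr
        exact add_pow_le zero_le_one (abs_nonneg ξ) n
    _ = 2 ^ (n - 1) * (‖ψ ξ‖ + |ξ| ^ n * ‖ψ ξ‖) := by ring

lemma ofReal_exp_cpow_line (γ ξ u : ℝ) :
    ((Real.exp u : ℝ) : ℂ) ^ line γ ξ =
      ((Real.exp (γ * u) : ℝ) : ℂ) * Complex.exp (2 * Real.pi * (ξ * u) * Complex.I) := by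
  rw [Complex.cpow_def_of_ne_zero (Complex.ofReal_ne_zero.2 (Real.exp_pos u).ne'),
    ← Complex.ofReal_log (Real.exp_pos u).le, Real.log_exp, Complex.ofReal_exp, ← Complex.exp_add,
    line]
  push_cast
  ring_nf

lemma schwartz_eq_integral_fourier (g : 𝓢(ℝ, ℂ)) (u : ℝ) :
    g u = ∫ ξ : ℝ, Complex.exp (2 * Real.pi * (ξ * u) * Complex.I) * (𝓕 g : 𝓢(ℝ, ℂ)) ξ := by
  have hinv : 𝓕⁻ (𝓕 g) = g := FourierTransform.fourierInv_fourier_eq g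
  conv_lhs => rw [← hinv]
  rw [SchwartzMap.fourierInv_coe, Real.fourierInv_eq']
  refine integral_congr_ae (Eventually.of_forall fun ξ => ?_)
  simp [mul_comm u ξ]

lemma ExpType.exists_superpos (hγ : γ < c) (h : ExpType c G) (U : ℝ) :
    ∃ φ : ℝ → ℂ, Rapid φ ∧ ∀ u < U, G u = superpos φ γ 0 (Real.exp u) := by
  obtain ⟨g, hg⟩ := (h.exp_mul γ).exists_schwartz (sub_pos.2 hγ) U
  refine ⟨(𝓕 g : 𝓢(ℝ, ℂ)), rapid_schwartz (𝓕 g), fun u hu => ?_⟩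
  have hexp : ((Real.exp (γ * u) : ℝ) : ℂ) * ((Real.exp (-γ * u) : ℝ) : ℂ) = 1 := by
    rw [← Complex.ofReal_mul, ← Real.exp_add]
    simp
  calc G u = ((Real.exp (γ * u) : ℝ) : ℂ) * g u := by
        rw [hg hu, ← mul_assoc, hexp, one_mul]
    _ = superpos (𝓕 g : 𝓢(ℝ, ℂ)) γ 0 (Real.exp u) := by
        rw [schwartz_eq_integral_fourier, ← integral_const_mul, superpos]
        refine integral_congr_ae (Eventually.of_forall fun ξ => ?_)
        simp only [add_zero, ofReal_exp_cpow_line]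
        ring

lemma superpos_inv {φ : ℝ → ℂ} {x : ℝ} (hx : 0 < x) (γ : ℝ) :
    superpos φ γ 0 x⁻¹ = superpos (fun ξ => φ (-ξ)) (-γ) 0 x := by
  rw [superpos, superpos, ← integral_neg_eq_self]
  refine integral_congr_ae (Eventually.of_forall fun ξ => ?_)
  simp only [add_zero]
  rw [inv_cpow_of_pos hx]
  congr 2
  simp only [line]
  push_cast
  ring

lemma PowerTypeZero.exists_isSuperpos {a : ℝ} {f : ℝ → ℂ} (h : PowerTypeZero a f) (hγ : γ < a) :
    ∃ Φ, IsSuperpos leftSets Φ γ (fun _ => 1) 0 f := by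
  choose φ hφ hG using fun X : ℝ => h.expType.exists_superpos hγ (Real.log X)
  refine ⟨φ, fun X _ => ?_⟩
  simp only [one_mul]
  refine ⟨hφ X, fun x hx => ?_⟩
  simpa only [Real.exp_log hx.1] using hG X (Real.log x) (Real.log_lt_log hx.1 hx.2)

lemma PowerTypeInfty.exists_isSuperpos {b : ℝ} {f : ℝ → ℂ} (h : PowerTypeInfty b f) (hγ : γ < b) :
    ∃ Φ, IsSuperpos rightSets Φ (-γ) (fun _ => 1) 0 f := by
  choose φ hφ hG using fun X : ℝ => h.expType.exists_superpos hγ (-Real.log X)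
  refine ⟨fun X ξ => φ X (-ξ), fun X hX => ?_⟩
  simp only [one_mul]
  refine ⟨(hφ X).comp_neg, fun x hx => ?_⟩
  have hx0 : 0 < x := hX.trans hx
  have hlog := hG X (-Real.log x) (neg_lt_neg (Real.log_lt_log hX hx))
  rwa [neg_neg, Real.exp_neg, Real.exp_log hx0, superpos_inv hx0] at hlog

end ExpType

/-! ### The Mellin symbols of the operators -/

lemma descPochhammer_eval_add_natCast (z : ℂ) (n : ℕ) :
    (descPochhammer ℂ n).eval (z + n) = poch (z + 1) n := by
  rw [descPochhammer_eval_eq_ascPochhammer, add_sub_cancel_right]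

lemma neg_one_pow_mul_descPochhammer_eval (z : ℂ) (n : ℕ) :
    (-1) ^ n * (descPochhammer ℂ n).eval z = poch (-z) n := by
  nth_rw 1 [← Finset.card_range n]
  rw [descPochhammer_eval_eq_prod_range, poch_eq_prod, ← Finset.prod_const,
    ← Finset.prod_mul_distrib]
  exact Finset.prod_congr rfl fun j _ => by ring

lemma add_ordShift_pos (α : ℂ) : 0 < (α + ordShift α).re := by
  have := Nat.lt_floor_add_one (1 - α.re)
  simp only [Complex.add_re, Complex.natCast_re, ordShift]
  linarith

lemma ordShift_lt {α : ℂ} {t : ℝ} (h : 0 < t) (h' : 1 - α.re < t) : (ordShift α : ℝ) < t := by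
  rcases le_or_gt 0 (1 - α.re) with hα | hα
  · exact (Nat.floor_le hα).trans_lt h'
  · simpa [ordShift, Nat.floor_of_nonpos hα.le] using h

lemma sub_smoothShift_lt (σ : ℂ) : (σ - smoothShift σ).re < 1 := by
  have := Nat.lt_floor_add_one σ.re
  simp only [Complex.sub_re, Complex.natCast_re, smoothShift]
  linarith

lemma smoothShift_lt {σ : ℂ} {t : ℝ} (h : 0 < t) (h' : σ.re < t) : (smoothShift σ : ℝ) < t := by
  rcases le_or_gt 0 σ.re with hσ | hσ
  · exact (Nat.floor_le hσ).trans_lt h'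
  · simpa [smoothShift, Nat.floor_of_nonpos hσ.le] using h

section Symbols

variable {Φ : ℝ → ℝ → ℂ} {γ : ℝ} {m : ℂ → ℂ} {s : ℂ} {f : ℝ → ℂ}

lemma IsSuperpos.rlL (h : IsSuperpos leftSets Φ γ m s f) (α : ℂ) (hγ : -1 < γ + s.re) :
    RlLDefined α f ∧ IsSuperpos leftSets Φ γ
      (fun w => Complex.Gamma (w + s + 1) * (Complex.Gamma (w + s + 1 + α))⁻¹ * m w)
      (s + α) (rlL α f) := by
  obtain ⟨hconv, hint⟩ := h.leftInt (isLeftHomogeneous_rlKerL (α + ordShift α)) fun w hw =>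
    hasMoment_rlProfile (w := w + s) (add_ordShift_pos α) (by simpa [hw] using hγ)
  refine ⟨⟨hconv, hint.contDiffOn isExhaustion_leftSets _⟩,
    (hint.iteratedDeriv isExhaustion_leftSets _).cast (fun w _ => ?_) (by ring)⟩
  rw [show w + (s + (α + ordShift α - 1 + 1)) = w + s + α + ordShift α by ring,
    descPochhammer_eval_add_natCast, ← poch_mul_inv_Gamma (w + s + 1 + α) (ordShift α)]
  ring_nf

lemma IsSuperpos.rlR (h : IsSuperpos rightSets Φ γ m s f) (α : ℂ) (hγ : γ + s.re + α.re < 0)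
    (hγ' : γ + s.re < -1) :
    RlRDefined α f ∧ IsSuperpos rightSets Φ γ
      (fun w => Complex.Gamma (-(w + s) - α) * (Complex.Gamma (-(w + s)))⁻¹ * m w)
      (s + α) (rlR α f) := by
  have hpos : ∀ w : ℂ, w.re = γ → 0 < (-(w + s) - α - ordShift α).re := fun w hw => by
    have := ordShift_lt (α := α) (t := -(γ + s.re) - α.re) (by linarith) (by linarith)
    simp only [Complex.sub_re, Complex.neg_re, Complex.add_re, Complex.natCast_re, hw]
    linarith
  have hmoment : ∀ w : ℂ, w.re = γ → HasMoment (rlProfile (α + ordShift α))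
      (-(w + s) - 2 - (α + ordShift α - 1))
      (Complex.Gamma (-(w + s) - α - ordShift α) * (Complex.Gamma (-(w + s)))⁻¹) := fun w hw => by
    rw [show -(w + s) - 2 - (α + ordShift α - 1) = -(w + s) - α - ordShift α - 1 by ring]
    convert hasMoment_rlProfile (add_ordShift_pos α) _ using 3
    · ring
    · ring_nf
    · rw [Complex.sub_re, Complex.one_re]
      linarith [hpos w hw]
  obtain ⟨hconv, hint⟩ := h.rightInt (isLeftHomogeneous_rlKerL (α + ordShift α)).swap
    fun w hw => (hmoment w hw).swap
  refine ⟨⟨hconv, hint.contDiffOn isExhaustion_rightSets _⟩,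
    ((hint.iteratedDeriv isExhaustion_rightSets _).const_mul _).cast (fun w hw => ?_) (by ring)⟩
  rw [← mul_assoc, neg_one_pow_mul_descPochhammer_eval,
    show -(w + (s + (α + ordShift α - 1 + 1))) = -(w + s) - α - ordShift α by ring,
    ← mul_assoc, ← mul_assoc, ← Gamma_add_natCast (ne_neg_natCast_of_re_pos (hpos w hw)),
    sub_add_cancel]

lemma IsSuperpos.ekL (h : IsSuperpos leftSets Φ γ m s f) (α y : ℂ)
    (hγ : 0 < y.re + 1 + (γ + s.re) / 2) :
    EkLDefined α y f ∧ IsSuperpos leftSets Φ γ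
      (fun w => Complex.Gamma (y + 1 + (w + s) / 2) *
        (Complex.Gamma (α + y + 1 + (w + s) / 2))⁻¹ * m w) s (ekL α y f) := by
  obtain ⟨hconv, hint⟩ := h.leftInt (isLeftHomogeneous_ekKerL (α + ordShift α) y) fun w hw =>
    hasMoment_ekProfile (w := w + s) (add_ordShift_pos α) (by simpa [hw] using hγ)
  have hinner := hint.cpow_mul isExhaustion_leftSets (2 * (α + y + ordShift α))
  have houter := (hinner.derivSq_iterate isExhaustion_leftSets (ordShift α)).cpow_mul
    isExhaustion_leftSets (-2 * (α + y))
  refine ⟨⟨hconv, hinner.contDiffOn isExhaustion_leftSets _⟩, houter.cast (fun w _ => ?_) (by ring)⟩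
  rw [show (w + (s + (-1 + 1) + 2 * (α + y + ordShift α))) / 2 =
    (w + s) / 2 + α + y + ordShift α by ring, descPochhammer_eval_add_natCast,
    ← poch_mul_inv_Gamma (α + y + 1 + (w + s) / 2) (ordShift α)]
  ring_nf

lemma IsSuperpos.ekR (h : IsSuperpos rightSets Φ γ m s f) (α y : ℂ) (hγ : γ + s.re < 2 * y.re)
    (hγ' : γ + s.re < 2 * (y.re + α.re - 1)) :
    EkRDefined α y f ∧ IsSuperpos rightSets Φ γ
      (fun w => Complex.Gamma (y - (w + s) / 2) *
        (Complex.Gamma (α + y - (w + s) / 2))⁻¹ * m w) s (ekR α y f) := by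
  have hpos : ∀ w : ℂ, w.re = γ → 0 < (y - ordShift α - (w + s) / 2).re := fun w hw => by
    have := ordShift_lt (α := α) (t := y.re - (γ + s.re) / 2) (by linarith) (by linarith)
    simp only [Complex.sub_re, Complex.natCast_re, Complex.div_ofNat_re, Complex.add_re, hw]
    linarith
  have hmoment : ∀ w : ℂ, w.re = γ → HasMoment (ekProfile (α + ordShift α) (y - ordShift α))
      (-(w + s) - 2) (Complex.Gamma (y - ordShift α - (w + s) / 2) *
        (Complex.Gamma (α + y - (w + s) / 2))⁻¹) := fun w hw => by
    have hw' : y - ordShift α + 1 + (-(w + s) - 2) / 2 = y - ordShift α - (w + s) / 2 := by ring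
    convert hasMoment_ekProfile (add_ordShift_pos α) (hw' ▸ hpos w hw) using 3
    · ring
    · ring_nf
  obtain ⟨hconv, hint⟩ := h.rightInt
    (isRightHomogeneous_ekKerR (α + ordShift α) (y - ordShift α)) hmoment
  have hinner := hint.cpow_mul isExhaustion_rightSets (2 * (ordShift α - y))
  have houter := ((hinner.derivSq_iterate isExhaustion_rightSets (ordShift α)).const_mul
    ((-1) ^ ordShift α)).cpow_mul isExhaustion_rightSets (2 * y)
  refine ⟨⟨hconv, hinner.contDiffOn isExhaustion_rightSets _⟩,
    houter.cast (fun w hw => ?_) (by ring)⟩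
  rw [← mul_assoc, neg_one_pow_mul_descPochhammer_eval,
    show -((w + (s + (-1 + 1) + 2 * (ordShift α - y))) / 2) = y - ordShift α - (w + s) / 2 by ring,
    ← mul_assoc, ← mul_assoc, ← Gamma_add_natCast (ne_neg_natCast_of_re_pos (hpos w hw))]
  ring_nf

lemma IsSuperpos.mulTwoDiv {S : ℝ → Set ℝ} (hS : IsExhaustion S) (h : IsSuperpos S Φ γ m s f)
    (c : ℂ) : IsSuperpos S Φ γ (fun w => 2 ^ c * m w) (s - c) (mulTwoDiv c f) := by
  refine (((h.cpow_mul hS (-c)).const_mul (2 ^ c)).congr hS fun x hx => ?_).cast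
    (fun w _ => rfl) (by ring)
  rw [BuschmanErdelyi.mulTwoDiv, div_cpow_of_pos two_pos hx, Complex.ofReal_ofNat, mul_assoc]

lemma IsSuperpos.mulDivTwo {S : ℝ → Set ℝ} (hS : IsExhaustion S) (h : IsSuperpos S Φ γ m s f)
    (c : ℂ) : IsSuperpos S Φ γ (fun w => 2 ^ (-c) * m w) (s + c) (mulDivTwo c f) := by
  refine ((h.cpow_mul hS c).const_mul (2 ^ (-c))).congr hS fun x hx => ?_
  rw [BuschmanErdelyi.mulDivTwo, div_cpow_of_pos hx two_pos, Complex.ofReal_ofNat]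
  ring

lemma IsSuperpos.opBL (h : IsSuperpos leftSets Φ γ m s f) (ν σ : ℂ) (hγ : ν.re - 1 < γ + s.re)
    (hγ' : -ν.re - 2 < γ + s.re) :
    BLDefined ν σ f ∧
      IsSuperpos leftSets Φ γ (fun w => symB ν σ (w + s) * m w) (s + 1 - σ) (opBL ν σ f) := by
  obtain ⟨hconv, hint⟩ := h.leftInt (isLeftHomogeneous_kerBL ν (σ - smoothShift σ)) fun w hw =>
    hasMoment_kerBProfile (w := w + s) ν (sub_smoothShift_lt σ) (by simpa [hw] using hγ)
      (by simpa [hw] using hγ')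
  refine ⟨⟨hconv, hint.contDiffOn isExhaustion_leftSets _⟩,
    (hint.iteratedDeriv isExhaustion_leftSets _).cast (fun w _ => ?_) (by ring)⟩
  rw [symB, symB, ← poch_mul_inv_Gamma (w + s + 2 - σ) (smoothShift σ),
    show w + (s + (-(σ - smoothShift σ) + 1)) = w + s + 1 - σ + smoothShift σ by ring,
    descPochhammer_eval_add_natCast]
  ring_nf

lemma IsSuperpos.opEL (h : IsSuperpos leftSets Φ γ m s f) (ν σ : ℂ) (hγ : -1 < γ + s.re)
    (hγ' : σ.re - 1 < γ + s.re) :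
    ELDefined ν σ f ∧
      IsSuperpos leftSets Φ γ (fun w => symE ν σ (w + s) * m w) (s + 1 - σ) (opEL ν σ f) := by
  have hre : ∀ w : ℂ, w.re = γ → -1 < (w + (s - smoothShift σ)).re := fun w hw => by
    have := smoothShift_lt (σ := σ) (t := γ + s.re + 1) (by linarith) (by linarith)
    simp only [Complex.add_re, Complex.sub_re, Complex.natCast_re, hw]
    linarith
  obtain ⟨hconv, hint⟩ := (h.iteratedDeriv isExhaustion_leftSets (smoothShift σ)).leftInt
    (isLeftHomogeneous_kerEL ν (σ - smoothShift σ)) fun w hw =>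
      hasMoment_kerEProfile ν (sub_smoothShift_lt σ) (hre w hw)
  refine ⟨⟨h.contDiffOn isExhaustion_leftSets _, hconv⟩, hint.cast (fun w hw => ?_) (by ring)⟩
  have hpos : 0 < (w + s - smoothShift σ + 1).re := by
    rw [add_sub_assoc, Complex.add_re, Complex.one_re]
    linarith [hre w hw]
  have hpoch : (descPochhammer ℂ (smoothShift σ)).eval (w + s) =
      poch (w + s - smoothShift σ + 1) (smoothShift σ) := by
    rw [← descPochhammer_eval_add_natCast, sub_add_cancel]
  have hΓ : Complex.Gamma (w + s + 1) = poch (w + s - smoothShift σ + 1) (smoothShift σ) *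
      Complex.Gamma (w + s - smoothShift σ + 1) := by
    rw [← Gamma_add_natCast (ne_neg_natCast_of_re_pos hpos)]
    ring_nf
  rw [symE, symE, hpoch, hΓ]
  ring_nf

lemma IsSuperpos.opBR (h : IsSuperpos rightSets Φ γ m s f) (ν σ : ℂ)
    (hγ : γ + s.re < σ.re - ν.re - 1) (hγ' : γ + s.re < ν.re + σ.re) :
    BRDefined ν σ f ∧
      IsSuperpos rightSets Φ γ (fun w => symB ν σ (σ - (w + s) - 2) * m w) (s + 1 - σ)
        (opBR ν σ f) := by
  have hmoment : ∀ w : ℂ, w.re = γ → HasMoment (kerBProfile ν (σ - smoothShift σ))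
      (-(w + (s - smoothShift σ)) - 2 - -(σ - smoothShift σ))
      (symB ν (σ - smoothShift σ) (σ - (w + s) - 2)) := fun w hw => by
    rw [show -(w + (s - smoothShift σ)) - 2 - -(σ - smoothShift σ) = σ - (w + s) - 2 by ring]
    have hre : (σ - (w + s) - 2).re = σ.re - (γ + s.re) - 2 := by simp [hw]
    exact hasMoment_kerBProfile ν (sub_smoothShift_lt σ) (by linarith) (by linarith)
  obtain ⟨hconv, hint⟩ := ((h.iteratedDeriv isExhaustion_rightSets (smoothShift σ)).const_mul
    ((-1) ^ smoothShift σ)).rightInt (isLeftHomogeneous_kerBL ν (σ - smoothShift σ)).swap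
    fun w hw => (hmoment w hw).swap
  refine ⟨⟨h.contDiffOn isExhaustion_rightSets _, hconv⟩, hint.cast (fun w _ => ?_) (by ring)⟩
  rw [← mul_assoc ((-1 : ℂ) ^ _), neg_one_pow_mul_descPochhammer_eval, symB, symB,
    show σ - (w + s) - 2 + 2 - σ = -(w + s) by ring,
    show σ - (w + s) - 2 + 2 - (σ - smoothShift σ) = -(w + s) + smoothShift σ by ring,
    ← poch_mul_inv_Gamma (-(w + s)) (smoothShift σ)]
  ring

lemma IsSuperpos.opER (h : IsSuperpos rightSets Φ γ m s f) (ν σ : ℂ) (hγ : γ + s.re < -1)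
    (hγ' : γ + s.re < σ.re - 1) :
    ERDefined ν σ f ∧
      IsSuperpos rightSets Φ γ (fun w => symE ν σ (σ - (w + s) - 2) * m w) (s + 1 - σ)
        (opER ν σ f) := by
  have hre : ∀ w : ℂ, w.re = γ → -1 < (σ - (w + s) - 2 - smoothShift σ).re := fun w hw => by
    have := smoothShift_lt (σ := σ) (t := σ.re - (γ + s.re) - 1) (by linarith) (by linarith)
    simp only [Complex.sub_re, Complex.add_re, Complex.natCast_re, Complex.re_ofNat, hw]
    linarith
  have hmoment : ∀ w : ℂ, w.re = γ → HasMoment (kerEProfile ν (σ - smoothShift σ))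
      (-(w + s) - 2 - -(σ - smoothShift σ))
      (symE ν (σ - smoothShift σ) (σ - (w + s) - 2 - smoothShift σ)) := fun w hw => by
    rw [show -(w + s) - 2 - -(σ - smoothShift σ) = σ - (w + s) - 2 - smoothShift σ by ring]
    exact hasMoment_kerEProfile ν (sub_smoothShift_lt σ) (hre w hw)
  obtain ⟨hconv, hint⟩ := h.rightInt (isLeftHomogeneous_kerEL ν (σ - smoothShift σ)).swap
    fun w hw => (hmoment w hw).swap
  refine ⟨⟨hconv, hint.contDiffOn isExhaustion_rightSets _⟩,
    ((hint.iteratedDeriv isExhaustion_rightSets _).const_mul _).cast (fun w hw => ?_) (by ring)⟩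
  have hpos : 0 < (σ - (w + s) - 1 - smoothShift σ).re := by
    rw [show σ - (w + s) - 1 - smoothShift σ = σ - (w + s) - 2 - smoothShift σ + 1 by ring,
      Complex.add_re, Complex.one_re]
    linarith [hre w hw]
  rw [← mul_assoc, neg_one_pow_mul_descPochhammer_eval, symE, symE,
    show σ - (w + s) - 2 + 1 = σ - (w + s) - 1 - smoothShift σ + smoothShift σ by ring,
    Gamma_add_natCast (ne_neg_natCast_of_re_pos hpos),
    show -(w + (s + (-(σ - smoothShift σ) + 1))) = σ - (w + s) - 1 - smoothShift σ by ring]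
  ring_nf

end Symbols

/-! ### The operators of zero order of smoothness as Buschman–Erdélyi operators -/

section ZeroOrder

variable (ν : ℂ)

lemma smoothShift_one : smoothShift 1 = 1 := by simp [smoothShift]

lemma kerBL_zero : kerBL ν 0 = fun x t => legendreP ν 0 (x / t) := by
  funext x t
  simp [kerBL]

lemma kerEL_zero : kerEL ν 0 = fun x t => legendreCut ν 0 (t / x) := by
  funext x t
  simp [kerEL]

lemma kerBR_zero : kerBR ν 0 = fun x t => legendreP ν 0 (t / x) := by
  funext x t
  simp [kerBR]

lemma kerER_zero : kerER ν 0 = fun x t => legendreCut ν 0 (x / t) := by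
  funext x t
  simp [kerER]

lemma opBL_one : opBL ν 1 = zeroSL ν := by
  funext f
  simp [opBL, zeroSL, smoothShift_one, kerBL_zero, iteratedDeriv_one]

lemma blDefined_one : BLDefined ν 1 = ZeroSLDefined ν := by
  funext f
  simp [BLDefined, ZeroSLDefined, smoothShift_one, kerBL_zero]

lemma opEL_one : opEL ν 1 = zeroPL ν := by
  funext f
  simp [opEL, zeroPL, smoothShift_one, kerEL_zero, iteratedDeriv_one]

lemma elDefined_one : ELDefined ν 1 = ZeroPLDefined ν := by
  funext f
  simp [ELDefined, ZeroPLDefined, smoothShift_one, kerEL_zero, iteratedDeriv_one]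

lemma opBR_one : opBR ν 1 = zeroPR ν := by
  funext f
  simp [opBR, zeroPR, smoothShift_one, kerBR_zero, iteratedDeriv_one]

lemma brDefined_one : BRDefined ν 1 = ZeroPRDefined ν := by
  funext f
  simp [BRDefined, ZeroPRDefined, smoothShift_one, kerBR_zero, iteratedDeriv_one]

lemma opER_one : opER ν 1 = zeroSR ν := by
  funext f x
  simp [opER, zeroSR, smoothShift_one, kerER_zero, iteratedDeriv_one]

lemma erDefined_one : ERDefined ν 1 = ZeroSRDefined ν := by
  funext f
  simp [ERDefined, ZeroSRDefined, smoothShift_one, kerER_zero]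

end ZeroOrder

/-! ### Identities between the Mellin symbols -/

section SymbolIdentities

variable {ν μ w : ℂ}

lemma symB_eq_rl_mul_ek (h : ν.re < w.re) :
    symB ν μ w = Complex.Gamma (w - ν) * (Complex.Gamma (w + 2 - μ))⁻¹ *
      (Complex.Gamma ((w + ν + 2) / 2) * (Complex.Gamma ((w - ν) / 2))⁻¹ * 2 ^ (ν + 1)) := by
  have hΓ : Complex.Gamma ((w - ν) / 2) ≠ 0 :=
    Complex.Gamma_ne_zero_of_re_pos (by simpa using h)
  have hdup := Complex.Gamma_mul_Gamma_add_half ((w - ν) / 2)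
  rw [mul_div_cancel₀ _ two_ne_zero, show (w - ν) / 2 + 1 / 2 = (w + 1 - ν) / 2 by ring,
    mul_comm] at hdup
  have hpow : (2 : ℂ) ^ (1 - (w - ν)) * 2 ^ w = 2 ^ (ν + 1) := by
    rw [← Complex.cpow_add _ _ two_ne_zero]
    ring_nf
  have hπ : ((√Real.pi : ℝ) : ℂ) ≠ 0 := by
    exact_mod_cast (Real.sqrt_pos.2 Real.pi_pos).ne'
  rw [symB, ← hpow, eq_div_of_mul_eq hΓ hdup]
  field_simp

lemma symE_eq_ek_mul_rl (h : ν.re + μ.re - 1 < w.re) :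
    symE ν μ w = 2 ^ (-(ν + 1)) * (Complex.Gamma ((w + 1 - ν - μ) / 2) *
      (Complex.Gamma ((w + 3 + ν - μ) / 2))⁻¹ *
      (Complex.Gamma (w + 1) * (Complex.Gamma (w + 1 - ν - μ))⁻¹)) := by
  have hre : 0 < (w + 1 - ν - μ).re := by
    simp only [Complex.sub_re, Complex.add_re, Complex.one_re]
    linarith
  have hΓ : Complex.Gamma (w + 1 - ν - μ) ≠ 0 := Complex.Gamma_ne_zero_of_re_pos hre
  have hΓ' : Complex.Gamma ((w + 2 - ν - μ) / 2) ≠ 0 := Complex.Gamma_ne_zero_of_re_pos <| by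
    rw [show w + 2 - ν - μ = w + 1 - ν - μ + 1 by ring, Complex.div_ofNat_re, Complex.add_re,
      Complex.one_re]
    positivity
  have hdup := Complex.Gamma_mul_Gamma_add_half ((w + 1 - ν - μ) / 2)
  rw [mul_div_cancel₀ _ two_ne_zero,
    show (w + 1 - ν - μ) / 2 + 1 / 2 = (w + 2 - ν - μ) / 2 by ring] at hdup
  have hpow : (2 : ℂ) ^ (-(ν + 1)) * 2 ^ (1 - (w + 1 - ν - μ)) = 2 ^ (μ - 1 - w) := by
    rw [← Complex.cpow_add _ _ two_ne_zero]
    ring_nf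
  rw [symE, ← hpow, eq_div_of_mul_eq hΓ' hdup]
  field_simp

lemma symB_reflect_eq_ek_mul_rl (h : w.re < μ.re - ν.re - 2) :
    symB ν μ (μ - w - 2) = 2 ^ (ν + 1) * (Complex.Gamma ((ν - w + μ) / 2) *
      (Complex.Gamma ((μ - w - ν - 2) / 2))⁻¹ *
      (Complex.Gamma (μ - w - ν - 2) * (Complex.Gamma (-w))⁻¹)) := by
  rw [symB_eq_rl_mul_ek (by simpa using by linarith)]
  ring_nf

lemma symE_reflect_eq_rl_mul_ek (h : w.re < -ν.re - 1) :
    symE ν μ (μ - w - 2) = Complex.Gamma (μ - w - 1) * (Complex.Gamma (-w - ν - 1))⁻¹ *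
      (Complex.Gamma ((-w - ν - 1) / 2) * (Complex.Gamma ((ν + 1 - w) / 2))⁻¹ *
      2 ^ (-(ν + 1))) := by
  rw [symE_eq_ek_mul_rl (by simpa using by linarith)]
  ring_nf

lemma symB_eq_rl_mul_symB_one (h : -1 < w.re) :
    symB ν μ w = Complex.Gamma (w + 1) * (Complex.Gamma (w + 2 - μ))⁻¹ * symB ν 1 w := by
  have hΓ : Complex.Gamma (w + 1) ≠ 0 :=
    Complex.Gamma_ne_zero_of_re_pos (by simpa using by linarith)
  rw [symB, symB, show w + 2 - 1 = w + 1 by ring]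
  field_simp

lemma symE_eq_symE_one_mul_rl (h : μ.re - 2 < w.re) :
    symE ν μ w = symE ν 1 (w + 1 - μ) *
      (Complex.Gamma (w + 1) * (Complex.Gamma (w + 2 - μ))⁻¹) := by
  have hΓ : Complex.Gamma (w + 2 - μ) ≠ 0 :=
    Complex.Gamma_ne_zero_of_re_pos (by simpa using by linarith)
  rw [symE, symE, show w + 1 - μ + 1 = w + 2 - μ by ring,
    show w + 1 - μ + 2 - ν - 1 = w + 2 - ν - μ by ring,
    show w + 1 - μ + 3 + ν - 1 = w + 3 + ν - μ by ring,
    show (1 : ℂ) - 1 - (w + 1 - μ) = μ - 1 - w by ring]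
  field_simp

end SymbolIdentities

/-! ### Factorizations -/

section Factorizations

variable {ν μ : ℂ} {a b : ℝ} {f : ℝ → ℂ}

theorem opBL_factorization (hf : PowerTypeZero a f) (h1 : ν.re < a) (h2 : -ν.re - 2 < a) :
    BLDefined ν μ f ∧
      EkLDefined (-(ν + 1)) (ν + 1 / 2) (mulTwoDiv (ν + 1) f) ∧
      RlLDefined (ν + 2 - μ) (ekL (-(ν + 1)) (ν + 1 / 2) (mulTwoDiv (ν + 1) f)) ∧
      EqOn (opBL ν μ f)
        (rlL (ν + 2 - μ) (ekL (-(ν + 1)) (ν + 1 / 2) (mulTwoDiv (ν + 1) f))) (Ioi 0) := by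
  obtain ⟨γ, hγ, hγa⟩ := exists_between (max_lt h1 h2)
  obtain ⟨hγ1, hγ2⟩ := max_lt_iff.1 hγ
  obtain ⟨Φ, hΦ⟩ := hf.exists_isSuperpos hγa
  obtain ⟨hB, hB'⟩ := hΦ.opBL ν μ (by simpa using by linarith) (by simpa using by linarith)
  obtain ⟨hEK, hEK'⟩ := (hΦ.mulTwoDiv isExhaustion_leftSets (ν + 1)).ekL (-(ν + 1)) (ν + 1 / 2)
    (by simpa using by linarith)
  obtain ⟨hRL, hRL'⟩ := hEK'.rlL (ν + 2 - μ) (by simpa using by linarith)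
  refine ⟨hB, hEK, hRL, hB'.eqOn isExhaustion_leftSets hRL' (fun w hw => ?_) (by ring)⟩
  rw [add_zero, symB_eq_rl_mul_ek (by simpa [hw] using by linarith)]
  ring_nf

theorem opEL_factorization (hf : PowerTypeZero a f) (h1 : -1 < a) (h2 : μ.re - 1 < a)
    (h3 : (ν + μ).re - 1 < a) :
    ELDefined ν μ f ∧ RlLDefined (-(ν + μ)) f ∧
      EkLDefined (ν + 1) (-1 / 2) (rlL (-(ν + μ)) f) ∧
      EqOn (opEL ν μ f)
        (mulDivTwo (ν + 1) (ekL (ν + 1) (-1 / 2) (rlL (-(ν + μ)) f))) (Ioi 0) := by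
  rw [Complex.add_re] at h3
  obtain ⟨γ, hγ, hγa⟩ := exists_between (max_lt h1 (max_lt h2 h3))
  obtain ⟨hγ1, hγ2, hγ3⟩ : -1 < γ ∧ μ.re - 1 < γ ∧ ν.re + μ.re - 1 < γ := by
    simpa only [max_lt_iff] using hγ
  obtain ⟨Φ, hΦ⟩ := hf.exists_isSuperpos hγa
  obtain ⟨hE, hE'⟩ := hΦ.opEL ν μ (by simpa using by linarith) (by simpa using by linarith)
  obtain ⟨hRL, hRL'⟩ := hΦ.rlL (-(ν + μ)) (by simpa using by linarith)
  obtain ⟨hEK, hEK'⟩ := hRL'.ekL (ν + 1) (-1 / 2) (by simpa using by linarith)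
  have hfactor := hEK'.mulDivTwo isExhaustion_leftSets (ν + 1)
  refine ⟨hE, hRL, hEK, hE'.eqOn isExhaustion_leftSets hfactor (fun w hw => ?_) (by ring)⟩
  rw [add_zero, symE_eq_ek_mul_rl (by simpa [hw] using by linarith)]
  ring_nf

theorem opBR_factorization (hf : PowerTypeInfty b f) (h1 : 1 < b) (h2 : (ν - μ).re + 4 < b)
    (h3 : -(ν + μ).re < b) :
    BRDefined ν μ f ∧ RlRDefined (ν - μ + 2) f ∧
      EkRDefined (-(ν + 1)) (ν + 1) (rlR (ν - μ + 2) f) ∧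
      EqOn (opBR ν μ f)
        (mulTwoDiv (ν + 1) (ekR (-(ν + 1)) (ν + 1) (rlR (ν - μ + 2) f))) (Ioi 0) := by
  rw [Complex.sub_re] at h2
  rw [Complex.add_re] at h3
  obtain ⟨γ, hγ, hγb⟩ := exists_between (max_lt h1 (max_lt h2 h3))
  obtain ⟨hγ1, hγ2, hγ3⟩ : 1 < γ ∧ ν.re - μ.re + 4 < γ ∧ -(ν.re + μ.re) < γ := by
    simpa only [max_lt_iff] using hγ
  obtain ⟨Φ, hΦ⟩ := hf.exists_isSuperpos hγb
  obtain ⟨hB, hB'⟩ := hΦ.opBR ν μ (by simpa using by linarith) (by simpa using by linarith)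
  obtain ⟨hRL, hRL'⟩ := hΦ.rlR (ν - μ + 2) (by simpa using by linarith) (by simpa using by linarith)
  obtain ⟨hEK, hEK'⟩ := hRL'.ekR (-(ν + 1)) (ν + 1)
    (by simpa using by linarith) (by simpa using by linarith)
  have hfactor := hEK'.mulTwoDiv isExhaustion_rightSets (ν + 1)
  refine ⟨hB, hRL, hEK, hB'.eqOn isExhaustion_rightSets hfactor (fun w hw => ?_) (by ring)⟩
  rw [add_zero, symB_reflect_eq_ek_mul_rl (by simpa [hw] using by linarith)]
  ring_nf

theorem opER_factorization (hf : PowerTypeInfty b f) (h1 : ν.re + 2 < b) (h2 : 1 - ν.re < b)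
    (h3 : 1 - μ.re < b) :
    ERDefined ν μ f ∧ EkRDefined (ν + 1) 0 (mulDivTwo (ν + 1) f) ∧
      RlRDefined (-(ν + μ)) (ekR (ν + 1) 0 (mulDivTwo (ν + 1) f)) ∧
      EqOn (opER ν μ f)
        (rlR (-(ν + μ)) (ekR (ν + 1) 0 (mulDivTwo (ν + 1) f))) (Ioi 0) := by
  obtain ⟨γ, hγ, hγb⟩ := exists_between (max_lt h1 (max_lt h2 h3))
  obtain ⟨hγ1, hγ2, hγ3⟩ : ν.re + 2 < γ ∧ 1 - ν.re < γ ∧ 1 - μ.re < γ := by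
    simpa only [max_lt_iff] using hγ
  obtain ⟨Φ, hΦ⟩ := hf.exists_isSuperpos hγb
  obtain ⟨hE, hE'⟩ := hΦ.opER ν μ (by simpa using by linarith) (by simpa using by linarith)
  obtain ⟨hEK, hEK'⟩ := (hΦ.mulDivTwo isExhaustion_rightSets (ν + 1)).ekR (ν + 1) 0
    (by simpa using by linarith) (by simpa using by linarith)
  obtain ⟨hRL, hRL'⟩ := hEK'.rlR (-(ν + μ))
    (by simpa using by linarith) (by simpa using by linarith)
  refine ⟨hE, hEK, hRL, hE'.eqOn isExhaustion_rightSets hRL' (fun w hw => ?_) (by ring)⟩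
  rw [add_zero, symE_reflect_eq_rl_mul_ek (by simpa [hw] using by linarith)]
  ring_nf

theorem zeroSL_factorization (hf : PowerTypeZero a f) (h1 : ν.re < a) (h2 : -ν.re - 2 < a) :
    ZeroSLDefined ν f ∧
      EkLDefined (-(ν + 1)) (ν + 1 / 2) (mulTwoDiv (ν + 1) f) ∧
      RlLDefined (ν + 1) (ekL (-(ν + 1)) (ν + 1 / 2) (mulTwoDiv (ν + 1) f)) ∧
      EqOn (zeroSL ν f)
        (rlL (ν + 1) (ekL (-(ν + 1)) (ν + 1 / 2) (mulTwoDiv (ν + 1) f))) (Ioi 0) := by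
  have h := opBL_factorization (μ := 1) hf h1 h2
  rwa [blDefined_one, opBL_one, show ν + 2 - 1 = ν + 1 by ring] at h

theorem zeroPL_factorization (hf : PowerTypeZero a f) (h1 : 0 < a) (h2 : ν.re < a) :
    ZeroPLDefined ν f ∧ RlLDefined (-(ν + 1)) f ∧
      EkLDefined (ν + 1) (-1 / 2) (rlL (-(ν + 1)) f) ∧
      EqOn (zeroPL ν f)
        (mulDivTwo (ν + 1) (ekL (ν + 1) (-1 / 2) (rlL (-(ν + 1)) f))) (Ioi 0) := by
  have h := opEL_factorization (ν := ν) (μ := 1) hf (by linarith) (by simpa using h1)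
    (by simpa using h2)
  rwa [elDefined_one, opEL_one] at h

theorem zeroPR_factorization (hf : PowerTypeInfty b f) (h1 : 1 < b) (h2 : ν.re + 3 < b)
    (h3 : -ν.re - 1 < b) :
    ZeroPRDefined ν f ∧ RlRDefined (ν + 1) f ∧
      EkRDefined (-(ν + 1)) (ν + 1) (rlR (ν + 1) f) ∧
      EqOn (zeroPR ν f)
        (mulTwoDiv (ν + 1) (ekR (-(ν + 1)) (ν + 1) (rlR (ν + 1) f))) (Ioi 0) := by
  have h := opBR_factorization (ν := ν) (μ := 1) hf h1 (by simpa using by linarith)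
    (by simpa using by linarith)
  rwa [brDefined_one, opBR_one, show ν - 1 + 2 = ν + 1 by ring] at h

theorem zeroSR_factorization (hf : PowerTypeInfty b f) (h1 : ν.re + 2 < b) (h2 : 1 - ν.re < b) :
    ZeroSRDefined ν f ∧ EkRDefined (ν + 1) 0 (mulDivTwo (ν + 1) f) ∧
      RlRDefined (-(ν + 1)) (ekR (ν + 1) 0 (mulDivTwo (ν + 1) f)) ∧
      EqOn (zeroSR ν f)
        (rlR (-(ν + 1)) (ekR (ν + 1) 0 (mulDivTwo (ν + 1) f))) (Ioi 0) := by
  have h := opER_factorization (ν := ν) (μ := 1) hf h1 h2 (by simpa using by linarith)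
  rwa [erDefined_one, opER_one] at h

theorem opBL_eq_rlL_zeroSL (hf : PowerTypeZero a f) (h1 : -1 < a) (h2 : ν.re - 1 < a)
    (h3 : -ν.re - 2 < a) :
    BLDefined ν μ f ∧ ZeroSLDefined ν f ∧ RlLDefined (1 - μ) (zeroSL ν f) ∧
      EqOn (opBL ν μ f) (rlL (1 - μ) (zeroSL ν f)) (Ioi 0) := by
  obtain ⟨γ, hγ, hγa⟩ := exists_between (max_lt h1 (max_lt h2 h3))
  obtain ⟨hγ1, hγ2, hγ3⟩ : -1 < γ ∧ ν.re - 1 < γ ∧ -ν.re - 2 < γ := by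
    simpa only [max_lt_iff] using hγ
  obtain ⟨Φ, hΦ⟩ := hf.exists_isSuperpos hγa
  obtain ⟨hB, hB'⟩ := hΦ.opBL ν μ (by simpa using by linarith) (by simpa using by linarith)
  obtain ⟨hS, hS'⟩ := hΦ.opBL ν 1 (by simpa using by linarith) (by simpa using by linarith)
  rw [blDefined_one] at hS
  rw [opBL_one] at hS'
  obtain ⟨hRL, hRL'⟩ := hS'.rlL (1 - μ) (by simpa using by linarith)
  refine ⟨hB, hS, hRL, hB'.eqOn isExhaustion_leftSets hRL' (fun w hw => ?_) (by ring)⟩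
  rw [add_zero, symB_eq_rl_mul_symB_one (by simpa [hw] using by linarith)]
  ring_nf

theorem opEL_eq_zeroPL_rlL (hf : PowerTypeZero a f) (h1 : -1 < a) (h2 : μ.re - 1 < a) :
    ELDefined ν μ f ∧ RlLDefined (1 - μ) f ∧ ZeroPLDefined ν (rlL (1 - μ) f) ∧
      EqOn (opEL ν μ f) (zeroPL ν (rlL (1 - μ) f)) (Ioi 0) := by
  obtain ⟨γ, hγ, hγa⟩ := exists_between (max_lt h1 h2)
  obtain ⟨hγ1, hγ2⟩ := max_lt_iff.1 hγ
  obtain ⟨Φ, hΦ⟩ := hf.exists_isSuperpos hγa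
  obtain ⟨hE, hE'⟩ := hΦ.opEL ν μ (by simpa using by linarith) (by simpa using by linarith)
  obtain ⟨hRL, hRL'⟩ := hΦ.rlL (1 - μ) (by simpa using by linarith)
  obtain ⟨hP, hP'⟩ := hRL'.opEL ν 1 (by simpa using by linarith) (by simpa using by linarith)
  rw [elDefined_one] at hP
  rw [opEL_one] at hP'
  refine ⟨hE, hRL, hP, hE'.eqOn isExhaustion_leftSets hP' (fun w hw => ?_) (by ring)⟩
  rw [add_zero, symE_eq_symE_one_mul_rl (by simpa [hw] using by linarith)]
  ring_nf

theorem opBR_eq_zeroPR_rlR (hf : PowerTypeInfty b f) (h1 : 1 < b) (h2 : 1 - μ.re < b)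
    (h3 : (ν - μ).re + 1 < b) (h4 : -(ν + μ).re < b) :
    BRDefined ν μ f ∧ RlRDefined (1 - μ) f ∧ ZeroPRDefined ν (rlR (1 - μ) f) ∧
      EqOn (opBR ν μ f) (zeroPR ν (rlR (1 - μ) f)) (Ioi 0) := by
  rw [Complex.sub_re] at h3
  rw [Complex.add_re] at h4
  obtain ⟨γ, hγ, hγb⟩ := exists_between (max_lt h1 (max_lt h2 (max_lt h3 h4)))
  obtain ⟨hγ1, hγ2, hγ3, hγ4⟩ : 1 < γ ∧ 1 - μ.re < γ ∧ ν.re - μ.re + 1 < γ ∧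
      -(ν.re + μ.re) < γ := by
    simpa only [max_lt_iff] using hγ
  obtain ⟨Φ, hΦ⟩ := hf.exists_isSuperpos hγb
  obtain ⟨hB, hB'⟩ := hΦ.opBR ν μ (by simpa using by linarith) (by simpa using by linarith)
  obtain ⟨hRL, hRL'⟩ := hΦ.rlR (1 - μ) (by simpa using by linarith) (by simpa using by linarith)
  obtain ⟨hP, hP'⟩ := hRL'.opBR ν 1 (by simpa using by linarith) (by simpa using by linarith)
  rw [brDefined_one] at hP
  rw [opBR_one] at hP'
  refine ⟨hB, hRL, hP, hB'.eqOn isExhaustion_rightSets hP' (fun w hw => ?_) (by ring)⟩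
  rw [add_zero, symB_eq_rl_mul_symB_one (by simpa [hw] using by linarith)]
  ring_nf

theorem opER_eq_rlR_zeroSR (hf : PowerTypeInfty b f) (h1 : 1 < b) (h2 : 1 - μ.re < b) :
    ERDefined ν μ f ∧ ZeroSRDefined ν f ∧ RlRDefined (1 - μ) (zeroSR ν f) ∧
      EqOn (opER ν μ f) (rlR (1 - μ) (zeroSR ν f)) (Ioi 0) := by
  obtain ⟨γ, hγ, hγb⟩ := exists_between (max_lt h1 h2)
  obtain ⟨hγ1, hγ2⟩ := max_lt_iff.1 hγ
  obtain ⟨Φ, hΦ⟩ := hf.exists_isSuperpos hγb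
  obtain ⟨hE, hE'⟩ := hΦ.opER ν μ (by simpa using by linarith) (by simpa using by linarith)
  obtain ⟨hS, hS'⟩ := hΦ.opER ν 1 (by simpa using by linarith) (by simpa using by linarith)
  rw [erDefined_one] at hS
  rw [opER_one] at hS'
  obtain ⟨hRL, hRL'⟩ := hS'.rlR (1 - μ) (by simpa using by linarith) (by simpa using by linarith)
  refine ⟨hE, hS, hRL, hE'.eqOn isExhaustion_rightSets hRL' (fun w hw => ?_) (by ring)⟩
  rw [add_zero, symE_eq_symE_one_mul_rl (by simpa [hw] using by linarith)]
  ring_nf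

end Factorizations

end BuschmanErdelyi

open BuschmanErdelyi in
theorem theorem14 (ν μ : ℂ) :
    -- factorizations of the four operators through Riemann–Liouville and Erdélyi–Kober operators
    (∀ (f : ℝ → ℂ) (a : ℝ), PowerTypeZero a f → ν.re < a → -ν.re - 2 < a →
      BLDefined ν μ f ∧
      EkLDefined (-(ν + 1)) (ν + 1 / 2) (mulTwoDiv (ν + 1) f) ∧
      RlLDefined (ν + 2 - μ) (ekL (-(ν + 1)) (ν + 1 / 2) (mulTwoDiv (ν + 1) f)) ∧
      Set.EqOn (opBL ν μ f)
        (rlL (ν + 2 - μ) (ekL (-(ν + 1)) (ν + 1 / 2) (mulTwoDiv (ν + 1) f))) (Set.Ioi 0)) ∧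
    (∀ (f : ℝ → ℂ) (a : ℝ), PowerTypeZero a f →
        -1 < a → μ.re - 1 < a → (ν + μ).re - 1 < a →
      ELDefined ν μ f ∧
      RlLDefined (-(ν + μ)) f ∧
      EkLDefined (ν + 1) (-1 / 2) (rlL (-(ν + μ)) f) ∧
      Set.EqOn (opEL ν μ f)
        (mulDivTwo (ν + 1) (ekL (ν + 1) (-1 / 2) (rlL (-(ν + μ)) f))) (Set.Ioi 0)) ∧
    (∀ (f : ℝ → ℂ) (b : ℝ), PowerTypeInfty b f →
        1 < b → (ν - μ).re + 4 < b → -(ν + μ).re < b →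
      BRDefined ν μ f ∧
      RlRDefined (ν - μ + 2) f ∧
      EkRDefined (-(ν + 1)) (ν + 1) (rlR (ν - μ + 2) f) ∧
      Set.EqOn (opBR ν μ f)
        (mulTwoDiv (ν + 1) (ekR (-(ν + 1)) (ν + 1) (rlR (ν - μ + 2) f))) (Set.Ioi 0)) ∧
    (∀ (f : ℝ → ℂ) (b : ℝ), PowerTypeInfty b f →
        ν.re + 2 < b → 1 - ν.re < b → 1 - μ.re < b →
      ERDefined ν μ f ∧
      EkRDefined (ν + 1) 0 (mulDivTwo (ν + 1) f) ∧
      RlRDefined (-(ν + μ)) (ekR (ν + 1) 0 (mulDivTwo (ν + 1) f)) ∧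
      Set.EqOn (opER ν μ f)
        (rlR (-(ν + μ)) (ekR (ν + 1) 0 (mulDivTwo (ν + 1) f))) (Set.Ioi 0)) ∧
    -- factorizations of the operators of zero order of smoothness
    (∀ (f : ℝ → ℂ) (a : ℝ), PowerTypeZero a f → ν.re < a → -ν.re - 2 < a →
      ZeroSLDefined ν f ∧
      EkLDefined (-(ν + 1)) (ν + 1 / 2) (mulTwoDiv (ν + 1) f) ∧
      RlLDefined (ν + 1) (ekL (-(ν + 1)) (ν + 1 / 2) (mulTwoDiv (ν + 1) f)) ∧
      Set.EqOn (zeroSL ν f)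
        (rlL (ν + 1) (ekL (-(ν + 1)) (ν + 1 / 2) (mulTwoDiv (ν + 1) f))) (Set.Ioi 0)) ∧
    (∀ (f : ℝ → ℂ) (a : ℝ), PowerTypeZero a f → 0 < a → ν.re < a →
      ZeroPLDefined ν f ∧
      RlLDefined (-(ν + 1)) f ∧
      EkLDefined (ν + 1) (-1 / 2) (rlL (-(ν + 1)) f) ∧
      Set.EqOn (zeroPL ν f)
        (mulDivTwo (ν + 1) (ekL (ν + 1) (-1 / 2) (rlL (-(ν + 1)) f))) (Set.Ioi 0)) ∧
    (∀ (f : ℝ → ℂ) (b : ℝ), PowerTypeInfty b f → 1 < b → ν.re + 3 < b → -ν.re - 1 < b →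
      ZeroPRDefined ν f ∧
      RlRDefined (ν + 1) f ∧
      EkRDefined (-(ν + 1)) (ν + 1) (rlR (ν + 1) f) ∧
      Set.EqOn (zeroPR ν f)
        (mulTwoDiv (ν + 1) (ekR (-(ν + 1)) (ν + 1) (rlR (ν + 1) f))) (Set.Ioi 0)) ∧
    (∀ (f : ℝ → ℂ) (b : ℝ), PowerTypeInfty b f → ν.re + 2 < b → 1 - ν.re < b →
      ZeroSRDefined ν f ∧
      EkRDefined (ν + 1) 0 (mulDivTwo (ν + 1) f) ∧
      RlRDefined (-(ν + 1)) (ekR (ν + 1) 0 (mulDivTwo (ν + 1) f)) ∧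
      Set.EqOn (zeroSR ν f)
        (rlR (-(ν + 1)) (ekR (ν + 1) 0 (mulDivTwo (ν + 1) f))) (Set.Ioi 0)) ∧
    -- each operator is the composition of a zero-order operator with `I^{1-μ}`
    (∀ (f : ℝ → ℂ) (a : ℝ), PowerTypeZero a f → -1 < a → ν.re - 1 < a → -ν.re - 2 < a →
      BLDefined ν μ f ∧
      ZeroSLDefined ν f ∧
      RlLDefined (1 - μ) (zeroSL ν f) ∧
      Set.EqOn (opBL ν μ f) (rlL (1 - μ) (zeroSL ν f)) (Set.Ioi 0)) ∧
    (∀ (f : ℝ → ℂ) (a : ℝ), PowerTypeZero a f → -1 < a → μ.re - 1 < a →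
      ELDefined ν μ f ∧
      RlLDefined (1 - μ) f ∧
      ZeroPLDefined ν (rlL (1 - μ) f) ∧
      Set.EqOn (opEL ν μ f) (zeroPL ν (rlL (1 - μ) f)) (Set.Ioi 0)) ∧
    (∀ (f : ℝ → ℂ) (b : ℝ), PowerTypeInfty b f →
        1 < b → 1 - μ.re < b → (ν - μ).re + 1 < b → -(ν + μ).re < b →
      BRDefined ν μ f ∧
      RlRDefined (1 - μ) f ∧
      ZeroPRDefined ν (rlR (1 - μ) f) ∧
      Set.EqOn (opBR ν μ f) (zeroPR ν (rlR (1 - μ) f)) (Set.Ioi 0)) ∧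
    (∀ (f : ℝ → ℂ) (b : ℝ), PowerTypeInfty b f → 1 < b → 1 - μ.re < b →
      ERDefined ν μ f ∧
      ZeroSRDefined ν f ∧
      RlRDefined (1 - μ) (zeroSR ν f) ∧
      Set.EqOn (opER ν μ f) (rlR (1 - μ) (zeroSR ν f)) (Set.Ioi 0)) := by
  exact ⟨fun _ _ => opBL_factorization, fun _ _ => opEL_factorization,
    fun _ _ => opBR_factorization, fun _ _ => opER_factorization,
    fun _ _ => zeroSL_factorization, fun _ _ => zeroPL_factorization,
    fun _ _ => zeroPR_factorization, fun _ _ => zeroSR_factorization,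
    fun _ _ => opBL_eq_rlL_zeroSL, fun _ _ => opEL_eq_zeroPL_rlL,
    fun _ _ => opBR_eq_zeroPR_rlR, fun _ _ => opER_eq_rlR_zeroSR⟩
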